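/- Let $P\subset\mathbb{R}^2$ be the closed region enclosed by a simple polygon (its boundary together with its interior). For $0<\alpha\le 180$, an $\alpha$-guard $g$ consists of a position $x_g\in P$ and a starting angle $v_g$; its visual field is the open angular interval $(v_g,v_g+\alpha)$ (in degrees), and $V^{\alpha}(g)$ is the set of points $q\ne x_g$ such that the segment $x_gq$ is contained in $P$ and the direction from $x_g$ to $q$ lies in the visual field of $g$. Several guards may share a position. A finite set $S$ of $\alpha$-guards guards $P$ if the regions $V^{\alpha}(g)$, $g\in S$, cover $P$ up to boundary points, that is, $\bigcup_{g\in S}\overline{V^{\alpha}(g)}=P$. Two different guards $g,h$ are incompatible if $V^{\alpha}(g)\cap V^{\alpha}(h)\neq\emptyset$. Let $\chi_G^{\alpha}(P)$ be the minimum, over all finite sets $S$ of $\alpha$-guards that guard $P$, of the least number of colors in a coloring of $S$ in which incompatible guards have different colors. Then $\chi_G^{180}(P)=1$, and $\chi_G^{\alpha}(P)\le 2$ for every $\alpha$ with $0<\alpha\le 180$. In particular, guard sets as above exist. -/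

import Mathlib

noncomputable section

namespace ChromaticGuarding

/-- The Euclidean plane. -/
abbrev Plane : Type := EuclideanSpace ℝ (Fin 2)

/-- A closed polygonal curve is simple if it has at least three edges, all of positive length,
consecutive edges meet exactly in their common vertex, and any two other edges are disjoint.
(`finRotate n i` is the cyclic successor of `i`.) -/
def IsSimple {n : ℕ} (poly : Polygon Plane n) : Prop :=
  3 ≤ n ∧ poly.HasNondegenerateEdges ∧
    (∀ i : Fin n, poly.edgeSet ℝ i ∩ poly.edgeSet ℝ (finRotate n i) = {poly (finRotate n i)}) ∧
    ∀ i j : Fin n, i ≠ j → j ≠ finRotate n i → i ≠ finRotate n j →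
      Disjoint (poly.edgeSet ℝ i) (poly.edgeSet ℝ j)

/-- The closed region enclosed by a polygonal curve: the curve together with the bounded
connected components of its complement. -/
def region {n : ℕ} (poly : Polygon Plane n) : Set Plane :=
  poly.boundary ℝ ∪
    {x | x ∉ poly.boundary ℝ ∧
      Bornology.IsBounded (connectedComponentIn (poly.boundary ℝ)ᶜ x)}

/-- The unit vector in the direction of the angle `θ`, measured in degrees. -/
def unitDir (θ : ℝ) : Plane := !₂[Real.cos (θ * (Real.pi / 180)), Real.sin (θ * (Real.pi / 180))]

/-- A guard is placed at a point, and its visual field starts at an angle `start` (in degrees). -/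
@[ext]
structure Guard where
  pos : Plane
  start : ℝ

/-- The region seen in `P` by an `α`-guard `g` with the (open) visual field
`(g.start, g.start + α)`: the points in a direction of the field whose segment from the guard
is contained in `P`. -/
def visibleRegion (P : Set Plane) (α : ℝ) (g : Guard) : Set Plane :=
  {q | segment ℝ g.pos q ⊆ P ∧
    ∃ r : ℝ, 0 < r ∧ ∃ θ ∈ Set.Ioo g.start (g.start + α), q = g.pos + r • unitDir θ}

/-- A finite set of `α`-guards located in `P` guards `P` if the regions they see cover `P`,
where limits of points seen by a guard count as covered. -/
def IsGuardSet (P : Set Plane) (α : ℝ) (S : Finset Guard) : Prop :=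
  (∀ g ∈ S, g.pos ∈ P) ∧ ⋃ g ∈ S, closure (visibleRegion P α g) = P

/-- Two different guards are incompatible if they see a common point. -/
def conflictGraph (P : Set Plane) (α : ℝ) (S : Finset Guard) : SimpleGraph S where
  Adj g h := g ≠ h ∧ (visibleRegion P α g ∩ visibleRegion P α h).Nonempty
  symm := ⟨fun _ _ hgh => ⟨hgh.1.symm, by rw [Set.inter_comm]; exact hgh.2⟩⟩
  loopless := ⟨fun _ hg => hg.1 rfl⟩

/-- The chromatic guarding number with `α`-guards: the minimum, over all guard sets, of the number
of colors needed so that incompatible guards have different colors (`⊤` if there is none). -/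
def chromaticGuardingNumber (P : Set Plane) (α : ℝ) : ℕ∞ :=
  ⨅ (S : Finset Guard) (_ : IsGuardSet P α S), (conflictGraph P α S).chromaticNumber

end ChromaticGuarding

end

/-!
A single guard with a field of 180 degrees per window suffices, and the visible regions of the
guards can be made disjoint. The argument runs in the complex plane (`toPlane` transfers it).

Let `x` be an interior point of the region `P`. The part of `P` that is not visible from `x` is
divided into pockets. Each pocket lies behind a window: the visible continuation (`chord`) of a ray
from `x` beyond a vertex `v` that it touches. A guard placed on the window just beyond `v`, whose
field is the half plane on the side of the pocket, sees only points of the pocket, and what it does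
not see of the pocket is divided into pockets behind its own windows (`IsPocket.isNode`,
`IsPolygonal.exists_pockets`). The vertex `v` belongs to the old pocket and not to the new one, so
the recursion ends (`IsNode.exists_guardsPart`). Starting with two opposite guards at any interior
point gives finitely many guards with disjoint visible regions that cover a dense part of `P`
(`IsPolygonal.exists_guards`), hence one color is enough.

The topological input is that a chord separates its two sides in `P` (`chord_separates`). The
complement of `P` is connected, hence for every point `p` outside `P` there is a continuous
logarithm of `q - p` on `P` (`exists_continuous_log`). With these one builds a continuous logarithm
of the quotient `(q - z) / (q - v)` on `P \ {v}`, where `v` is the start of the chord and `z` a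
point outside `P` just beyond its end. The principal logarithm of this quotient is continuous off
the chord and jumps by `2πi` across it, whereas the difference of two continuous logarithms is
constant on connected sets.

For smaller `α`, a field of 180 degrees contains `⌊180 / α⌋` consecutive disjoint fields of `α`
degrees, and one more such field at its end covers the rest. The former get one color and the latter
another. Only finitely many rays are lost, so the guards still cover a dense part of `P`
(`chromaticGuardingNumber_le_two`).

What the construction needs to know about `P` is collected in `IsPolygonal`. It holds for the region
enclosed by a simple polygon (`IsSimpleCurve.isPolygonal`): around each of its points the curve
consists of two radii (`IsLocalArc`), so every point has two sides, each of which is enclosed or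
not. At least one of them is enclosed at each point of an edge, again by a comparison of logarithms
(`exists_mem_fill_near`): the polygon stays connected when one point is removed.
-/

namespace ChromaticGuarding

open Set Metric Complex

/-! ### Continuous logarithms on compact sets with connected complement -/

lemma div_mem_slitPlane {q a b : ℂ} (h : q ∉ segment ℝ a b) : (q - a) / (q - b) ∈ slitPlane := by
  have hb : q - b ≠ 0 := fun hb => h (by rw [sub_eq_zero.1 hb]; exact right_mem_segment ℝ a b)
  by_contra hs
  rw [mem_slitPlane_iff_not_le_zero, not_not] at hs
  obtain ⟨t, ht⟩ : ∃ t : ℝ, (q - a) / (q - b) = -(t : ℂ) := by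
    refine ⟨-((q - a) / (q - b)).re, ?_⟩
    apply Complex.ext
    · simp
    · simpa using (Complex.le_def.1 hs).2
  have ht0 : 0 ≤ t := by
    rw [ht] at hs
    have := (Complex.le_def.1 hs).1
    simpa using this
  rw [div_eq_iff hb] at ht
  apply h
  refine ⟨1 / (1 + t), t / (1 + t), by positivity, by positivity, by field_simp, ?_⟩
  have h1 : (1 + t : ℂ) ≠ 0 := by
    have : (1 + t : ℝ) ≠ 0 := by positivity
    exact_mod_cast this
  simp only [real_smul]
  push_cast
  field_simp
  linear_combination -ht

/-- On a compact set `P` with connected complement, `q - p` has a continuous logarithm for every `p`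
outside `P`: far away from `P` it exists, and the points `p` for which it exists form an open and
closed subset of the complement. -/
lemma exists_continuous_log {P : Set ℂ} (hP : IsCompact P) (hc : IsPreconnected Pᶜ) {p : ℂ}
    (hp : p ∉ P) : ∃ L : ℂ → ℂ, ContinuousOn L P ∧ ∀ q ∈ P, exp (L q) = q - p := by
  -- the points that admit a logarithm form an open and closed subset of the complement
  set G : Set ℂ := {p | p ∉ P ∧ ∃ L : ℂ → ℂ, ContinuousOn L P ∧ ∀ q ∈ P, exp (L q) = q - p}
  have key : ∀ p ∈ G, ∀ p', (∀ q ∈ P, ‖p' - p‖ < ‖q - p‖) → p' ∈ G := by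
    rintro p ⟨hpP, L, hL, hexp⟩ p' hp'
    have hne : ∀ q ∈ P, q - p ≠ 0 := fun q hq h => hpP (by rwa [← sub_eq_zero.1 h])
    have hs : ∀ q ∈ P, (q - p') / (q - p) ∈ slitPlane := by
      intro q hq
      have h1 : (q - p') / (q - p) = 1 - (p' - p) / (q - p) := by
        field_simp [hne q hq]; ring
      left
      rw [h1]
      have h2 : ‖(p' - p) / (q - p)‖ < 1 := by
        rw [norm_div, div_lt_one (norm_pos_iff.2 (hne q hq))]
        exact hp' q hq
      have := (abs_lt.1 ((Complex.abs_re_le_norm _).trans_lt h2)).2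
      simp only [sub_re, one_re]
      linarith
    refine ⟨fun hpP' => lt_irrefl _ (hp' p' hpP'),
      fun q => L q + log ((q - p') / (q - p)), ?_, ?_⟩
    · refine hL.add (ContinuousOn.clog ?_ hs)
      exact ContinuousOn.div (by fun_prop) (by fun_prop) hne
    · intro q hq
      rw [exp_add, hexp q hq, exp_log (slitPlane_ne_zero (hs q hq))]
      field_simp [hne q hq]
  obtain ⟨R, hR⟩ := hP.isBounded.exists_norm_le
  have hfar : (((|R| + 1 : ℝ) : ℂ)) ∈ G := by
    have hn : ∀ q ∈ P, ‖q‖ < |R| + 1 := fun q hq =>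
      lt_of_le_of_lt ((hR q hq).trans (le_abs_self R)) (lt_add_one _)
    have hs : ∀ q ∈ P, ((|R| + 1 : ℝ) : ℂ) - q ∈ slitPlane := by
      intro q hq
      left
      have := (abs_lt.1 ((Complex.abs_re_le_norm q).trans_lt (hn q hq))).2
      simp only [sub_re, ofReal_re]
      linarith
    refine ⟨fun h => ?_, fun q => log (((|R| + 1 : ℝ) : ℂ) - q) + log (-1), ?_, ?_⟩
    · have := hn _ h
      rw [norm_real, Real.norm_eq_abs, abs_of_pos (by positivity)] at this
      exact lt_irrefl _ this
    · exact (ContinuousOn.clog (by fun_prop) hs).add continuousOn_const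
    · intro q hq
      rw [exp_add, exp_log (slitPlane_ne_zero (hs q hq)), exp_log (by norm_num)]
      ring
  have hopen : IsOpen Pᶜ := hP.isClosed.isOpen_compl
  have hsub : Pᶜ ⊆ G := by
    refine IsPreconnected.subset_of_closure_inter_subset hc ?_ ⟨_, hfar.1, hfar⟩ ?_
    · rw [Metric.isOpen_iff]
      intro a ha
      obtain ⟨ε, hε, hball⟩ := Metric.isOpen_iff.1 hopen a ha.1
      refine ⟨ε, hε, fun b hb => key a ha b fun q hq => ?_⟩
      have h1 : ε ≤ ‖q - a‖ := by
        by_contra! hlt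
        exact hball (by rwa [mem_ball, dist_eq_norm]) hq
      rw [mem_ball, dist_eq_norm] at hb
      linarith
    · rintro a ⟨ha, haP⟩
      obtain ⟨ε, hε, hball⟩ := Metric.isOpen_iff.1 hopen a haP
      obtain ⟨b, hb, hab⟩ := Metric.mem_closure_iff.1 ha (ε / 2) (by positivity)
      refine key b hb a fun q hq => ?_
      have h1 : ε ≤ ‖q - a‖ := by
        by_contra! hlt
        exact hball (by rwa [mem_ball, dist_eq_norm]) hq
      rw [dist_eq_norm] at hab
      have h2 : ‖q - a‖ ≤ ‖q - b‖ + ‖a - b‖ := by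
        have := norm_sub_le (q - b) (a - b)
        simpa using this
      linarith
  exact (hsub hp).2

/-- A continuous choice of logarithms of `1` is constant on a preconnected set. -/
lemma eq_of_exp_eq_one {A : Set ℂ} (hA : IsPreconnected A) {f : ℂ → ℂ} (hf : ContinuousOn f A)
    (h1 : ∀ q ∈ A, exp (f q) = 1) {a b : ℂ} (ha : a ∈ A) (hb : b ∈ A) : f a = f b := by
  choose! k hk using fun q hq => exp_eq_one_iff.1 (h1 q hq)
  have him : ∀ q ∈ A, (f q).im / (2 * Real.pi) = k q := by
    intro q hq
    rw [hk q hq]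
    have : ((k q : ℂ) * (2 * Real.pi * I)).im = k q * (2 * Real.pi) := by simp
    rw [this]
    field_simp
  have hc : ContinuousOn (fun q => (f q).im / (2 * Real.pi)) A :=
    (continuous_im.comp_continuousOn hf).div_const _
  have hkc : ContinuousOn (fun q => k q) A := by
    have h2 : ContinuousOn (fun q => ((k q : ℤ) : ℝ)) A := hc.congr fun q hq => (him q hq).symm
    have := Int.isClosedEmbedding_coe_real.isInducing.continuousOn_iff (f := k) (s := A)
    exact this.2 h2
  have hab : k a = k b := hA.constant hkc ha hb
  rw [hk a ha, hk b hb, hab]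

/-- A chord of a compact set with connected complement separates its two sides. The chord
`[v, z]` runs on a line, `z` lies outside of `P`, and `v` is accessible from outside of `P` along
the segment `[v, v']`. The function `g - log h` below is a continuous choice of logarithms of `1`
on the part of `P` off the chord, and it jumps by `2πi` across the chord. -/
lemma chord_separates {P : Set ℂ} (hP : IsCompact P) (hc : IsPreconnected Pᶜ) {v v' d n c : ℂ}
    {s T r δ : ℝ} (hd : d ≠ 0) (hs : 0 < s) (hsT : s < T) (hc' : c = v + s * d)
    (hz : v + T * d ∉ P) (hv' : v' ∉ P) (hvv' : ∀ q ∈ P, q ≠ v → q ∉ segment ℝ v v')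
    (hball : ball c r ⊆ P) (hn : (n / d).im ≠ 0) (hδ : 0 < δ) (hδr : ‖δ * n‖ < r)
    {A : Set ℂ} (hA : IsPreconnected A) (hAP : A ⊆ P)
    (hAw : ∀ q ∈ A, q ∉ segment ℝ (v + T * d) v) (h1 : c + δ * n ∈ A) (h2 : c - δ * n ∈ A) :
    False := by
  set z := v + T * d with hzdef
  obtain ⟨L₁, hL₁, hexp₁⟩ := exists_continuous_log hP hc hz
  obtain ⟨L₂, hL₂, hexp₂⟩ := exists_continuous_log hP hc hv'
  set g : ℂ → ℂ := fun q => L₁ q - L₂ q - log ((q - v) / (q - v')) with hg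
  set h : ℂ → ℂ := fun q => (q - z) / (q - v) with hh
  have hne' : ∀ q ∈ P, q - v' ≠ 0 := fun q hq h => hv' (by rwa [← sub_eq_zero.1 h])
  have hgc : ContinuousOn g (P \ {v}) := by
    refine ((hL₁.mono sdiff_subset).sub (hL₂.mono sdiff_subset)).sub (ContinuousOn.clog ?_ ?_)
    · exact ContinuousOn.div (by fun_prop) (by fun_prop) fun q hq => hne' q hq.1
    · exact fun q hq => div_mem_slitPlane (hvv' q hq.1 hq.2)
  have hgexp : ∀ q ∈ P \ {v}, exp (g q) = h q := by
    intro q hq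
    have h3 : q - v ≠ 0 := sub_ne_zero.2 hq.2
    rw [hg, exp_sub, exp_sub, hexp₁ q hq.1, hexp₂ q hq.1,
      exp_log (div_ne_zero h3 (hne' q hq.1))]
    have := hne' q hq.1
    simp only [hh]
    field_simp
  -- the jump function is constant on preconnected sets off the chord
  have hconst : ∀ B : Set ℂ, IsPreconnected B → B ⊆ P → (∀ q ∈ B, q ∉ segment ℝ z v) →
      ∀ a ∈ B, ∀ b ∈ B, g a - log (h a) = g b - log (h b) := by
    intro B hB hBP hBw a ha b hb
    have hBv : ∀ q ∈ B, q ≠ v := fun q hq hqv =>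
      hBw q hq (hqv ▸ right_mem_segment ℝ z v)
    have hBs : B ⊆ P \ {v} := fun q hq => ⟨hBP hq, hBv q hq⟩
    refine eq_of_exp_eq_one (f := fun q => g q - log (h q)) hB
      ((hgc.mono hBs).sub (ContinuousOn.clog ?_ ?_)) ?_ ha hb
    · exact ContinuousOn.div (by fun_prop) (by fun_prop) fun q hq => sub_ne_zero.2 (hBv q hq)
    · exact fun q hq => div_mem_slitPlane (hBw q hq)
    · intro q hq
      have h3 : h q ≠ 0 := slitPlane_ne_zero (div_mem_slitPlane (hBw q hq))
      rw [exp_sub, hgexp q (hBs hq), exp_log h3, div_self h3]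
  have hr : 0 < r := (norm_nonneg _).trans_lt hδr
  have hcv : c ≠ v := by
    rw [hc']
    simp [hd, hs.ne']
  have hnear : P \ {v} ∈ nhds c :=
    Filter.inter_mem (Filter.mem_of_superset (ball_mem_nhds c hr) hball)
      (isOpen_compl_singleton.mem_nhds hcv)
  -- the argument of `h` is known at `c ± ε n`
  have hhv : ∀ ε : ℝ, h (c + ε * n) = 1 - T / (s + ε * (n / d)) := by
    intro ε
    simp only [hh]
    by_cases h0 : (s : ℂ) + ε * (n / d) = 0
    · have : c + ε * n - v = 0 := by
        rw [hc']
        have : (v + s * d + ε * n - v : ℂ) = d * (s + ε * (n / d)) := by field_simp; ring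
        rw [this, h0, mul_zero]
      have him : ε * (n / d).im = 0 := by simpa using congrArg Complex.im h0
      have hε : ε = 0 := by simpa [hn] using him
      rw [hε] at h0
      simp [hs.ne'] at h0
    · have h3 : (c + ε * n - v : ℂ) = d * (s + ε * (n / d)) := by rw [hc']; field_simp; ring
      have h4 : (c + ε * n - z : ℂ) = d * (s + ε * (n / d)) - T * d := by
        rw [hc', hzdef]; field_simp; ring
      rw [h3, h4, mul_comm (T : ℂ) d, ← mul_sub, mul_div_mul_left _ _ hd, sub_div, div_self h0]
  have him : ∀ ε : ℝ, (h (c + ε * n)).im =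
      T * (ε * (n / d).im) / normSq ((s : ℂ) + ε * (n / d)) := by
    intro ε
    rw [hhv, sub_im, div_im]
    simp
  have hcont : ContinuousAt (fun ε : ℝ => h (c + ε * n)) 0 := by
    have : ContinuousAt h c := by
      exact ContinuousAt.div (f := fun q => q - z) (g := fun q => q - v) (by fun_prop)
        (by fun_prop) (sub_ne_zero.2 hcv)
    refine ContinuousAt.comp (g := h) (f := fun ε : ℝ => c + ε * n) ?_ (by fun_prop)
    simpa using this
  have hT : 0 < T := hs.trans hsT
  have hre0 : (h (c + ((0 : ℝ) : ℂ) * n)).re < 0 := by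
    rw [hhv]
    have : (1 - (T : ℂ) / (s + ((0 : ℝ) : ℂ) * (n / d))) = ((1 - T / s : ℝ) : ℂ) := by
      push_cast; ring
    rw [this, ofReal_re, sub_neg, one_lt_div hs]
    exact hsT
  have hre : ∀ᶠ ε : ℝ in nhds 0, (h (c + ε * n)).re < 0 :=
    (continuous_re.continuousAt.comp hcont).eventually (gt_mem_nhds hre0)
  have hgcont : ContinuousAt (fun ε : ℝ => g (c + ε * n)) 0 := by
    refine ContinuousAt.comp (g := g) (f := fun ε : ℝ => c + ε * n) ?_ (by fun_prop)
    simpa using hgc.continuousAt hnear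
  have hgd : ∀ᶠ ε : ℝ in nhds 0, ‖g (c + ε * n) - g c‖ < Real.pi / 2 := by
    have := (Metric.continuousAt_iff'.1 hgcont) (Real.pi / 2) (by positivity)
    simpa [dist_eq_norm] using this
  obtain ⟨η, hη, hηs⟩ := Metric.eventually_nhds_iff.1 (hre.and hgd)
  set ε := min (η / 2) δ with hε
  have hε0 : 0 < ε := lt_min (by positivity) hδ
  have hεδ : ε ≤ δ := min_le_right _ _
  have hεη : ε < η := (min_le_left _ _).trans_lt (by linarith)
  have hp := hηs (y := ε) (by simpa [abs_of_pos hε0] using hεη)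
  have hm := hηs (y := -ε) (by simpa [abs_of_pos hε0] using hεη)
  -- points on one side of the chord are joined by a segment off the chord
  have hside : ∀ τ : ℝ, |τ| = 1 → g (c + (τ * δ : ℝ) * n) - log (h (c + (τ * δ : ℝ) * n)) =
      g (c + (τ * ε : ℝ) * n) - log (h (c + (τ * ε : ℝ) * n)) := by
    intro τ hτ
    have hτ0 : τ ≠ 0 := fun h => by simp [h] at hτ
    refine hconst ((fun t : ℝ => c + (τ * t : ℝ) * n) '' Icc ε δ)
      (isPreconnected_Icc.image _ (by fun_prop)) ?_ ?_ _
      ⟨δ, ⟨hεδ, le_rfl⟩, rfl⟩ _ ⟨ε, ⟨le_rfl, hεδ⟩, rfl⟩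
    · rintro _ ⟨t, ht, rfl⟩
      apply hball
      rw [mem_ball, dist_eq_norm]
      refine lt_of_le_of_lt ?_ hδr
      have ht0 : 0 < t := hε0.trans_le ht.1
      have : ‖c + (τ * t : ℝ) * n - c‖ = t * ‖n‖ := by
        rw [add_sub_cancel_left, norm_mul, norm_real, Real.norm_eq_abs, abs_mul, hτ, one_mul,
          abs_of_pos ht0]
      simp only [this, norm_mul, norm_real, Real.norm_eq_abs, abs_of_pos hδ]
      gcongr
      exact ht.2
    · rintro _ ⟨t, ht, rfl⟩ ⟨a, b, ha, hb, hab, hq⟩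
      have ht0 : 0 < t := hε0.trans_le ht.1
      have hq' : ((a * T : ℝ) : ℂ) = s + (τ * t : ℝ) * (n / d) := by
        have e : (a : ℂ) * (v + T * d) + b * v = v + s * d + (τ * t : ℝ) * n := by
          rw [← hzdef, ← hc']; simpa [real_smul] using hq
        have hab' : (a : ℂ) + b = 1 := by exact_mod_cast hab
        field_simp
        push_cast
        push_cast at e
        linear_combination e - v * hab'
      have := congrArg Complex.im hq'
      rw [add_im, im_ofReal_mul, ofReal_im, ofReal_im, zero_add] at this
      exact mul_ne_zero (mul_ne_zero hτ0 ht0.ne') hn this.symm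
  have e1 := hconst A hA hAP hAw _ h1 _ h2
  have e2 := hside 1 (by simp)
  have e3 := hside (-1) (by simp)
  simp only [one_mul, neg_mul, ofReal_neg, ← sub_eq_add_neg] at e2 e3
  rw [e2, e3] at e1
  have hm' := hm
  simp only [ofReal_neg, neg_mul, ← sub_eq_add_neg] at hm'
  have himp := him ε
  have himm := him (-ε)
  simp only [ofReal_neg, neg_mul, ← sub_eq_add_neg] at himm
  have hnsp : 0 < normSq ((s : ℂ) + ε * (n / d)) := by
    rw [normSq_pos]
    intro h0
    have := congrArg Complex.im h0
    simp [hε0.ne'] at this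
    exact hn (by simpa using this)
  have hnsm : 0 < normSq ((s : ℂ) - ε * (n / d)) := by
    rw [normSq_pos]
    intro h0
    have := congrArg Complex.im h0
    simp [hε0.ne'] at this
    exact hn (by simpa using this)
  set hp' := h (c + ε * n)
  set hm'' := h (c - ε * n)
  have hd1 : |(g (c + ε * n)).im - (g (c - ε * n)).im| < Real.pi := by
    have a1 := (Complex.abs_im_le_norm _).trans_lt hp.2
    have a2 := (Complex.abs_im_le_norm _).trans_lt hm'.2
    rw [sub_im, abs_lt] at a1 a2
    rw [abs_lt]
    constructor <;> linarith [a1.1, a1.2, a2.1, a2.2]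
  have e4 := congrArg Complex.im e1
  simp only [sub_im, log_im] at e4
  have hposarg : ∀ ζ : ℂ, ζ.re < 0 → 0 < ζ.im → Real.pi / 2 < arg ζ := by
    intro ζ hr hi
    by_contra! hle
    have h0 : 0 ≤ arg ζ := arg_nonneg_iff.2 hi.le
    have := (abs_arg_le_pi_div_two_iff (z := ζ)).1 (by rw [abs_of_nonneg h0]; exact hle)
    linarith
  have hnegarg : ∀ ζ : ℂ, ζ.re < 0 → ζ.im < 0 → arg ζ < -(Real.pi / 2) := by
    intro ζ hr hi
    by_contra! hle
    have h0 : arg ζ < 0 := arg_neg_iff.2 hi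
    have := (abs_arg_le_pi_div_two_iff (z := ζ)).1 (by rw [abs_of_neg h0]; linarith)
    linarith
  rw [abs_lt] at hd1
  rcases lt_or_gt_of_ne hn with hneg | hpos
  · have i1 : hp'.im < 0 := by
      rw [himp]
      exact div_neg_of_neg_of_pos (mul_neg_of_pos_of_neg hT (mul_neg_of_pos_of_neg hε0 hneg)) hnsp
    have i2 : 0 < hm''.im := by
      rw [himm]
      refine div_pos (mul_pos hT ?_) hnsm
      have := mul_neg_of_pos_of_neg hε0 hneg
      linarith
    have := hnegarg _ hp.1 i1
    have := hposarg _ hm'.1 i2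
    linarith [hd1.1, hd1.2]
  · have i1 : 0 < hp'.im := by
      rw [himp]
      exact div_pos (mul_pos hT (mul_pos hε0 hpos)) hnsp
    have i2 : hm''.im < 0 := by
      rw [himm]
      refine div_neg_of_neg_of_pos (mul_neg_of_pos_of_neg hT ?_) hnsm
      have := mul_pos hε0 hpos
      linarith
    have := hposarg _ hp.1 i1
    have := hnegarg _ hm'.1 i2
    linarith [hd1.1, hd1.2]

/-! ### Visibility and the abstract hypotheses on the region -/

/-- The points `q` such that the segment from `x` to `q` is contained in `P`. -/
def vis (P : Set ℂ) (x : ℂ) : Set ℂ := {q | segment ℝ x q ⊆ P}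

/-- The part of the ball of radius `r` around `c` strictly on the side of the normal `n`. -/
def halfBall (n c : ℂ) (r : ℝ) : Set ℂ := {q | q ∈ ball c r ∧ 0 < inner ℝ n (q - c)}

/-- The properties of a simple polygonal region that the construction of guards uses. Locally at
each of its points the region is a cone whose complement is connected, so two parts of the region
never touch in a single point; the connected complement makes it simply connected. A point of the
frontier can be the last obstacle on a segment that enters the interior only if it belongs to the
finite set `W`, the vertices of the polygon. -/
structure IsPolygonal (P : Set ℂ) (W : Finset ℂ) : Prop where
  compact : IsCompact P
  compl : IsPreconnected Pᶜ
  preconnected_interior : IsPreconnected (interior P)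
  subset_closure_interior : P ⊆ closure (interior P)
  conic : ∀ y ∈ P, ∃ r > 0, (∀ z, ‖z‖ < r → ∀ t ∈ Ioc (0 : ℝ) 1, (y + z ∈ P ↔ y + t • z ∈ P)) ∧
    IsPreconnected (ball y r \ P)
  corner : ∀ v ∈ P, v ∉ interior P → ∀ d : ℂ, ∀ r > 0,
    (∀ s ∈ Ioo (0 : ℝ) r, v + s • d ∈ interior P ∧ v - s • d ∈ P) → v ∈ W

lemma mem_vis_self {P : Set ℂ} {x : ℂ} (hx : x ∈ P) : x ∈ vis P x := by
  simpa [vis] using hx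

lemma isClosed_vis {P : Set ℂ} (hP : IsClosed P) (x : ℂ) : IsClosed (vis P x) := by
  have : vis P x = ⋂ t ∈ Icc (0 : ℝ) 1, (fun q => x + t • (q - x)) ⁻¹' P := by
    ext q
    simp only [vis, segment_eq_image', mem_ofPred_eq, image_subset_iff, mem_iInter, mem_preimage]
    rfl
  rw [this]
  exact isClosed_biInter fun t _ => hP.preimage (by fun_prop)

lemma ball_subset_vis {P : Set ℂ} {x : ℂ} {r : ℝ} (h : ball x r ⊆ P) : ball x r ⊆ vis P x := by
  intro q hq
  have hr : 0 < r := dist_nonneg.trans_lt hq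
  exact ((convex_ball x r).segment_subset (mem_ball_self hr) hq).trans h

/-- Visibility along a line, in terms of the parameters of the points. -/
lemma segment_line_subset_iff {P : Set ℂ} {v d : ℂ} {a b : ℝ} :
    segment ℝ (v + a • d) (v + b • d) ⊆ P ↔ ∀ u ∈ uIcc a b, v + u • d ∈ P := by
  have h : segment ℝ (v + a • d) (v + b • d) = (fun u : ℝ => v + u • d) '' uIcc a b := by
    rw [← segment_eq_uIcc]
    have := image_segment ℝ (AffineMap.lineMap (k := ℝ) v (v + d)) a b
    have e : ∀ u : ℝ, AffineMap.lineMap (k := ℝ) v (v + d) u = v + u • d := by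
      intro u; simp [AffineMap.lineMap_apply, add_comm]
    simp only [e] at this
    rw [← this]
  rw [h, image_subset_iff]
  rfl

lemma exists_smul_of_inner_eq_zero {n d z : ℂ} (hn : n ≠ 0) (hd : d ≠ 0)
    (hnd : inner ℝ n d = 0) (hnz : inner ℝ n z = 0) : ∃ t : ℝ, z = t • d := by
  rw [Complex.inner] at hnd hnz
  simp only [mul_re, conj_re, conj_im] at hnd hnz
  have hc : z.im * d.re - z.re * d.im = 0 := by
    have h1 : n.re * (z.im * d.re - z.re * d.im) = 0 := by
      linear_combination z.im * hnd - d.im * hnz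
    have h2 : n.im * (z.im * d.re - z.re * d.im) = 0 := by
      linear_combination d.re * hnz - z.re * hnd
    by_contra h
    exact hn (Complex.ext (by simpa [h] using h1) (by simpa [h] using h2))
  have h0 : (z / d).im = 0 := by
    rw [div_im]
    rw [← sub_div, hc, zero_div]
  refine ⟨(z / d).re, ?_⟩
  have : ((z / d).re : ℂ) = z / d := by
    apply Complex.ext <;> simp [h0]
  rw [real_smul, this]
  field_simp

lemma im_div_ne_zero {n d : ℂ} (hn : n ≠ 0) (hd : d ≠ 0) (hnd : inner ℝ n d = 0) :
    (n / d).im ≠ 0 := by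
  intro h
  rw [Complex.inner] at hnd
  simp only [mul_re, conj_re, conj_im] at hnd
  have hre : (n / d).re = 0 := by
    rw [div_re, ← add_div]
    have : n.re * d.re + n.im * d.im = 0 := by linarith
    rw [this, zero_div]
  have : n / d = 0 := Complex.ext hre h
  simp [hn, hd] at this

lemma convex_halfBall (n c : ℂ) (r : ℝ) : Convex ℝ (halfBall n c r) := by
  have h : Convex ℝ {q : ℂ | inner ℝ n c < inner ℝ n q} :=
    convex_halfSpace_gt (f := fun q => inner ℝ n q)
      ⟨fun x y => inner_add_right n x y, fun t x => real_inner_smul_right n x t⟩ _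
  have e : halfBall n c r = ball c r ∩ {q : ℂ | inner ℝ n c < inner ℝ n q} := by
    ext q
    simp only [halfBall, inner_sub_right, sub_pos]
    rfl
  rw [e]
  exact (convex_ball c r).inter h

lemma halfBall_mono {n c : ℂ} {r r' : ℝ} (h : r ≤ r') : halfBall n c r ⊆ halfBall n c r' :=
  fun _ hq => ⟨ball_subset_ball h hq.1, hq.2⟩

lemma mem_halfBall_add_smul {n c : ℂ} {r δ : ℝ} (hn : n ≠ 0) (hδ : 0 < δ) (h : ‖δ • n‖ < r) :
    c + δ • n ∈ halfBall n c r := by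
  refine ⟨by simpa [mem_ball, dist_eq_norm] using h, ?_⟩
  rw [add_sub_cancel_left, real_inner_smul_right]
  exact mul_pos hδ (real_inner_self_pos.2 hn)

/-- The half-open segment from `c` to a visible point `q`, together with a half ball at `c`. -/
lemma isPreconnected_segment_union_halfBall {n c q : ℂ} {r : ℝ} (hr : 0 < r)
    (hq : 0 < inner ℝ n (q - c)) :
    IsPreconnected ((fun t : ℝ => c + t • (q - c)) '' Ioc 0 1 ∪ halfBall n c r) := by
  have hqc : q - c ≠ 0 := fun h => by simp [h] at hq
  set t := min 1 (r / (2 * ‖q - c‖))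
  have ht0 : 0 < t := lt_min one_pos (by positivity)
  refine IsPreconnected.union (c + t • (q - c)) ⟨t, ⟨ht0, min_le_left _ _⟩, rfl⟩ ⟨?_, ?_⟩
    (isPreconnected_Ioc.image _ (by fun_prop)) (convex_halfBall n c r).isPreconnected
  · rw [mem_ball, dist_eq_norm, add_sub_cancel_left, norm_smul, Real.norm_eq_abs, abs_of_pos ht0]
    have : t ≤ r / (2 * ‖q - c‖) := min_le_right _ _
    calc t * ‖q - c‖ ≤ r / (2 * ‖q - c‖) * ‖q - c‖ := by gcongr
      _ = r / 2 := by field_simp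
      _ < r := by linarith
  · rw [add_sub_cancel_left, real_inner_smul_right]
    positivity

/-- A segment of `P` through `v` has a half ball at `v` on one of its sides inside `P`. -/
lemma IsPolygonal.exists_halfBall {P : Set ℂ} {W : Finset ℂ} (hP : IsPolygonal P W) {v d n : ℂ}
    {r₀ : ℝ} (hr₀ : 0 < r₀) (hn : n ≠ 0) (hd : d ≠ 0) (hnd : inner ℝ n d = 0)
    (h : ∀ s ∈ Ioo (-r₀) r₀, v + s • d ∈ P) :
    ∃ r > 0, halfBall n v r ⊆ P ∨ halfBall (-n) v r ⊆ P := by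
  obtain ⟨r, hr, hcone, hpre⟩ := hP.conic v (by simpa using h 0 (by simp [hr₀]))
  refine ⟨r, hr, ?_⟩
  -- the complement near `v` avoids the line, so it lies on one side
  have hline : ∀ q ∈ ball v r \ P, inner ℝ n (q - v) ≠ 0 := by
    rintro q ⟨hq, hqP⟩ h0
    obtain ⟨t, ht⟩ := exists_smul_of_inner_eq_zero hn hd hnd h0
    apply hqP
    rw [mem_ball, dist_eq_norm] at hq
    have hτ : (min 1 (r₀ / (2 * (|t| + 1)))) ∈ Ioc (0 : ℝ) 1 :=
      ⟨lt_min one_pos (by positivity), min_le_left _ _⟩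
    have := (hcone (q - v) hq _ hτ).2
    rw [add_sub_cancel] at this
    apply this
    rw [ht, smul_smul]
    apply h
    rw [mem_Ioo, ← abs_lt, abs_mul, abs_of_pos hτ.1]
    calc min 1 (r₀ / (2 * (|t| + 1))) * |t| ≤ r₀ / (2 * (|t| + 1)) * (|t| + 1) := by
          gcongr
          · exact min_le_right _ _
          · linarith
      _ = r₀ / 2 := by field_simp
      _ < r₀ := by linarith
  by_contra! hcon
  obtain ⟨h1, h2⟩ := hcon
  obtain ⟨a, ha, haP⟩ := not_subset.1 h1
  obtain ⟨b, hb, hbP⟩ := not_subset.1 h2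
  have him := hpre.image (fun q => inner ℝ n (q - v)) (by fun_prop)
  have hb2 : inner ℝ n (b - v) < 0 := by
    have := hb.2
    rw [inner_neg_left] at this
    linarith
  have := him.ordConnected.out (mem_image_of_mem _ ⟨hb.1, hbP⟩) (mem_image_of_mem _ ⟨ha.1, haP⟩)
    ⟨hb2.le, ha.2.le⟩
  obtain ⟨q, hq, hq0⟩ := this
  exact hline q hq hq0

/-- A ray that starts in `P` leaves it at some first point. -/
lemma IsPolygonal.exists_exit {P : Set ℂ} {W : Finset ℂ} (hP : IsPolygonal P W) {v d : ℂ}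
    (hv : v ∈ P) (hd : d ≠ 0) : ∃ T : ℝ, 0 < T ∧ v + T • d ∉ P ∧
      ∀ t ∈ Icc 0 T, v + t • d ∈ P → ∀ u ∈ Icc 0 t, v + u • d ∈ P := by
  set E : Set ℝ := {t | 0 ≤ t ∧ ∀ u ∈ Icc 0 t, v + u • d ∈ P}
  have h0 : (0 : ℝ) ∈ E := ⟨le_rfl, fun u hu => by
    have : u = 0 := le_antisymm hu.2 hu.1
    simpa [this] using hv⟩
  obtain ⟨R, hR⟩ := hP.compact.isBounded.exists_norm_le
  have hd' : 0 < ‖d‖ := norm_pos_iff.2 hd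
  have hbd : BddAbove E := by
    refine ⟨(R + ‖v‖) / ‖d‖, fun t ht => ?_⟩
    rw [le_div_iff₀ hd']
    have h1 := hR _ (ht.2 t ⟨ht.1, le_rfl⟩)
    have h2 : ‖t • d‖ ≤ ‖v + t • d‖ + ‖v‖ := by
      have := norm_sub_le (v + t • d) v
      simpa using this
    rw [norm_smul, Real.norm_eq_abs, abs_of_nonneg ht.1] at h2
    linarith
  set τ := sSup E
  have hτ0 : 0 ≤ τ := le_csSup hbd h0
  have hlt : ∀ u ∈ Ico 0 τ, v + u • d ∈ P := by
    intro u hu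
    obtain ⟨t, ht, hut⟩ := exists_lt_of_lt_csSup ⟨0, h0⟩ hu.2
    exact ht.2 u ⟨hu.1, hut.le⟩
  have hτP : v + τ • d ∈ P := by
    rcases hτ0.eq_or_lt with h | h
    · simpa [← h] using hv
    · have hcl : τ ∈ closure (Ico 0 τ) := by rw [closure_Ico h.ne]; exact ⟨hτ0, le_rfl⟩
      have hsub : Ico 0 τ ⊆ (fun u : ℝ => v + u • d) ⁻¹' P := hlt
      exact (hP.compact.isClosed.preimage (f := fun u : ℝ => v + u • d)
        (by fun_prop)).closure_subset_iff.2 hsub hcl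
  have hle : ∀ u ∈ Icc 0 τ, v + u • d ∈ P := by
    intro u hu
    rcases hu.2.eq_or_lt with h | h
    · rwa [h]
    · exact hlt u ⟨hu.1, h⟩
  obtain ⟨r, hr, hcone, -⟩ := hP.conic _ hτP
  set η := r / (2 * ‖d‖) with hη
  have hη0 : 0 < η := by positivity
  have hηr : ‖η • d‖ < r := by
    rw [norm_smul, Real.norm_eq_abs, abs_of_pos hη0, hη]
    have : r / (2 * ‖d‖) * ‖d‖ = r / 2 := by field_simp
    rw [this]; linarith
  have hiff : ∀ u ∈ Ioc τ (τ + η), (v + (τ + η : ℝ) • d ∈ P ↔ v + u • d ∈ P) := by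
    intro u hu
    have := hcone (η • d) hηr ((u - τ) / η)
      ⟨div_pos (by linarith [hu.1]) hη0, by rw [div_le_one hη0]; linarith [hu.2]⟩
    rw [smul_smul, div_mul_cancel₀ _ hη0.ne', add_assoc, add_assoc, ← add_smul, ← add_smul] at this
    simpa using this
  have hout : v + (τ + η : ℝ) • d ∉ P := by
    intro hin
    have : τ + η ∈ E := by
      refine ⟨by positivity, fun u hu => ?_⟩
      rcases le_or_gt u τ with h | h
      · exact hle u ⟨hu.1, h⟩
      · exact (hiff u ⟨h, hu.2⟩).1 hin
    have := le_csSup hbd this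
    linarith
  refine ⟨τ + η, by positivity, hout, fun t ht htP u hu => ?_⟩
  have htτ : t ≤ τ := by
    by_contra! h
    exact hout ((hiff t ⟨h, ht.2⟩).2 htP)
  exact hle u ⟨hu.1, hu.2.trans htτ⟩

/-! ### Windows and pockets -/

/-- A window seen from the point `v - d`: the segment from `v - d` to `v` lies in `P`, and `v` is
an obstacle on the side of `n` of this segment, where `n` is a normal of `d`. The region contains a
half ball at `v` on the other side, and the ray of direction `d` enters the interior beyond `v`. -/
structure IsWindow (P : Set ℂ) (v d n : ℂ) : Prop where
  d_ne : d ≠ 0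
  n_ne : n ≠ 0
  perp : inner ℝ n d = 0
  back : ∀ u ∈ Icc (-1 : ℝ) 0, v + u • d ∈ P
  not_interior : v ∉ interior P
  ahead : ∃ r : ℝ, 0 < r ∧ halfBall (-n) v r ⊆ P ∧ ∀ s ∈ Ioo (0 : ℝ) r, v + s • d ∈ interior P

/-- The visible part of the ray of direction `d` that starts at `v`. -/
def chord (P : Set ℂ) (v d : ℂ) : Set ℂ :=
  {q | ∃ t : ℝ, 0 ≤ t ∧ q = v + t • d ∧ ∀ u ∈ Icc 0 t, v + u • d ∈ P}

/-- `Q` is the pocket behind a window: the connected component, in the complement of the chord, of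
a point `c + δ n` close to the point `c = v + s d` of the chord. -/
structure IsPocket (P : Set ℂ) (v d n : ℂ) (R s ρ δ : ℝ) (Q : Set ℂ) : Prop
    extends IsWindow P v d n where
  s_pos : 0 < s
  δ_pos : 0 < δ
  norm_lt : ‖δ • n‖ < ρ
  halfBall_subset : halfBall (-n) v R ⊆ P
  ball_subset_ball : ball (v + s • d) ρ ⊆ ball v R
  ball_subset : ball (v + s • d) ρ ⊆ P
  interior : ∀ t ∈ Ioc 0 s, v + t • d ∈ interior P
  eq : Q = connectedComponentIn (P \ chord P v d) (v + s • d + δ • n)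

lemma chord_subset_vis {P : Set ℂ} {v d n : ℂ} (hw : IsWindow P v d n) :
    chord P v d ⊆ vis P (v - d) := by
  rintro q ⟨t, ht, rfl, h⟩
  have : v - d = v + (-1 : ℝ) • d := by simp [sub_eq_add_neg]
  rw [this, vis, mem_ofPred_eq, segment_line_subset_iff]
  intro u hu
  rw [uIcc_of_le (by linarith)] at hu
  rcases le_total u 0 with h0 | h0
  · exact hw.back u ⟨hu.1, h0⟩
  · exact h u ⟨h0, hu.2⟩

lemma inner_of_mem_chord {P : Set ℂ} {v d n q : ℂ} (hnd : inner ℝ n d = 0)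
    (hq : q ∈ chord P v d) : inner ℝ n (q - v) = 0 := by
  obtain ⟨t, -, rfl, -⟩ := hq
  rw [add_sub_cancel_left, real_inner_smul_right, hnd, mul_zero]

lemma not_mem_chord_of_inner_ne {P : Set ℂ} {v d n q : ℂ} {s : ℝ} (hnd : inner ℝ n d = 0)
    (hq : inner ℝ n (q - (v + s • d)) ≠ 0) : q ∉ chord P v d := by
  intro h
  apply hq
  have : q - (v + s • d) = (q - v) - s • d := by ring
  rw [this, inner_sub_right, inner_of_mem_chord hnd h, real_inner_smul_right, hnd, mul_zero,
    sub_zero]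

/-- The two sides of the chord at the point `v + s d` are not connected off the chord. -/
lemma IsPocket.separates {P : Set ℂ} {W : Finset ℂ} (hP : IsPolygonal P W) {v d n : ℂ}
    {R s ρ δ : ℝ} {Q : Set ℂ} (h : IsPocket P v d n R s ρ δ Q) {A : Set ℂ} (hA : IsPreconnected A)
    (hAP : A ⊆ P \ chord P v d) (h1 : v + s • d + δ • n ∈ A) (h2 : v + s • d - δ • n ∈ A) :
    False := by
  have hv : v ∈ P := by simpa using h.back 0 (by simp)
  obtain ⟨T, hT, hTP, hexit⟩ := hP.exists_exit hv h.d_ne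
  obtain ⟨r, hr, hcone, -⟩ := hP.conic v hv
  obtain ⟨v', hv'b, hv'⟩ : ∃ v' ∈ ball v r, v' ∉ P := by
    by_contra! hcon
    exact h.not_interior (mem_interior.2 ⟨_, hcon, isOpen_ball, mem_ball_self hr⟩)
  have hsT : s < T := by
    by_contra! hle
    exact hTP (interior_subset (h.interior T ⟨hT, hle⟩))
  refine chord_separates hP.compact hP.compl (v := v) (v' := v') (d := d) (n := n)
    (c := v + s • d) (s := s) (T := T) (r := ρ) (δ := δ) h.d_ne h.s_pos hsT (by simp)
    (by simpa using hTP) hv' ?_ h.ball_subset (im_div_ne_zero h.n_ne h.d_ne h.perp) h.δ_pos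
    (by simpa using h.norm_lt) hA (fun q hq => (hAP hq).1) ?_ (by simpa using h1)
    (by simpa using h2)
  · intro q hq hqv hseg
    rw [segment_eq_image'] at hseg
    obtain ⟨t, ht, rfl⟩ := hseg
    have ht0 : 0 < t := by
      refine ht.1.lt_of_ne ?_
      rintro rfl
      simp at hqv
    rw [mem_ball, dist_eq_norm] at hv'b
    have := (hcone (v' - v) hv'b t ⟨ht0, ht.2⟩).2 hq
    rw [add_sub_cancel] at this
    exact hv' this
  · intro q hq hseg
    rw [segment_symm, segment_eq_image'] at hseg
    obtain ⟨t, ht, rfl⟩ := hseg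
    have e : v + t • (v + T * d - v) = v + (t * T) • d := by simp; ring
    simp only [e] at hq
    refine (hAP hq).2 ⟨t * T, by have := ht.1; positivity, rfl, ?_⟩
    exact hexit _ ⟨by have := ht.1; positivity, by nlinarith [ht.2]⟩ (hAP hq).1

lemma IsPocket.germ_mem {P : Set ℂ} {v d n : ℂ} {R s ρ δ : ℝ} {Q : Set ℂ}
    (h : IsPocket P v d n R s ρ δ Q) : v + s • d + δ • n ∈ Q := by
  rw [h.eq]
  have := mem_halfBall_add_smul (c := v + s • d) h.n_ne h.δ_pos h.norm_lt
  exact mem_connectedComponentIn ⟨h.ball_subset this.1, not_mem_chord_of_inner_ne h.perp this.2.ne'⟩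

lemma IsPocket.subset {P : Set ℂ} {v d n : ℂ} {R s ρ δ : ℝ} {Q : Set ℂ}
    (h : IsPocket P v d n R s ρ δ Q) : Q ⊆ P \ chord P v d := by
  rw [h.eq]
  exact connectedComponentIn_subset _ _

lemma IsPocket.preconnected {P : Set ℂ} {v d n : ℂ} {R s ρ δ : ℝ} {Q : Set ℂ}
    (h : IsPocket P v d n R s ρ δ Q) : IsPreconnected Q := by
  rw [h.eq]
  exact isPreconnected_connectedComponentIn

lemma IsPocket.absorb {P : Set ℂ} {v d n : ℂ} {R s ρ δ : ℝ} {Q : Set ℂ}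
    (h : IsPocket P v d n R s ρ δ Q) {A : Set ℂ} (hA : IsPreconnected A)
    (hAP : A ⊆ P \ chord P v d) (hne : (A ∩ Q).Nonempty) : A ⊆ Q := by
  obtain ⟨a, ha, haQ⟩ := hne
  have hQ := h.eq
  rw [hQ, connectedComponentIn_eq (by rwa [hQ] at haQ)]
  exact hA.subset_connectedComponentIn ha hAP

lemma IsPocket.opposite_not_mem {P : Set ℂ} {W : Finset ℂ} (hP : IsPolygonal P W) {v d n : ℂ}
    {R s ρ δ : ℝ} {Q : Set ℂ} (h : IsPocket P v d n R s ρ δ Q) : v + s • d - δ • n ∉ Q :=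
  fun hm => h.separates hP h.preconnected h.subset h.germ_mem hm

/-- Points on the line of the window in front of `v` are connected to the side of the chord
opposite to the pocket, around `v`. -/
lemma IsPocket.front_not_mem {P : Set ℂ} {W : Finset ℂ} (hP : IsPolygonal P W) {v d n : ℂ}
    {R s ρ δ : ℝ} {Q : Set ℂ} (h : IsPocket P v d n R s ρ δ Q) {a : ℝ} (ha : a < 0)
    (hvis : ∀ u ∈ Icc a 0, v + u • d ∈ P) : v + a • d ∉ Q := by
  intro hmem
  have hopp : v + s • d - δ • n ∈ halfBall (-n) v R := by
    have h1 := mem_halfBall_add_smul (n := -n) (c := v + s • d) (neg_ne_zero.2 h.n_ne) h.δ_pos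
      (by simpa using h.norm_lt)
    have e : v + s • d + δ • -n = v + s • d - δ • n := by simp [sub_eq_add_neg]
    rw [e] at h1
    refine ⟨h.ball_subset_ball h1.1, ?_⟩
    have e2 : v + s • d - δ • n - v = s • d + (v + s • d - δ • n - (v + s • d)) := by ring
    rw [e2, inner_add_right, real_inner_smul_right, inner_neg_left, h.perp]
    simpa using h1.2
  have hR : 0 < R := dist_nonneg.trans_lt hopp.1
  have hd : 0 < ‖d‖ := norm_pos_iff.2 h.d_ne
  set b := max a (-(R / (2 * ‖d‖)))
  have hb0 : b < 0 := max_lt ha (by rw [neg_lt_zero]; positivity)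
  have hbR : ‖b • d‖ < R := by
    rw [norm_smul, Real.norm_eq_abs, abs_of_neg hb0]
    have : -b ≤ R / (2 * ‖d‖) := by linarith [le_max_right a (-(R / (2 * ‖d‖)))]
    calc -b * ‖d‖ ≤ R / (2 * ‖d‖) * ‖d‖ := by gcongr
      _ = R / 2 := by field_simp
      _ < R := by linarith
  have hnot : ∀ u : ℝ, u < 0 → v + u • d ∉ chord P v d := by
    rintro u hu ⟨t, ht, he, -⟩
    have : (u - t) • d = 0 := by rw [sub_smul]; linear_combination he
    rcases smul_eq_zero.1 this with h0 | h0
    · linarith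
    · exact h.d_ne h0
  have h1 : v + b • d ∈ Q := by
    refine h.absorb (A := (fun u : ℝ => v + u • d) '' Icc a b)
      (isPreconnected_Icc.image _ (by fun_prop)) ?_ ⟨_, ⟨a, ⟨le_rfl, le_max_left _ _⟩, rfl⟩, hmem⟩
      ⟨b, ⟨le_max_left _ _, le_rfl⟩, rfl⟩
    rintro _ ⟨u, hu, rfl⟩
    exact ⟨hvis u ⟨hu.1, hu.2.trans hb0.le⟩, hnot u (hu.2.trans_lt hb0)⟩
  refine h.opposite_not_mem hP (h.absorb (A := segment ℝ (v + b • d) (v + s • d - δ • n))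
    (convex_segment _ _).isPreconnected ?_ ⟨_, left_mem_segment _ _ _, h1⟩
    (right_mem_segment _ _ _))
  rw [segment_eq_image']
  rintro _ ⟨t, ht, rfl⟩
  rcases ht.1.eq_or_lt with h0 | h0
  · subst h0
    simpa using h.subset h1
  · set q := v + b • d + t • (v + s • d - δ • n - (v + b • d)) with hq
    have hin : 0 < inner ℝ (-n) (q - v) := by
      have e : q - v = (1 - t) • b • d + t • (v + s • d - δ • n - v) := by
        rw [hq]; simp only [real_smul]; push_cast; ring
      rw [e, inner_add_right, real_inner_smul_right, real_inner_smul_right, real_inner_smul_right,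
        inner_neg_left, h.perp]
      simpa using mul_pos h0 hopp.2
    have hball : q ∈ ball v R := by
      refine (convex_ball v R).segment_subset (x := v + b • d) (y := v + s • d - δ • n)
        (by simpa [mem_ball, dist_eq_norm] using hbR) hopp.1 ?_
      rw [segment_eq_image']
      exact ⟨t, ht, rfl⟩
    refine ⟨h.halfBall_subset ⟨hball, hin⟩, not_mem_chord_of_inner_ne (s := 0) h.perp ?_⟩
    rw [inner_neg_left] at hin
    rw [zero_smul, add_zero]
    linarith

/-- Nothing that is visible through the window belongs to the pocket. -/
lemma IsPocket.disjoint_vis {P : Set ℂ} {W : Finset ℂ} (hP : IsPolygonal P W) {v d n : ℂ}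
    {R s ρ δ : ℝ} {Q : Set ℂ} (h : IsPocket P v d n R s ρ δ Q) : Disjoint Q (vis P (v - d)) := by
  rw [Set.disjoint_left]
  intro q hqQ hq
  have hx : v - d = v + (-1 : ℝ) • d := by simp [sub_eq_add_neg]
  apply h.front_not_mem hP (a := -1) (by norm_num) h.back
  rw [← hx]
  refine h.absorb (A := segment ℝ (v - d) q) (convex_segment _ _).isPreconnected ?_
    ⟨q, right_mem_segment _ _ _, hqQ⟩ (left_mem_segment _ _ _)
  intro y hy
  refine ⟨hq hy, ?_⟩
  rintro ⟨t, ht, hyt, -⟩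
  -- a chord point on the segment puts `q` on the ray, hence on the chord
  rw [segment_eq_image'] at hy
  obtain ⟨u, hu, hyu⟩ := hy
  have hu0 : 0 < u := by
    refine hu.1.lt_of_ne ?_
    rintro rfl
    simp only [zero_smul, add_zero] at hyu
    have h0 : (1 + t) • d = 0 := by
      rw [add_smul, one_smul]; linear_combination -hyu - hyt
    rcases smul_eq_zero.1 h0 with h1 | h1
    · linarith
    · exact h.d_ne h1
  have hqe : q = v + ((1 + t) / u - 1) • d := by
    have hu' : (u : ℂ) ≠ 0 := by exact_mod_cast hu0.ne'
    simp only [real_smul] at hyu hyt ⊢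
    push_cast
    field_simp
    linear_combination hyu + hyt
  have hge : 0 ≤ (1 + t) / u - 1 := by
    rw [sub_nonneg, le_div_iff₀ hu0]
    linarith [hu.2]
  refine (h.subset hqQ).2 ⟨_, hge, hqe, ?_⟩
  have hv := hq
  rw [hx, hqe, vis, mem_ofPred_eq, segment_line_subset_iff, uIcc_of_le (by linarith)] at hv
  exact fun w hw => hv w ⟨by linarith [hw.1], hw.2⟩

/-! ### Nodes: pockets together with a guard on their window -/

/-- The set of points seen by a guard at `g.1` whose visual field is the open half plane with inner
normal `g.2`. -/
def halfVis (P : Set ℂ) (g : ℂ × ℂ) : Set ℂ := {q ∈ vis P g.1 | 0 < inner ℝ g.2 (q - g.1)}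

/-- A guard at the interior point `x` that looks in the half plane with normal `n` and is
responsible for the connected part `Q` of the region: it sees nothing outside `Q` in its field, sees
nothing of `Q` outside its field, and `Q` is only accessible across points visible from `x`. -/
structure IsNode (P : Set ℂ) (x n : ℂ) (Q : Set ℂ) : Prop where
  mem_interior : x ∈ interior P
  n_ne : n ≠ 0
  subset : Q ⊆ P
  preconnected : IsPreconnected Q
  halfVis_subset : halfVis P (x, n) ⊆ Q
  inner_pos : ∀ q ∈ Q, q ∈ vis P x → 0 < inner ℝ n (q - x)
  absorb : ∀ A : Set ℂ, IsPreconnected A → A ⊆ P → Disjoint A (vis P x) → (A ∩ Q).Nonempty → A ⊆ Q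

/-- A guard placed on the chord just behind the vertex `v` of a window sees the whole chord and, on
the side of the pocket, only points of the pocket. -/
lemma IsPocket.isNode {P : Set ℂ} {W : Finset ℂ} (hP : IsPolygonal P W) {v d n : ℂ}
    {R s ρ δ : ℝ} {Q : Set ℂ} (h : IsPocket P v d n R s ρ δ Q) : IsNode P (v + s • d) n Q := by
  have hρ : 0 < ρ := (norm_nonneg _).trans_lt h.norm_lt
  have hchord : chord P v d ⊆ vis P (v + s • d) := by
    rintro q ⟨t, ht, rfl, hq⟩
    rw [vis, mem_ofPred_eq, segment_line_subset_iff]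
    intro u hu
    rcases le_total u t with hut | hut
    · exact hq u ⟨(le_min h.s_pos.le ht).trans hu.1, hut⟩
    · rcases le_total s t with hst | hst
      · rw [uIcc_of_le hst] at hu
        exact hq u ⟨h.s_pos.le.trans hu.1, hu.2⟩
      · rw [uIcc_of_ge hst] at hu
        rcases hut.eq_or_lt with h0 | h0
        · subst h0; exact hq t ⟨ht, le_rfl⟩
        · exact interior_subset (h.interior u ⟨ht.trans_lt h0, hu.2⟩)
  -- visible points strictly on one side are connected to the corresponding germ at the guard
  have hside : ∀ m : ℂ, inner ℝ m d = 0 → ∀ q ∈ vis P (v + s • d),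
      0 < inner ℝ m (q - (v + s • d)) →
      ((fun t : ℝ => v + s • d + t • (q - (v + s • d))) '' Ioc 0 1 ∪ halfBall m (v + s • d) ρ) ⊆
        P \ chord P v d := by
    rintro m hm q hq hpos y (⟨t, ht, rfl⟩ | hy)
    · refine ⟨hq ?_, not_mem_chord_of_inner_ne (n := m) (s := s) hm ?_⟩
      · rw [segment_eq_image']
        exact ⟨t, ⟨ht.1.le, ht.2⟩, rfl⟩
      · rw [add_sub_cancel_left, real_inner_smul_right]
        exact (mul_pos ht.1 hpos).ne'
    · exact ⟨h.ball_subset hy.1, not_mem_chord_of_inner_ne (n := m) (s := s) hm hy.2.ne'⟩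
  refine ⟨h.interior s ⟨h.s_pos, le_rfl⟩, h.n_ne, fun q hq => (h.subset hq).1, h.preconnected,
    ?_, ?_, ?_⟩
  · rintro q ⟨hq, hpos⟩
    refine h.absorb (isPreconnected_segment_union_halfBall hρ hpos) (hside n h.perp q hq hpos)
      ⟨_, Or.inr (mem_halfBall_add_smul h.n_ne h.δ_pos h.norm_lt), h.germ_mem⟩
      (Or.inl ⟨1, by simp, by simp⟩)
  · intro q hqQ hq
    by_contra! hle
    rcases hle.lt_or_eq with hlt | heq
    · have hpos : 0 < inner ℝ (-n) (q - (v + s • d)) := by rw [inner_neg_left]; linarith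
      refine h.opposite_not_mem hP (h.absorb (isPreconnected_segment_union_halfBall hρ hpos)
        (hside (-n) (by rw [inner_neg_left, h.perp, neg_zero]) q hq hpos)
        ⟨q, Or.inl ⟨1, by simp, by simp⟩, hqQ⟩ (Or.inr ?_))
      have := mem_halfBall_add_smul (n := -n) (c := v + s • d) (neg_ne_zero.2 h.n_ne) h.δ_pos
        (by simpa using h.norm_lt)
      simpa [sub_eq_add_neg] using this
    · obtain ⟨τ, hτ⟩ := exists_smul_of_inner_eq_zero h.n_ne h.d_ne h.perp heq
      have hqe : q = v + (s + τ) • d := by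
        rw [add_smul]; linear_combination hτ
      have hv := hq
      rw [hqe, vis, mem_ofPred_eq, segment_line_subset_iff] at hv
      rcases le_or_gt 0 (s + τ) with h0 | h0
      · refine (h.subset hqQ).2 ⟨_, h0, hqe, fun u hu => ?_⟩
        rcases hu.1.eq_or_lt with h1 | h1
        · simpa [← h1] using h.back 0 (by simp)
        · rcases le_or_gt u s with h2 | h2
          · exact interior_subset (h.interior u ⟨h1, h2⟩)
          · exact hv u ⟨(min_le_left _ _).trans h2.le, hu.2.trans (le_max_right _ _)⟩
      · refine h.front_not_mem hP h0 (fun u hu => hv u ?_) (hqe ▸ hqQ)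
        rw [uIcc_of_ge (by linarith [h.s_pos])]
        exact ⟨hu.1, hu.2.trans h.s_pos.le⟩
  · intro A hA hAP hdis hne
    refine h.absorb hA (fun a ha => ⟨hAP ha, fun hc => ?_⟩) hne
    exact Set.disjoint_left.1 hdis ha (hchord hc)

lemma IsWindow.exists_pocket {P : Set ℂ} {v d n : ℂ} (hw : IsWindow P v d n) :
    ∃ R s ρ δ Q, IsPocket P v d n R s ρ δ Q := by
  obtain ⟨r, hr, hhalf, hint⟩ := hw.ahead
  have hd : 0 < ‖d‖ := norm_pos_iff.2 hw.d_ne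
  have hn : 0 < ‖n‖ := norm_pos_iff.2 hw.n_ne
  set s := min (r / 2) (r / (2 * ‖d‖))
  have hs0 : 0 < s := lt_min (by positivity) (by positivity)
  have hsr : s < r := (min_le_left _ _).trans_lt (by linarith)
  have hsd : ‖s • d‖ ≤ r / 2 := by
    rw [norm_smul, Real.norm_eq_abs, abs_of_pos hs0]
    calc s * ‖d‖ ≤ r / (2 * ‖d‖) * ‖d‖ := by gcongr; exact min_le_right _ _
      _ = r / 2 := by field_simp
  obtain ⟨ε, hε, hball⟩ := Metric.isOpen_iff.1 isOpen_interior _ (hint s ⟨hs0, hsr⟩)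
  have hρ : 0 < min ε (r / 2) := lt_min hε (by positivity)
  refine ⟨r, s, min ε (r / 2), min ε (r / 2) / (2 * ‖n‖), _, hw, hs0, by positivity, ?_, hhalf,
    ?_, ?_, fun t ht => hint t ⟨ht.1, ht.2.trans_lt hsr⟩, rfl⟩
  · rw [norm_smul, Real.norm_eq_abs, abs_of_pos (by positivity)]
    have : min ε (r / 2) / (2 * ‖n‖) * ‖n‖ = min ε (r / 2) / 2 := by field_simp
    rw [this]; linarith
  · apply Metric.ball_subset_ball'
    rw [dist_eq_norm, add_sub_cancel_left]
    linarith [min_le_right ε (r / 2)]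
  · exact (Metric.ball_subset_ball (min_le_left _ _)).trans (hball.trans interior_subset)

/-! ### Exits of the visible region -/

/-- Half balls on one side of the points of a compact part of a line have a common radius. -/
lemma exists_uniform_halfBall {P : Set ℂ} {v d n : ℂ} (hnd : inner ℝ n d = 0) {K : Set ℝ}
    (hK : IsCompact K) (h : ∀ t ∈ K, ∃ r : ℝ, 0 < r ∧ halfBall n (v + t • d) r ⊆ P) :
    ∃ r : ℝ, 0 < r ∧ ∀ t ∈ K, halfBall n (v + t • d) r ⊆ P := by
  refine hK.induction_on (p := fun s => ∃ r : ℝ, 0 < r ∧ ∀ t ∈ s, halfBall n (v + t • d) r ⊆ P)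
    ⟨1, one_pos, by simp⟩ ?_ ?_ ?_
  · rintro s t hst ⟨r, hr, h⟩
    exact ⟨r, hr, fun u hu => h u (hst hu)⟩
  · rintro s t ⟨r, hr, h⟩ ⟨r', hr', h'⟩
    refine ⟨min r r', lt_min hr hr', fun u hu => ?_⟩
    rcases hu with hu | hu
    · exact (halfBall_mono (min_le_left _ _)).trans (h u hu)
    · exact (halfBall_mono (min_le_right _ _)).trans (h' u hu)
  · intro t ht
    obtain ⟨r, hr, hsub⟩ := h t ht
    have hc : Continuous fun u : ℝ => v + u • d := by fun_prop
    refine ⟨(fun u : ℝ => v + u • d) ⁻¹' ball (v + t • d) (r / 2),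
      mem_nhdsWithin_of_mem_nhds
        (hc.continuousAt.preimage_mem_nhds (ball_mem_nhds _ (by linarith))),
      r / 2, by linarith, fun u hu q hq => hsub ⟨?_, ?_⟩⟩
    · have h1 := hq.1
      have h2 : dist (v + u • d) (v + t • d) < r / 2 := hu
      rw [mem_ball] at h1 ⊢
      linarith [dist_triangle q (v + u • d) (v + t • d)]
    · have e : q - (v + t • d) = q - (v + u • d) + (u - t) • d := by
        rw [sub_smul]; ring
      rw [e, inner_add_right, real_inner_smul_right, hnd, mul_zero, add_zero]
      exact hq.2

/-- The union of the half balls of equal radius on one side of a segment is convex. -/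
lemma convex_iUnion_halfBall (v d n : ℂ) (a b r : ℝ) :
    Convex ℝ {q | ∃ t ∈ Icc a b, q ∈ halfBall n (v + t • d) r} := by
  have h0 : ∀ (t : ℝ) (q : ℂ), q ∈ halfBall n (v + t • d) r ↔ q - (v + t • d) ∈ halfBall n 0 r := by
    intro t q
    simp only [halfBall, mem_ofPred_eq, mem_ball, dist_eq_norm, sub_zero]
  rintro x ⟨t, ht, hx⟩ y ⟨u, hu, hy⟩ α β hα hβ hαβ
  refine ⟨α * t + β * u, (convex_Icc a b) ht hu hα hβ hαβ, ?_⟩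
  rw [h0] at hx hy ⊢
  convert (convex_halfBall n 0 r) hx hy hα hβ hαβ using 1
  have : (α : ℂ) + β = 1 := by exact_mod_cast hαβ
  simp only [real_smul]
  push_cast
  linear_combination v * this

/-- Near a visible interior point `p`, and on the side of `n` of the segment from `x` to `p`, either
everything is visible, or everything belongs to the pocket of one window, that at the last obstacle
on this side of the segment. -/
lemma IsPolygonal.exit {P : Set ℂ} {W : Finset ℂ} (hP : IsPolygonal P W) {x e n : ℂ}
    (hx : x ∈ interior P) (hp : x + e ∈ interior P) (hvis : x + e ∈ vis P x) (he : e ≠ 0)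
    (hn : n ≠ 0) (hne : inner ℝ n e = 0) :
    (∃ r : ℝ, 0 < r ∧ halfBall n (x + e) r ⊆ vis P x) ∨
    ∃ t : ℝ, 0 < t ∧ IsWindow P (x + t • e) (t • e) n ∧ x + t • e ∈ W ∧
      ∀ R s ρ δ Q, IsPocket P (x + t • e) (t • e) n R s ρ δ Q →
        ∃ r : ℝ, 0 < r ∧ halfBall n (x + e) r ⊆ Q := by
  have hline : ∀ t ∈ Icc (0 : ℝ) 1, x + t • e ∈ P := by
    have h1 : x = x + (0 : ℝ) • e := by simp
    have h2 : x + e = x + (1 : ℝ) • e := by simp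
    have := hvis
    rw [h2, vis, mem_ofPred_eq] at this
    nth_rewrite 1 [h1] at this
    rw [segment_line_subset_iff, uIcc_of_le zero_le_one] at this
    exact this
  have hint : ∀ m : ℂ, ∀ y ∈ interior P, ∃ r : ℝ, 0 < r ∧ halfBall m y r ⊆ P := by
    intro m y hy
    obtain ⟨r, hr, hb⟩ := Metric.isOpen_iff.1 isOpen_interior y hy
    exact ⟨r, hr, fun q hq => interior_subset (hb hq.1)⟩
  set good : ℝ → Prop := fun t => ∃ r : ℝ, 0 < r ∧ halfBall n (x + t • e) r ⊆ P with hgood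
  by_cases hall : ∀ t ∈ Icc (0 : ℝ) 1, good t
  · left
    obtain ⟨r, hr, hsub⟩ := exists_uniform_halfBall hne isCompact_Icc hall
    refine ⟨r, hr, fun q hq => ?_⟩
    rw [vis, mem_ofPred_eq, segment_eq_image']
    rintro _ ⟨t, ht, rfl⟩
    rcases ht.1.eq_or_lt with h0 | h0
    · subst h0
      simpa using interior_subset hx
    · apply hsub t ht
      have e1 : x + t • (q - x) - (x + t • e) = t • (q - (x + e)) := by
        simp only [smul_sub, smul_add]; ring
      refine ⟨?_, ?_⟩
      · rw [mem_ball, dist_eq_norm, e1, norm_smul, Real.norm_eq_abs, abs_of_pos h0]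
        have := hq.1
        rw [mem_ball, dist_eq_norm] at this
        nlinarith [ht.2, norm_nonneg (q - (x + e))]
      · rw [e1, real_inner_smul_right]
        exact mul_pos h0 hq.2
  · right
    push Not at hall
    -- the last bad point
    set B : Set ℝ := {t | t ∈ Icc (0 : ℝ) 1 ∧ ¬ good t}
    have hgopen : IsOpen {t | good t} := by
      rw [isOpen_iff_mem_nhds]
      rintro t ⟨r, hr, hsub⟩
      have hc : Continuous fun u : ℝ => x + u • e := by fun_prop
      filter_upwards [hc.continuousAt.preimage_mem_nhds
        (ball_mem_nhds (x + t • e) (half_pos hr))] with u hu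
      refine ⟨r / 2, half_pos hr, fun q hq => hsub ⟨?_, ?_⟩⟩
      · have h1 := hq.1
        have h2 : dist (x + u • e) (x + t • e) < r / 2 := hu
        rw [mem_ball] at h1 ⊢
        linarith [dist_triangle q (x + u • e) (x + t • e)]
      · have e1 : q - (x + t • e) = q - (x + u • e) + (u - t) • e := by
          rw [sub_smul]; ring
        rw [e1, inner_add_right, real_inner_smul_right, hne, mul_zero, add_zero]
        exact hq.2
    have hBc : IsCompact B := isCompact_Icc.inter_right hgopen.isClosed_compl
    obtain ⟨τ, ⟨⟨hτ0, hτ1⟩, hτbad⟩, hτmax⟩ := hBc.exists_isGreatest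
      (by obtain ⟨t, ht, hb⟩ := hall; exact ⟨t, ht, hb⟩)
    have hτ0' : 0 < τ := by
      refine hτ0.lt_of_ne fun h => hτbad ?_
      simp only [hgood]
      rw [← h, zero_smul, add_zero]
      exact hint n x hx
    have hτ1' : τ < 1 := by
      refine hτ1.lt_of_ne fun h => hτbad ?_
      simp only [hgood]
      rw [h, one_smul]
      exact hint n _ hp
    have hgood' : ∀ t, τ < t → t ≤ 1 → good t := by
      intro t h1 h2
      by_contra hb
      exact absurd (hτmax ⟨⟨hτ0.trans h1.le, h2⟩, hb⟩) (not_le.2 h1)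
    have hvint : x + τ • e ∉ interior P := fun h => hτbad (hint n _ h)
    -- the opposite half ball at the last bad point
    have hεmin : 0 < min τ (1 - τ) := lt_min hτ0' (by linarith)
    obtain ⟨r, hr, hhalf⟩ := hP.exists_halfBall (v := x + τ • e) (d := e) (n := n) hεmin hn he hne
      (fun s hs => by
        rw [add_assoc, ← add_smul]
        apply hline
        have h1 := min_le_left τ (1 - τ)
        have h2 := min_le_right τ (1 - τ)
        exact ⟨by linarith [hs.1], by linarith [hs.2]⟩)
    have hhalf' : halfBall (-n) (x + τ • e) r ⊆ P :=
      hhalf.resolve_left fun h => hτbad ⟨r, hr, h⟩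
    have hen : 0 < ‖e‖ := norm_pos_iff.2 he
    -- beyond it both half balls are present
    have hbeyond : ∀ s : ℝ, 0 < s → s < min (1 - τ) (r / ‖e‖) → x + (τ + s) • e ∈ interior P := by
      intro s hs0 hs
      obtain ⟨ρ, hρ, hρsub⟩ := hgood' (τ + s) (by linarith)
        (by linarith [min_le_left (1 - τ) (r / ‖e‖)])
      have hsr : s * ‖e‖ < r := by
        rw [← lt_div_iff₀ hen]
        exact hs.trans_le (min_le_right _ _)
      set ρ' := min ρ (r - s * ‖e‖)
      have hρ'0 : 0 < ρ' := lt_min hρ (by linarith)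
      have hmain : ∀ q ∈ ball (x + (τ + s) • e) ρ', inner ℝ n (q - (x + (τ + s) • e)) ≠ 0 →
          q ∈ P := by
        intro q hq hne0
        rcases hne0.lt_or_gt with hlt | hgt
        · apply hhalf'
          have e1 : q - (x + τ • e) = (q - (x + (τ + s) • e)) + s • e := by
            rw [add_smul]; ring
          refine ⟨?_, ?_⟩
          · rw [mem_ball, dist_eq_norm, e1]
            refine (norm_add_le _ _).trans_lt ?_
            rw [mem_ball, dist_eq_norm] at hq
            rw [norm_smul, Real.norm_eq_abs, abs_of_pos hs0]
            linarith [min_le_right ρ (r - s * ‖e‖)]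
          · rw [e1, inner_add_right, real_inner_smul_right, inner_neg_left, inner_neg_left, hne]
            linarith
        · exact hρsub ⟨ball_subset_ball (min_le_left _ _) hq, hgt⟩
      rw [mem_interior]
      refine ⟨_, fun q hq => ?_, isOpen_ball, mem_ball_self hρ'0⟩
      by_cases h0 : inner ℝ n (q - (x + (τ + s) • e)) = 0
      · -- points on the line are limits of points of the half ball
        have hlim : Filter.Tendsto (fun ε : ℝ => q + ε • n) (nhdsWithin 0 (Ioi 0)) (nhds q) := by
          have : Continuous fun ε : ℝ => q + ε • n := by fun_prop
          simpa using (this.tendsto 0).mono_left nhdsWithin_le_nhds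
        refine hP.compact.isClosed.mem_of_tendsto hlim ?_
        filter_upwards [hlim.eventually (isOpen_ball.mem_nhds hq), self_mem_nhdsWithin] with ε h1 h2
        refine hmain _ h1 ?_
        have e1 : q + ε • n - (x + (τ + s) • e) = q - (x + (τ + s) • e) + ε • n := by ring
        rw [e1, inner_add_right, h0, zero_add, real_inner_smul_right]
        exact (mul_pos h2 (real_inner_self_pos.2 hn)).ne'
      · exact hmain q hq h0
    set r₁ := min (1 - τ) (r / ‖e‖)
    have hr₁0 : 0 < r₁ := lt_min (by linarith) (by positivity)
    have hw : IsWindow P (x + τ • e) (τ • e) n := by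
      refine ⟨smul_ne_zero hτ0'.ne' he, hn, by rw [real_inner_smul_right, hne, mul_zero], ?_,
        hvint, min r (r₁ / τ), lt_min hr (by positivity),
        (halfBall_mono (min_le_left _ _)).trans hhalf', ?_⟩
      · intro u hu
        rw [smul_smul, add_assoc, ← add_smul]
        apply hline
        constructor <;> nlinarith [hu.1, hu.2]
      · intro s hs
        rw [smul_smul, add_assoc, ← add_smul]
        refine hbeyond _ (mul_pos hs.1 hτ0') ?_
        rw [← lt_div_iff₀ hτ0']
        exact hs.2.trans_le (min_le_right _ _)
    refine ⟨τ, hτ0', hw, ?_, ?_⟩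
    · refine hP.corner _ (hline τ ⟨hτ0, hτ1⟩) hvint e (min r₁ τ) (lt_min hr₁0 hτ0') fun s hs => ?_
      have h1 := min_le_left r₁ τ
      have h2 := min_le_right r₁ τ
      refine ⟨?_, ?_⟩
      · rw [add_assoc, ← add_smul]
        exact hbeyond s hs.1 (hs.2.trans_le h1)
      · have : x + τ • e - s • e = x + (τ - s) • e := by rw [sub_smul]; ring
        rw [this]
        exact hline _ ⟨by linarith [hs.2], by linarith [hs.1]⟩
    · intro R s ρ δ Q hQ
      -- `c = x + κ e` is the point of the chord that defines the pocket
      set κ := τ + s * τ with hκ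
      have hs0 := hQ.s_pos
      have hκτ : τ < κ := by rw [hκ]; nlinarith [mul_pos hs0 hτ0']
      have hc : x + τ • e + s • τ • e = x + κ • e := by
        rw [smul_smul, add_assoc, ← add_smul]
      obtain ⟨σ, hσ, hσsub⟩ := exists_uniform_halfBall (P := P) (v := x) (d := e) hne
        (K := Icc (min 1 κ) (max 1 κ)) isCompact_Icc (by
          intro t ht
          rcases le_or_gt t 1 with h1 | h1
          · exact hgood' t ((lt_min hτ1' hκτ).trans_le ht.1) h1
          · have htκ : t ≤ κ := by
              rcases le_max_iff.1 ht.2 with h | h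
              · linarith
              · exact h
            have := hQ.interior ((t - τ) / τ) ⟨div_pos (by linarith) hτ0', by
              rw [div_le_iff₀ hτ0']; linarith⟩
            rw [smul_smul, div_mul_cancel₀ _ hτ0'.ne', add_assoc, ← add_smul,
              add_sub_cancel] at this
            exact hint n _ this)
      refine ⟨σ, hσ, ?_⟩
      set S : Set ℂ := {q | ∃ t ∈ Icc (min 1 κ) (max 1 κ), q ∈ halfBall n (x + t • e) σ}
      have hSP : S ∪ halfBall n (x + κ • e) ρ ⊆ P \ chord P (x + τ • e) (τ • e) := by
        rintro q (⟨t, ht, hq⟩ | hq)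
        · refine ⟨hσsub t ht hq, ?_⟩
          refine not_mem_chord_of_inner_ne (n := n) (s := (t - τ) / τ) hw.perp ?_
          rw [smul_smul, div_mul_cancel₀ _ hτ0'.ne', add_assoc, ← add_smul, add_sub_cancel]
          exact hq.2.ne'
        · rw [← hc] at hq
          exact ⟨hQ.ball_subset hq.1, not_mem_chord_of_inner_ne hw.perp hq.2.ne'⟩
      have hρ : 0 < ρ := (norm_nonneg _).trans_lt hQ.norm_lt
      have hmem : ∀ τ' : ℝ, 0 < τ' →
          x + κ • e + (τ' / (2 * ‖n‖)) • n ∈ halfBall n (x + κ • e) τ' := by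
        intro τ' h0
        refine mem_halfBall_add_smul hn (by positivity) ?_
        rw [norm_smul, Real.norm_eq_abs, abs_of_pos (by positivity)]
        have : τ' / (2 * ‖n‖) * ‖n‖ = τ' / 2 := by field_simp
        rw [this]; linarith
      have hpre : IsPreconnected (S ∪ halfBall n (x + κ • e) ρ) := by
        have := hmem (min σ ρ) (lt_min hσ hρ)
        refine IsPreconnected.union _
          ⟨κ, ⟨min_le_right _ _, le_max_right _ _⟩, halfBall_mono (min_le_left _ _) this⟩
          (halfBall_mono (min_le_right _ _) this)
          (convex_iUnion_halfBall x e n _ _ σ).isPreconnected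
          (convex_halfBall _ _ _).isPreconnected
      have hsub := hQ.absorb hpre hSP ⟨_, Or.inr (by
        have := mem_halfBall_add_smul (c := x + κ • e) hn hQ.δ_pos hQ.norm_lt
        exact this), by rw [← hc]; exact hQ.germ_mem⟩
      intro q hq
      refine hsub (Or.inl ⟨1, ⟨min_le_left _ _, le_max_left _ _⟩, ?_⟩)
      simpa using hq

/-! ### Construction of the guards -/

/-- The unit normal on the left of a nonzero vector. -/
noncomputable def leftNormal (z : ℂ) : ℂ := I * (z / ‖z‖)

lemma leftNormal_smul {t : ℝ} (ht : 0 < t) (z : ℂ) : leftNormal (t • z) = leftNormal z := by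
  rw [leftNormal, leftNormal, norm_smul, Real.norm_eq_abs, abs_of_pos ht, real_smul]
  push_cast
  rw [mul_div_mul_left _ _ (by exact_mod_cast ht.ne')]

lemma leftNormal_ne_zero {z : ℂ} (hz : z ≠ 0) : leftNormal z ≠ 0 := by
  simp [leftNormal, hz]

lemma inner_leftNormal_self (z : ℂ) : inner ℝ (leftNormal z) z = 0 := by
  have : leftNormal z = (‖z‖⁻¹ : ℝ) • (I * z) := by
    rw [leftNormal, real_smul]; push_cast; ring
  rw [this, real_inner_smul_left, Complex.inner]
  simp
  right
  ring

/-- The pockets behind the windows seen from an interior point. -/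
theorem IsPolygonal.exists_pockets {P : Set ℂ} {W : Finset ℂ} (hP : IsPolygonal P W) {x : ℂ}
    (hx : x ∈ interior P) : ∃ 𝒬 : Set (Set ℂ), 𝒬.Finite ∧ 𝒬.PairwiseDisjoint id ∧
      (∀ Q ∈ 𝒬, ∃ c n, IsNode P c n Q) ∧ (∀ Q ∈ 𝒬, Disjoint Q (vis P x)) ∧
      interior P \ vis P x ⊆ ⋃₀ 𝒬 ∧
      ∀ Q ∈ 𝒬, ∃ v ∈ W, v ∈ vis P x ∧ ∀ A : Set ℂ, IsPreconnected A → A ⊆ P →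
        Disjoint A (chord P v (v - x)) → (A ∩ Q).Nonempty → A ⊆ Q := by
  classical
  set N : ℂ × ℝ → ℂ := fun i => i.2 • leftNormal (i.1 - x) with hN
  have hch : ∀ i : ℂ × ℝ, IsWindow P i.1 (i.1 - x) (N i) →
      ∃ Q, ∃ R s ρ δ, IsPocket P i.1 (i.1 - x) (N i) R s ρ δ Q := by
    intro i hi
    obtain ⟨R, s, ρ, δ, Q, h⟩ := hi.exists_pocket
    exact ⟨Q, R, s, ρ, δ, h⟩
  choose! F hF using hch
  set J : Set (ℂ × ℝ) := {i | i ∈ W ×ˢ ({1, -1} : Finset ℝ) ∧ IsWindow P i.1 (i.1 - x) (N i)}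
  have hJf : J.Finite := (Finset.finite_toSet (W ×ˢ ({1, -1} : Finset ℝ))).subset fun i hi => hi.1
  have hdisvis : ∀ i ∈ J, Disjoint (F i) (vis P x) := by
    rintro i hi
    obtain ⟨R, s, ρ, δ, h⟩ := hF i hi.2
    have := h.disjoint_vis hP
    rwa [sub_sub_cancel] at this
  have hchord : ∀ i ∈ J, chord P i.1 (i.1 - x) ⊆ vis P x := by
    intro i hi
    have := chord_subset_vis hi.2
    rwa [sub_sub_cancel] at this
  have habs : ∀ i ∈ J, ∀ A : Set ℂ, IsPreconnected A → A ⊆ P →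
      Disjoint A (chord P i.1 (i.1 - x)) → (A ∩ F i).Nonempty → A ⊆ F i := by
    intro i hi A hA hAP hdis hne
    obtain ⟨R, s, ρ, δ, h⟩ := hF i hi.2
    exact h.absorb hA (fun a ha => ⟨hAP ha, Set.disjoint_left.1 hdis ha⟩) hne
  have hpre : ∀ i ∈ J, IsPreconnected (F i) ∧ F i ⊆ P := by
    intro i hi
    obtain ⟨R, s, ρ, δ, h⟩ := hF i hi.2
    exact ⟨h.preconnected, fun q hq => (h.subset hq).1⟩
  refine ⟨F '' J, hJf.image F, ?_, ?_, ?_, ?_, ?_⟩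
  · -- pockets that meet contain each other
    have hle : ∀ i ∈ J, ∀ j ∈ J, (F i ∩ F j).Nonempty → F i ⊆ F j := fun i hi j hj hne =>
      habs j hj _ (hpre i hi).1 (hpre i hi).2 ((hdisvis i hi).mono_right (hchord j hj)) hne
    rintro _ ⟨i, hi, rfl⟩ _ ⟨j, hj, rfl⟩ hij
    rw [Function.onFun, id, id, Set.disjoint_iff_inter_eq_empty]
    by_contra hne
    have hne' := nonempty_iff_ne_empty.2 hne
    exact hij ((hle i hi j hj hne').antisymm (hle j hj i hi (by rwa [inter_comm])))
  · rintro _ ⟨i, hi, rfl⟩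
    obtain ⟨R, s, ρ, δ, h⟩ := hF i hi.2
    exact ⟨_, _, h.isNode hP⟩
  · rintro _ ⟨i, hi, rfl⟩
    exact hdisvis i hi
  · rintro y ⟨hy, hyv⟩
    have hcl := isClosed_vis hP.compact.isClosed x
    have hMo : IsOpen (interior P \ vis P x) := isOpen_interior.sdiff hcl
    set C := connectedComponentIn (interior P \ vis P x) y with hC
    have hCsub : C ⊆ interior P \ vis P x := connectedComponentIn_subset _ _
    have hyC : y ∈ C := mem_connectedComponentIn ⟨hy, hyv⟩
    have hCo : IsOpen C := hMo.connectedComponentIn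
    -- the component of `y` in the invisible part borders on the visible part
    obtain ⟨p, hpC, hpint, hpv⟩ : ∃ p ∈ closure C, p ∈ interior P ∧ p ∈ vis P x := by
      by_contra! hcon
      have : interior P ⊆ C := by
        refine hP.preconnected_interior.subset_of_closure_inter_subset hCo ⟨y, hy, hyC⟩ ?_
        rintro p ⟨hpC, hp⟩
        have hpM : p ∈ interior P \ vis P x := ⟨hp, hcon p hpC hp⟩
        obtain ⟨q, hq1, hq2⟩ := mem_closure_iff.1 hpC _ (hMo.connectedComponentIn (x := p))
          (mem_connectedComponentIn hpM)
        rw [hC, connectedComponentIn_eq hq2, ← connectedComponentIn_eq hq1]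
        exact mem_connectedComponentIn hpM
      exact (hCsub (this hx)).2 (mem_vis_self (interior_subset hx))
    set e := p - x with he
    have hpe : p = x + e := by rw [he]; ring
    have he0 : e ≠ 0 := by
      intro h0
      have hpx : p = x := by rw [hpe, h0, add_zero]
      obtain ⟨r, hr, hb⟩ := Metric.isOpen_iff.1 isOpen_interior x hx
      obtain ⟨q, hq1, hq2⟩ := mem_closure_iff.1 hpC _ isOpen_ball
        (by rw [hpx]; exact mem_ball_self hr)
      exact (hCsub hq2).2 (ball_subset_vis (hb.trans interior_subset) hq1)
    have hm0 := leftNormal_ne_zero he0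
    have hme := inner_leftNormal_self e
    have hexit : ∀ σ ∈ ({1, -1} : Finset ℝ), ∃ r : ℝ, 0 < r ∧
        ∀ q ∈ C, q ∈ halfBall (σ • leftNormal e) p r → y ∈ ⋃₀ (F '' J) := by
      intro σ hσ
      have hσ0 : σ ≠ 0 := by
        rintro rfl
        simp at hσ
      rcases hP.exit (n := σ • leftNormal e) hx (by rwa [← hpe]) (by rwa [← hpe]) he0
        (smul_ne_zero hσ0 hm0) (by rw [real_inner_smul_left, hme, mul_zero]) with
        ⟨r, hr, hsub⟩ | ⟨t, ht, hw, htW, hQ⟩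
      · rw [← hpe] at hsub
        exact ⟨r, hr, fun q hqC hq => absurd (hsub hq) (hCsub hqC).2⟩
      · set i : ℂ × ℝ := (x + t • e, σ) with hi
        have e1 : i.1 - x = t • e := by simp [hi]
        have e2 : N i = σ • leftNormal e := by
          simp only [hN, e1, leftNormal_smul ht]
          rfl
        have hiJ : i ∈ J := by
          refine ⟨Finset.mem_product.2 ⟨htW, hσ⟩, ?_⟩
          rw [e1, e2]
          exact hw
        obtain ⟨R, s, ρ, δ, h⟩ := hF i hiJ.2
        rw [e1, e2] at h
        obtain ⟨r, hr, hsub⟩ := hQ R s ρ δ _ h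
        rw [← hpe] at hsub
        refine ⟨r, hr, fun q hqC hq => ⟨F i, mem_image_of_mem _ hiJ, ?_⟩⟩
        refine habs i hiJ C isPreconnected_connectedComponentIn
          (fun a ha => interior_subset (hCsub ha).1) ?_ ⟨q, hqC, hsub hq⟩ hyC
        exact Set.disjoint_left.2 fun a ha hac => (hCsub ha).2 (hchord i hiJ hac)
    obtain ⟨r₁, hr₁, h₁⟩ := hexit 1 (by simp)
    obtain ⟨r₂, hr₂, h₂⟩ := hexit (-1) (by simp)
    rw [one_smul] at h₁
    rw [neg_one_smul] at h₂
    set r := min r₁ r₂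
    -- a point of the component close to `p` and off the line of sight
    obtain ⟨q, hqC, hqb, hq0⟩ : ∃ q ∈ C, q ∈ ball p r ∧ inner ℝ (leftNormal e) (q - p) ≠ 0 := by
      obtain ⟨q, hqb, hqC⟩ := mem_closure_iff.1 hpC _ isOpen_ball
        (mem_ball_self (lt_min hr₁ hr₂))
      by_cases h0 : inner ℝ (leftNormal e) (q - p) = 0
      · have hc : Continuous fun ε : ℝ => q + ε • leftNormal e := by fun_prop
        have hlim : Filter.Tendsto (fun ε : ℝ => q + ε • leftNormal e) (nhdsWithin 0 (Ioi 0))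
            (nhds q) := by
          simpa using (hc.tendsto 0).mono_left nhdsWithin_le_nhds
        obtain ⟨ε, hε, hε0⟩ := ((hlim.eventually ((hCo.inter isOpen_ball).mem_nhds
          ⟨hqC, hqb⟩)).and self_mem_nhdsWithin).exists
        refine ⟨_, hε.1, hε.2, ?_⟩
        have e1 : q + ε • leftNormal e - p = q - p + ε • leftNormal e := by ring
        rw [e1, inner_add_right, h0, zero_add, real_inner_smul_right]
        exact (mul_pos hε0 (real_inner_self_pos.2 hm0)).ne'
      · exact ⟨q, hqC, hqb, h0⟩
    rcases hq0.lt_or_gt with hlt | hgt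
    · refine h₂ q hqC ⟨ball_subset_ball (min_le_right _ _) hqb, ?_⟩
      rw [inner_neg_left]
      linarith
    · exact h₁ q hqC ⟨ball_subset_ball (min_le_left _ _) hqb, hgt⟩
  · rintro _ ⟨i, hi, rfl⟩
    refine ⟨i.1, (Finset.mem_product.1 hi.1).1, ?_, habs i hi⟩
    apply hchord i hi
    refine ⟨0, le_rfl, by simp, fun u hu => ?_⟩
    have : u = 0 := le_antisymm hu.2 hu.1
    simpa [this] using hi.2.back 0 (by simp)

/-- The guards of `S` see pairwise disjoint parts of `Q` that cover its interior points. -/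
structure GuardsPart (P : Set ℂ) (S : Finset (ℂ × ℂ)) (Q : Set ℂ) : Prop where
  valid : ∀ g ∈ S, g.1 ∈ interior P ∧ g.2 ≠ 0
  subset : ∀ g ∈ S, halfVis P g ⊆ Q
  disjoint : (S : Set (ℂ × ℂ)).PairwiseDisjoint (halfVis P)
  cover : Q ∩ interior P ⊆ ⋃ g ∈ S, halfVis P g

lemma GuardsPart.sUnion {P : Set ℂ} {𝒬 : Set (Set ℂ)} (hf : 𝒬.Finite)
    (hd : 𝒬.PairwiseDisjoint id) (h : ∀ Q ∈ 𝒬, ∃ S, GuardsPart P S Q) :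
    ∃ S, GuardsPart P S (⋃₀ 𝒬) := by
  classical
  choose! S hS using h
  refine ⟨hf.toFinset.biUnion S, ?_, ?_, ?_, ?_⟩
  · intro g hg
    obtain ⟨Q, hQ, hg⟩ := Finset.mem_biUnion.1 hg
    exact (hS Q (hf.mem_toFinset.1 hQ)).valid g hg
  · intro g hg
    obtain ⟨Q, hQ, hg⟩ := Finset.mem_biUnion.1 hg
    exact ((hS Q (hf.mem_toFinset.1 hQ)).subset g hg).trans
      (subset_sUnion_of_mem (hf.mem_toFinset.1 hQ))
  · intro g hg h hh hgh
    obtain ⟨Q, hQ, hg⟩ := Finset.mem_biUnion.1 (Finset.mem_coe.1 hg)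
    obtain ⟨Q', hQ', hh⟩ := Finset.mem_biUnion.1 (Finset.mem_coe.1 hh)
    rw [hf.mem_toFinset] at hQ hQ'
    by_cases hQQ : Q = Q'
    · subst hQQ
      exact (hS Q hQ).disjoint hg hh hgh
    · exact (hd hQ hQ' hQQ).mono ((hS Q hQ).subset g hg) ((hS Q' hQ').subset h hh)
  · rintro q ⟨⟨Q, hQ, hqQ⟩, hq⟩
    obtain ⟨g, hg, hqg⟩ := mem_iUnion₂.1 ((hS Q hQ).cover ⟨hqQ, hq⟩)
    exact mem_iUnion₂.2 ⟨g, Finset.mem_biUnion.2 ⟨Q, hf.mem_toFinset.2 hQ, hg⟩, hqg⟩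

/-- Every node can be guarded. The pockets behind the windows of its guard are nodes again, and they
contain fewer vertices, as the vertex at the window lies in the node but not in the pocket. -/
theorem IsNode.exists_guardsPart {P : Set ℂ} {W : Finset ℂ} (hP : IsPolygonal P W) {x n : ℂ}
    {Q : Set ℂ} (hQ : IsNode P x n Q) : ∃ S, GuardsPart P S Q := by
  classical
  induction hk : (W.filter (· ∈ Q)).card using Nat.strong_induction_on generalizing x n Q with
  | _ k ih =>
    subst hk
    obtain ⟨𝒬, hf, hd, hnode, hdis, hcov, hv⟩ := hP.exists_pockets hQ.mem_interior
    set 𝒬' : Set (Set ℂ) := {Q' ∈ 𝒬 | (Q' ∩ Q).Nonempty}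
    have hsub : ∀ Q' ∈ 𝒬', Q' ⊆ Q := by
      rintro Q' ⟨hQ', hne⟩
      obtain ⟨c, m, hc⟩ := hnode Q' hQ'
      exact hQ.absorb Q' hc.preconnected hc.subset (hdis Q' hQ') hne
    obtain ⟨S, hS⟩ : ∃ S, GuardsPart P S (⋃₀ 𝒬') := by
      refine GuardsPart.sUnion (hf.subset fun _ h => h.1) (hd.subset fun _ h => h.1) ?_
      rintro Q' hQ'
      obtain ⟨c, m, hc⟩ := hnode Q' hQ'.1
      refine ih _ ?_ hc rfl
      obtain ⟨v, hvW, hvis, habs⟩ := hv Q' hQ'.1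
      have hvQ' : v ∉ Q' := fun h => Set.disjoint_left.1 (hdis Q' hQ'.1) h hvis
      -- the window lies in the field of the guard: otherwise `Q` would not meet it
      have hvH : 0 < inner ℝ n (v - x) := by
        by_contra! hle
        have hQQ' : Q ⊆ Q' := by
          refine habs Q hQ.preconnected hQ.subset ?_ (by rw [inter_comm]; exact hQ'.2)
          rw [Set.disjoint_left]
          rintro q hq ⟨t, ht, hqt, hqv⟩
          have hqvis : q ∈ vis P x := by
            have e1 : x = v + (-1 : ℝ) • (v - x) := by simp
            rw [hqt]
            nth_rewrite 1 [e1]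
            rw [vis, mem_ofPred_eq, segment_line_subset_iff]
            intro u hu
            rw [uIcc_of_le (by linarith)] at hu
            rcases le_total u 0 with h0 | h0
            · have := hvis
              have e2 : v = v + (0 : ℝ) • (v - x) := by simp
              rw [e2] at this
              nth_rewrite 1 [e1] at this
              rw [vis, mem_ofPred_eq, segment_line_subset_iff, uIcc_of_le (by norm_num)] at this
              exact this u ⟨hu.1, h0⟩
            · exact hqv u ⟨h0, hu.2⟩
          have := hQ.inner_pos q hq hqvis
          have e3 : q - x = (1 + t) • (v - x) := by
            rw [hqt, add_smul, one_smul]; ring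
          rw [e3, real_inner_smul_right] at this
          nlinarith
        obtain ⟨r, hr, hb⟩ := Metric.isOpen_iff.1 isOpen_interior x hQ.mem_interior
        have hnn : 0 < ‖n‖ := norm_pos_iff.2 hQ.n_ne
        have hg := mem_halfBall_add_smul (n := n) (c := x) (r := r) (δ := r / (2 * ‖n‖))
          hQ.n_ne (by positivity) (by
            rw [norm_smul, Real.norm_eq_abs, abs_of_pos (by positivity)]
            have : r / (2 * ‖n‖) * ‖n‖ = r / 2 := by field_simp
            rw [this]; linarith)
        have hgv := ball_subset_vis (hb.trans interior_subset) hg.1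
        exact Set.disjoint_left.1 (hdis Q' hQ'.1) (hQQ' (hQ.halfVis_subset ⟨hgv, hg.2⟩)) hgv
      have hvQ : v ∈ Q := hQ.halfVis_subset ⟨hvis, hvH⟩
      refine Finset.card_lt_card (Finset.ssubset_iff_of_subset ?_ |>.2 ⟨v, ?_, ?_⟩)
      · intro w hw
        rw [Finset.mem_filter] at hw ⊢
        exact ⟨hw.1, hsub Q' hQ' hw.2⟩
      · exact Finset.mem_filter.2 ⟨hvW, hvQ⟩
      · simp [hvQ']
    refine ⟨insert (x, n) S, ?_, ?_, ?_, ?_⟩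
    · intro g hg
      rcases Finset.mem_insert.1 hg with rfl | hg
      · exact ⟨hQ.mem_interior, hQ.n_ne⟩
      · exact hS.valid g hg
    · intro g hg
      rcases Finset.mem_insert.1 hg with rfl | hg
      · exact hQ.halfVis_subset
      · exact (hS.subset g hg).trans (sUnion_subset hsub)
    · rw [Finset.coe_insert]
      refine hS.disjoint.insert fun g hg _ => ?_
      refine Disjoint.mono (fun q hq => hq.1) (hS.subset g hg) (Disjoint.symm ?_)
      exact disjoint_sUnion_left.2 fun Q' hQ' => hdis Q' hQ'.1
    · rintro q ⟨hqQ, hq⟩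
      by_cases hqv : q ∈ vis P x
      · exact mem_iUnion₂.2 ⟨(x, n), Finset.mem_insert_self _ _, hqv, hQ.inner_pos q hqQ hqv⟩
      · obtain ⟨Q', hQ', hqQ'⟩ := hcov ⟨hq, hqv⟩
        obtain ⟨g, hg, hqg⟩ := mem_iUnion₂.1 (hS.cover
          ⟨⟨Q', ⟨hQ', q, hqQ', hqQ⟩, hqQ'⟩, hq⟩)
        exact mem_iUnion₂.2 ⟨g, Finset.mem_insert_of_mem hg, hqg⟩

/-- Two guards at an interior point that look in opposite directions, together with the guards of
the pockets behind all windows seen from this point. -/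
theorem IsPolygonal.exists_guards {P : Set ℂ} {W : Finset ℂ} (hP : IsPolygonal P W) :
    ∃ S : Finset (ℂ × ℂ), (∀ g ∈ S, g.1 ∈ P ∧ g.2 ≠ 0) ∧
      (S : Set (ℂ × ℂ)).PairwiseDisjoint (halfVis P) ∧ P ⊆ closure (⋃ g ∈ S, halfVis P g) := by
  classical
  rcases (interior P).eq_empty_or_nonempty with h0 | ⟨x, hx⟩
  · have := hP.subset_closure_interior
    rw [h0, closure_empty] at this
    exact ⟨∅, by simp, by simp, this.trans (empty_subset _)⟩
  obtain ⟨𝒬, hf, hd, hnode, hdis, hcov, -⟩ := hP.exists_pockets hx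
  obtain ⟨S, hS⟩ : ∃ S, GuardsPart P S (⋃₀ 𝒬) := by
    refine GuardsPart.sUnion hf hd fun Q hQ => ?_
    obtain ⟨c, m, hc⟩ := hnode Q hQ
    exact hc.exists_guardsPart hP
  have hvisS : ∀ n, ∀ g ∈ S, Disjoint (halfVis P (x, n)) (halfVis P g) := fun n g hg =>
    Disjoint.mono (fun q hq => hq.1) (hS.subset g hg)
      (disjoint_sUnion_left.2 hdis).symm
  refine ⟨insert (x, 1) (insert (x, -1) S), ?_, ?_, ?_⟩
  · intro g hg
    rcases Finset.mem_insert.1 hg with rfl | hg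
    · exact ⟨interior_subset hx, one_ne_zero⟩
    rcases Finset.mem_insert.1 hg with rfl | hg
    · exact ⟨interior_subset hx, neg_ne_zero.2 one_ne_zero⟩
    · exact ⟨interior_subset (hS.valid g hg).1, (hS.valid g hg).2⟩
  · rw [Finset.coe_insert, Finset.coe_insert]
    refine (hS.disjoint.insert fun g hg _ => hvisS _ g hg).insert fun g hg _ => ?_
    rcases hg with rfl | hg
    · rw [Set.disjoint_left]
      rintro q ⟨-, h1⟩ ⟨-, h2⟩
      simp only [inner_neg_left] at h1 h2
      linarith
    · exact hvisS _ g hg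
  · refine hP.subset_closure_interior.trans ?_
    have hmain : ∀ y ∈ interior P, inner ℝ (1 : ℂ) (y - x) ≠ 0 →
        y ∈ ⋃ g ∈ insert (x, 1) (insert (x, -1) S), halfVis P g := by
      intro y hy hy0
      by_cases hyv : y ∈ vis P x
      · rcases hy0.lt_or_gt with hlt | hgt
        · refine mem_iUnion₂.2 ⟨(x, -1), by simp, hyv, ?_⟩
          rw [inner_neg_left]
          linarith
        · exact mem_iUnion₂.2 ⟨(x, 1), by simp, hyv, hgt⟩
      · obtain ⟨g, hg, hyg⟩ := mem_iUnion₂.1 (hS.cover ⟨hcov ⟨hy, hyv⟩, hy⟩)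
        exact mem_iUnion₂.2 ⟨g, by simp [hg], hyg⟩
    refine closure_minimal (fun y hy => ?_) isClosed_closure
    by_cases hy0 : inner ℝ (1 : ℂ) (y - x) = 0
    · have hc : Continuous fun ε : ℝ => y + ε • (1 : ℂ) := by fun_prop
      have hlim : Filter.Tendsto (fun ε : ℝ => y + ε • (1 : ℂ)) (nhdsWithin 0 (Ioi 0))
          (nhds y) := by
        have := (hc.tendsto 0).mono_left (nhdsWithin_le_nhds (s := Ioi 0))
        rwa [zero_smul, add_zero] at this
      refine mem_closure_of_tendsto hlim ?_
      filter_upwards [hlim.eventually (isOpen_interior.mem_nhds hy), self_mem_nhdsWithin]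
        with ε h1 h2
      refine hmain _ h1 ?_
      have e1 : y + ε • (1 : ℂ) - x = y - x + ε • (1 : ℂ) := by ring
      rw [e1, inner_add_right, hy0, zero_add, real_inner_smul_right]
      exact (mul_pos h2 (real_inner_self_pos.2 one_ne_zero)).ne'
    · exact subset_closure (hmain y hy hy0)

/-! ### Splitting guards with a field of 180 degrees -/

lemma unitDir_zero (θ : ℝ) : unitDir θ 0 = Real.cos (θ * (Real.pi / 180)) := rfl

lemma unitDir_one (θ : ℝ) : unitDir θ 1 = Real.sin (θ * (Real.pi / 180)) := rfl

lemma eq_of_smul_unitDir_eq {r r' θ θ' : ℝ} (hr : 0 < r) (hr' : 0 < r') (h : |θ - θ'| < 180)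
    (he : r • unitDir θ = r' • unitDir θ') : θ = θ' := by
  have h0 := congrArg (fun w : Plane => w 0) he
  have h1 := congrArg (fun w : Plane => w 1) he
  simp only [PiLp.smul_apply, unitDir_zero, unitDir_one, smul_eq_mul] at h0 h1
  have hs : Real.sin ((θ - θ') * (Real.pi / 180)) = 0 := by
    rw [sub_mul, Real.sin_sub]
    have : r * r' * (Real.sin (θ * (Real.pi / 180)) * Real.cos (θ' * (Real.pi / 180)) -
        Real.cos (θ * (Real.pi / 180)) * Real.sin (θ' * (Real.pi / 180))) = 0 := by
      linear_combination r' * Real.cos (θ' * (Real.pi / 180)) * h1 -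
        r' * Real.sin (θ' * (Real.pi / 180)) * h0
    exact (mul_eq_zero.1 this).resolve_left (mul_pos hr hr').ne'
  rw [abs_lt] at h
  have hpi := Real.pi_pos
  rw [Real.sin_eq_zero_iff_of_lt_of_lt (by nlinarith) (by nlinarith)] at hs
  rcases mul_eq_zero.1 hs with h2 | h2
  · linarith
  · exact absurd h2 (by positivity)

/-- The complement of a line is open and dense. -/
lemma isOpen_dense_off_line (x : Plane) (θ : ℝ) :
    IsOpen {q : Plane | (q - x) 0 * unitDir θ 1 ≠ (q - x) 1 * unitDir θ 0} ∧
      Dense {q : Plane | (q - x) 0 * unitDir θ 1 ≠ (q - x) 1 * unitDir θ 0} := by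
  refine ⟨isOpen_ne_fun (by fun_prop) (by fun_prop), fun y => ?_⟩
  by_cases hy : (y - x) 0 * unitDir θ 1 ≠ (y - x) 1 * unitDir θ 0
  · exact subset_closure hy
  · push Not at hy
    have hc : Continuous fun ε : ℝ => y + ε • (!₂[unitDir θ 1, -unitDir θ 0] : Plane) := by fun_prop
    have hlim : Filter.Tendsto (fun ε : ℝ => y + ε • (!₂[unitDir θ 1, -unitDir θ 0] : Plane))
        (nhdsWithin 0 (Ioi 0)) (nhds y) := by
      have := (hc.tendsto 0).mono_left (nhdsWithin_le_nhds (s := Ioi 0))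
      rwa [zero_smul, add_zero] at this
    refine mem_closure_of_tendsto hlim ?_
    filter_upwards [self_mem_nhdsWithin] with ε hε
    have hε0 : (0 : ℝ) < ε := hε
    simp only [PiLp.sub_apply] at hy
    change (y 0 + ε * unitDir θ 1 - x 0) * unitDir θ 1 ≠
      (y 1 + ε * -unitDir θ 0 - x 1) * unitDir θ 0
    intro h
    have hsq : unitDir θ 1 ^ 2 + unitDir θ 0 ^ 2 = 1 := by
      rw [unitDir_zero, unitDir_one]; exact Real.sin_sq_add_cos_sq _
    nlinarith

lemma visibleRegion_subset (P : Set Plane) (α : ℝ) (g : Guard) : visibleRegion P α g ⊆ P :=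
  fun _ hq => hq.1 (right_mem_segment _ _ _)

lemma visibleRegion_mono {P : Set Plane} {α β γ : ℝ} {g : Guard} (hβ : 0 ≤ β) (h : β + α ≤ γ) :
    visibleRegion P α ⟨g.pos, g.start + β⟩ ⊆ visibleRegion P γ g := by
  rintro q ⟨hq, r, hr, θ, hθ, hqe⟩
  simp only [mem_Ioo] at hθ
  exact ⟨hq, r, hr, θ, ⟨by linarith [hθ.1], by linarith [hθ.2]⟩, hqe⟩

lemma isGuardSet_of_subset_closure {P : Set Plane} (hP : IsClosed P) {α : ℝ} {S : Finset Guard}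
    (hS : ∀ g ∈ S, g.pos ∈ P) (h : P ⊆ closure (⋃ g ∈ S, visibleRegion P α g)) :
    IsGuardSet P α S := by
  refine ⟨hS, Subset.antisymm (iUnion₂_subset fun g _ =>
    hP.closure_subset_iff.2 (visibleRegion_subset P α g)) ?_⟩
  rwa [S.closure_biUnion] at h

lemma chromaticGuardingNumber_le {P : Set Plane} {α : ℝ} {S : Finset Guard} {k : ℕ}
    (hS : IsGuardSet P α S) (c : Guard → Fin k)
    (hc : ∀ g ∈ S, ∀ h ∈ S, c g = c h →
      (visibleRegion P α g ∩ visibleRegion P α h).Nonempty → g = h) :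
    chromaticGuardingNumber P α ≤ k := by
  refine (iInf₂_le S hS).trans (SimpleGraph.Colorable.chromaticNumber_le ?_)
  refine ⟨SimpleGraph.Coloring.mk (fun g => c g) ?_⟩
  rintro g h ⟨hne, hgh⟩ hcol
  exact hne (Subtype.ext (hc g g.2 h h.2 hcol hgh))

lemma one_le_chromaticGuardingNumber {P : Set Plane} (hne : P.Nonempty) (α : ℝ) :
    1 ≤ chromaticGuardingNumber P α := by
  refine le_iInf₂ fun S hS => ?_
  rw [Order.one_le_iff_ne_zero, Ne, SimpleGraph.chromaticNumber_eq_zero_iff, not_isEmpty_iff]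
  obtain ⟨q, hq⟩ := hne
  rw [← hS.2] at hq
  obtain ⟨g, hg, -⟩ := mem_iUnion₂.1 hq
  exact ⟨⟨g, hg⟩⟩

/-- A field of 180 degrees is split into as many consecutive disjoint fields of `α` degrees as fit,
which get the first color, and the last `α` degrees, which get the second color. The guards with the
smaller fields still cover a dense part of the region, since only finitely many rays are lost. -/
theorem chromaticGuardingNumber_le_two {P : Set Plane} (hP : IsClosed P)
    (hint : P ⊆ closure (interior P)) {S : Finset Guard} (hS : ∀ g ∈ S, g.pos ∈ P)
    (hd : (S : Set Guard).PairwiseDisjoint (visibleRegion P 180))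
    (hcov : P ⊆ closure (⋃ g ∈ S, visibleRegion P 180 g)) {α : ℝ} (hα : 0 < α) (hα' : α ≤ 180) :
    chromaticGuardingNumber P α ≤ 2 := by
  classical
  set m := ⌊180 / α⌋₊
  have hmα : m * α ≤ 180 := by
    rw [← le_div_iff₀ hα]
    exact Nat.floor_le (by positivity)
  have hmα' : 180 < (m + 1) * α := by
    rw [← div_lt_iff₀ hα]
    exact Nat.lt_floor_add_one _
  set A : Finset Guard := (S ×ˢ Finset.range m).image fun i => ⟨i.1.pos, i.1.start + i.2 * α⟩
  set B : Finset Guard := S.image fun g => ⟨g.pos, g.start + (180 - α)⟩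
  have hpart : ∀ j < m, (0 : ℝ) ≤ j * α ∧ j * α + α ≤ 180 := by
    intro j hj
    have : ((j + 1 : ℕ) : ℝ) ≤ m := by exact_mod_cast hj
    push_cast at this
    exact ⟨by positivity, by nlinarith⟩
  -- guards with a common visible point come from the same guard with the large field
  have hsame : ∀ g ∈ S, ∀ h ∈ S, ∀ β γ : ℝ, 0 ≤ β → β + α ≤ 180 → 0 ≤ γ → γ + α ≤ 180 →
      (visibleRegion P α ⟨g.pos, g.start + β⟩ ∩ visibleRegion P α ⟨h.pos, h.start + γ⟩).Nonempty →
      g = h ∧ |β - γ| < α := by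
    rintro g hg h hh β γ hβ hβ' hγ hγ' ⟨q, hq1, hq2⟩
    have hgh : g = h := by
      by_contra hne
      exact Set.disjoint_left.1 (hd hg hh hne) (visibleRegion_mono hβ hβ' hq1)
        (visibleRegion_mono hγ hγ' hq2)
    subst hgh
    refine ⟨rfl, ?_⟩
    obtain ⟨-, r, hr, θ, hθ, he⟩ := hq1
    obtain ⟨-, r', hr', θ', hθ', he'⟩ := hq2
    simp only [mem_Ioo] at hθ hθ' he he'
    have : θ = θ' := by
      refine eq_of_smul_unitDir_eq hr hr' ?_ (add_left_cancel (he.symm.trans he'))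
      rw [abs_lt]
      constructor <;> linarith [hθ.1, hθ.2, hθ'.1, hθ'.2]
    rw [abs_lt]
    constructor <;> linarith [hθ.1, hθ.2, hθ'.1, hθ'.2]
  have hguard : IsGuardSet P α (A ∪ B) := by
    refine isGuardSet_of_subset_closure hP ?_ fun y hy => ?_
    · intro t ht
      rcases Finset.mem_union.1 ht with ht | ht
      · obtain ⟨i, hi, rfl⟩ := Finset.mem_image.1 ht
        exact hS i.1 (Finset.mem_product.1 hi).1
      · obtain ⟨g, hg, rfl⟩ := Finset.mem_image.1 ht
        exact hS g hg
    · rw [_root_.mem_closure_iff]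
      intro U hU hyU
      obtain ⟨y', hy'U, hy'⟩ := _root_.mem_closure_iff.1 (hint hy) U hU hyU
      set I : Finset (Guard × ℕ) := S ×ˢ Finset.range (m + 1)
      set L : Guard × ℕ → Set Plane := fun i =>
        {q : Plane | (q - i.1.pos) 0 * unitDir (i.1.start + i.2 * α) 1 ≠
          (q - i.1.pos) 1 * unitDir (i.1.start + i.2 * α) 0}
      have hLo : IsOpen (⋂ i ∈ I, L i) :=
        isOpen_biInter_finset fun i _ => (isOpen_dense_off_line _ _).1
      have hLd : Dense (⋂ i ∈ (I : Set (Guard × ℕ)), L i) :=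
        dense_biInter_of_isOpen (fun i _ => (isOpen_dense_off_line _ _).1)
          I.countable_toSet (fun i _ => (isOpen_dense_off_line _ _).2)
      have hUo : IsOpen (U ∩ interior P) := hU.inter isOpen_interior
      obtain ⟨z, hzU, hzL⟩ := hLd.inter_open_nonempty _ hUo ⟨y', hy'U, hy'⟩
      obtain ⟨w, ⟨hwU, hwL⟩, hw⟩ := _root_.mem_closure_iff.1 (hcov (interior_subset hzU.2)) _
        (hUo.inter hLo) ⟨hzU, by simpa using hzL⟩
      obtain ⟨g, hg, hwg, r, hr, θ, hθ, hwe⟩ := mem_iUnion₂.1 hw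
      refine ⟨w, hwU.1, mem_iUnion₂.2 ?_⟩
      -- the direction of `w` is not one of the excluded ones
      have hθj : ∀ j ≤ m, θ ≠ g.start + j * α := by
        rintro j hj rfl
        have := mem_iInter₂.1 hwL (g, j)
          (Finset.mem_product.2 ⟨hg, Finset.mem_range.2 (by omega)⟩)
        apply this
        simp only [hwe, add_sub_cancel_left, PiLp.smul_apply, smul_eq_mul]
        ring
      rcases lt_or_gt_of_ne (hθj m le_rfl) with hlt | hgt
      · set j := ⌊(θ - g.start) / α⌋₊ with hj
        have hpos : 0 ≤ (θ - g.start) / α := div_nonneg (by linarith [hθ.1]) hα.le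
        have hj1 : j * α ≤ θ - g.start := by
          rw [← le_div_iff₀ hα]; exact Nat.floor_le hpos
        have hj2 : θ - g.start < (j + 1) * α := by
          rw [← div_lt_iff₀ hα]; exact Nat.lt_floor_add_one _
        have hjm : j < m := by
          have : (j : ℝ) < m := by
            have : j * α < m * α := by linarith
            exact lt_of_mul_lt_mul_right this hα.le
          exact_mod_cast this
        refine ⟨⟨g.pos, g.start + j * α⟩, Finset.mem_union_left _ (Finset.mem_image.2
          ⟨(g, j), Finset.mem_product.2 ⟨hg, Finset.mem_range.2 hjm⟩, rfl⟩), hwg, r, hr, θ, ?_, hwe⟩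
        simp only [mem_Ioo]
        refine ⟨lt_of_le_of_ne (by linarith) (hθj j hjm.le).symm, by linarith⟩
      · refine ⟨⟨g.pos, g.start + (180 - α)⟩, Finset.mem_union_right _
          (Finset.mem_image_of_mem _ hg), hwg, r, hr, θ, ?_, hwe⟩
        simp only [mem_Ioo]
        exact ⟨by linarith, by linarith [hθ.2]⟩
  refine chromaticGuardingNumber_le (k := 2) hguard (fun t => if t ∈ A then 0 else 1) ?_
  intro t ht t' ht' hcol hne
  by_cases htA : t ∈ A <;> by_cases htA' : t' ∈ A
  · obtain ⟨⟨g, j⟩, hi, rfl⟩ := Finset.mem_image.1 htA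
    obtain ⟨⟨g', j'⟩, hi', rfl⟩ := Finset.mem_image.1 htA'
    obtain ⟨hg, hj⟩ := Finset.mem_product.1 hi
    obtain ⟨hg', hj'⟩ := Finset.mem_product.1 hi'
    have h1 := hpart j (Finset.mem_range.1 hj)
    have h2 := hpart j' (Finset.mem_range.1 hj')
    obtain ⟨rfl, habs⟩ := hsame g hg g' hg' _ _ h1.1 h1.2 h2.1 h2.2 hne
    have : j = j' := by
      rw [← sub_mul, abs_mul, abs_of_pos hα] at habs
      have h3 : |((j : ℤ) : ℝ) - ((j' : ℤ) : ℝ)| < 1 := by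
        have : |(j : ℝ) - j'| * α < 1 * α := by linarith
        exact_mod_cast lt_of_mul_lt_mul_right this hα.le
      have h4 : |(j : ℤ) - j'| < 1 := by exact_mod_cast h3
      have := Int.abs_lt_one_iff.1 h4
      omega
    rw [this]
  · simp [htA, htA'] at hcol
  · simp [htA, htA'] at hcol
  · obtain ⟨g, hg, rfl⟩ := Finset.mem_image.1 ((Finset.mem_union.1 ht).resolve_left htA)
    obtain ⟨g', hg', rfl⟩ := Finset.mem_image.1 ((Finset.mem_union.1 ht').resolve_left htA')
    obtain ⟨rfl, -⟩ := hsame g hg g' hg' _ _ (by linarith) (by linarith) (by linarith)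
      (by linarith) hne
    rfl

theorem chromaticGuardingNumber_eq_one {P : Set Plane} (hP : IsClosed P) (hne : P.Nonempty)
    {S : Finset Guard} (hS : ∀ g ∈ S, g.pos ∈ P)
    (hd : (S : Set Guard).PairwiseDisjoint (visibleRegion P 180))
    (hcov : P ⊆ closure (⋃ g ∈ S, visibleRegion P 180 g)) :
    chromaticGuardingNumber P 180 = 1 := by
  refine le_antisymm ?_ (one_le_chromaticGuardingNumber hne _)
  refine chromaticGuardingNumber_le (k := 1) (isGuardSet_of_subset_closure hP hS hcov)
    (fun _ => 0) ?_
  rintro g hg h hh - ⟨q, hq1, hq2⟩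
  by_contra hgh
  exact Set.disjoint_left.1 (hd hg hh hgh) hq1 hq2

/-! ### Transfer from the complex plane -/

/-- The isometry between the complex plane and the Euclidean plane. -/
noncomputable def toPlane : ℂ ≃ₗᵢ[ℝ] Plane := Complex.orthonormalBasisOneI.repr

lemma toPlane_zero (z : ℂ) : toPlane z 0 = z.re := rfl

lemma toPlane_one (z : ℂ) : toPlane z 1 = z.im := rfl

lemma toPlane_eq_smul_unitDir_iff {w : ℂ} {r θ : ℝ} :
    toPlane w = r • unitDir θ ↔ w = r * exp ((θ * (Real.pi / 180) : ℝ) * I) := by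
  have h : toPlane (r * exp ((θ * (Real.pi / 180) : ℝ) * I)) = r • unitDir θ := by
    ext i
    fin_cases i
    · change toPlane _ 0 = (r • unitDir θ) 0
      rw [toPlane_zero, PiLp.smul_apply, unitDir_zero, re_ofReal_mul, exp_ofReal_mul_I_re,
        smul_eq_mul]
    · change toPlane _ 1 = (r • unitDir θ) 1
      rw [toPlane_one, PiLp.smul_apply, unitDir_one, im_ofReal_mul, exp_ofReal_mul_I_im,
        smul_eq_mul]
  rw [← h, toPlane.injective.eq_iff]

lemma image_toPlane_segment (a b : ℂ) :
    toPlane '' segment ℝ a b = segment ℝ (toPlane a) (toPlane b) :=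
  image_segment ℝ toPlane.toLinearEquiv.toLinearMap.toAffineMap a b

/-- The guard in the Euclidean plane whose field of 180 degrees is the half plane with normal
`g.2`. -/
noncomputable def toGuard (g : ℂ × ℂ) : Guard := ⟨toPlane g.1, arg g.2 * (180 / Real.pi) - 90⟩

lemma inner_pos_iff {n w : ℂ} (hn : n ≠ 0) : 0 < inner ℝ n w ↔ 0 < (w / n).re := by
  have hN : 0 < normSq n := normSq_pos.2 hn
  rw [Complex.inner, div_re, ← add_div, div_pos_iff_of_pos_right hN]
  simp only [mul_re, conj_re, conj_im]
  constructor <;> intro h <;> linarith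

lemma exists_unitDir_iff {n w : ℂ} (hn : n ≠ 0) :
    (∃ r : ℝ, 0 < r ∧ ∃ θ ∈ Ioo (arg n * (180 / Real.pi) - 90)
      (arg n * (180 / Real.pi) - 90 + 180), toPlane w = r • unitDir θ) ↔ 0 < inner ℝ n w := by
  have hpi := Real.pi_pos
  have hpolar : n = ‖n‖ * exp (arg n * I) := (norm_mul_exp_arg_mul_I n).symm
  have hnn : 0 < ‖n‖ := norm_pos_iff.2 hn
  simp only [toPlane_eq_smul_unitDir_iff]
  rw [inner_pos_iff hn]
  constructor
  · rintro ⟨r, hr, θ, hθ, rfl⟩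
    have hq : (r * exp ((θ * (Real.pi / 180) : ℝ) * I)) / n =
        ((r / ‖n‖ : ℝ) : ℂ) * exp ((θ * (Real.pi / 180) - arg n : ℝ) * I) := by
      nth_rewrite 1 [hpolar]
      rw [ofReal_sub, sub_mul, exp_sub]
      push_cast
      field_simp
    rw [hq, re_ofReal_mul, exp_ofReal_mul_I_re]
    refine mul_pos (by positivity) (Real.cos_pos_of_mem_Ioo ⟨?_, ?_⟩)
    · have : arg n = arg n * (180 / Real.pi) * (Real.pi / 180) := by field_simp
      nlinarith [hθ.1]
    · have : arg n = arg n * (180 / Real.pi) * (Real.pi / 180) := by field_simp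
      nlinarith [hθ.2]
  · intro h
    have hw : w ≠ 0 := by rintro rfl; simp at h
    have harg := abs_arg_lt_pi_div_two_iff.2 (Or.inl h)
    rw [abs_lt] at harg
    refine ⟨‖w‖, norm_pos_iff.2 hw, (arg n + arg (w / n)) * (180 / Real.pi), ⟨?_, ?_⟩, ?_⟩
    · have : -(Real.pi / 2) * (180 / Real.pi) = -90 := by field_simp; norm_num
      have h2 : 0 < 180 / Real.pi := by positivity
      nlinarith [mul_lt_mul_of_pos_right harg.1 h2]
    · have : (Real.pi / 2) * (180 / Real.pi) = 90 := by field_simp; norm_num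
      have h2 : 0 < 180 / Real.pi := by positivity
      nlinarith [mul_lt_mul_of_pos_right harg.2 h2]
    · have e1 : (arg n + arg (w / n)) * (180 / Real.pi) * (Real.pi / 180) =
          arg n + arg (w / n) := by field_simp
      rw [e1]
      push_cast
      rw [add_mul, exp_add]
      have h3 : w / n = ‖w / n‖ * exp (arg (w / n) * I) := (norm_mul_exp_arg_mul_I _).symm
      have h4 : w = n * (w / n) := by field_simp
      nth_rewrite 1 [h4]
      nth_rewrite 1 [hpolar]
      nth_rewrite 1 [h3]
      rw [norm_div]
      push_cast
      have : (‖n‖ : ℂ) ≠ 0 := by exact_mod_cast hnn.ne'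
      field_simp

lemma visibleRegion_toGuard {P : Set ℂ} {g : ℂ × ℂ} (hg : g.2 ≠ 0) :
    visibleRegion (toPlane '' P) 180 (toGuard g) = toPlane '' halfVis P g := by
  ext q
  obtain ⟨z, rfl⟩ := toPlane.surjective q
  rw [toPlane.injective.mem_set_image]
  simp only [visibleRegion, halfVis, vis, toGuard, mem_ofPred_eq]
  rw [← image_toPlane_segment, image_subset_image_iff toPlane.injective]
  refine and_congr_right fun _ => ?_
  rw [← exists_unitDir_iff hg]
  simp only [map_sub, sub_eq_iff_eq_add']

/-- The chromatic guarding numbers of the image of a set to which the construction applies. -/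
theorem IsPolygonal.chromaticGuardingNumber {P : Set ℂ} {W : Finset ℂ} (hP : IsPolygonal P W)
    (hne : P.Nonempty) : chromaticGuardingNumber (toPlane '' P) 180 = 1 ∧
      ∀ α : ℝ, 0 < α → α ≤ 180 → chromaticGuardingNumber (toPlane '' P) α ≤ 2 := by
  classical
  obtain ⟨S, hS, hd, hcov⟩ := hP.exists_guards
  have hcl : IsClosed (toPlane '' P) := toPlane.toHomeomorph.isClosed_image.2 hP.compact.isClosed
  have hint : toPlane '' P ⊆ closure (interior (toPlane '' P)) := by
    have e1 : interior (toPlane '' P) = toPlane '' interior P :=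
      (toPlane.toHomeomorph.image_interior P).symm
    have e2 : closure (toPlane '' interior P) = toPlane '' closure (interior P) :=
      (toPlane.toHomeomorph.image_closure _).symm
    rw [e1, e2]
    exact image_mono hP.subset_closure_interior
  have hS' : ∀ g ∈ S.image toGuard, g.pos ∈ toPlane '' P := by
    intro g hg
    obtain ⟨i, hi, rfl⟩ := Finset.mem_image.1 hg
    exact mem_image_of_mem _ (hS i hi).1
  have hd' : ((S.image toGuard : Finset Guard) : Set Guard).PairwiseDisjoint
      (visibleRegion (toPlane '' P) 180) := by
    intro g hg h hh hgh
    obtain ⟨i, hi, rfl⟩ := Finset.mem_image.1 hg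
    obtain ⟨j, hj, rfl⟩ := Finset.mem_image.1 hh
    rw [Function.onFun, visibleRegion_toGuard (hS i hi).2, visibleRegion_toGuard (hS j hj).2]
    exact (disjoint_image_iff toPlane.injective).2 (hd hi hj fun h => hgh (by rw [h]))
  have hcov' : toPlane '' P ⊆ closure (⋃ g ∈ S.image toGuard,
      visibleRegion (toPlane '' P) 180 g) := by
    have e1 : (⋃ g ∈ S.image toGuard, visibleRegion (toPlane '' P) 180 g) =
        toPlane '' ⋃ g ∈ S, halfVis P g := by
      rw [Finset.set_biUnion_finset_image, image_iUnion₂]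
      exact iUnion₂_congr fun g hg => visibleRegion_toGuard (hS g hg).2
    have e2 : closure (toPlane '' ⋃ g ∈ S, halfVis P g) =
        toPlane '' closure (⋃ g ∈ S, halfVis P g) := (toPlane.toHomeomorph.image_closure _).symm
    rw [e1, e2]
    exact image_mono hcov
  exact ⟨chromaticGuardingNumber_eq_one hcl (hne.image _) hS' hd' hcov',
    fun α hα hα' => chromaticGuardingNumber_le_two hcl hint hS' hd' hcov' hα hα'⟩

/-! ### Filling the holes of a compact set -/

/-- A set together with the bounded components of its complement. -/
def fill (K : Set ℂ) : Set ℂ :=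
  K ∪ {x | x ∉ K ∧ Bornology.IsBounded (connectedComponentIn Kᶜ x)}

lemma subset_fill (K : Set ℂ) : K ⊆ fill K := subset_union_left

lemma mem_fill_iff_of_isPreconnected {K A : Set ℂ} (hA : IsPreconnected A) (hAK : A ⊆ Kᶜ) {a b : ℂ}
    (ha : a ∈ A) (hb : b ∈ A) : a ∈ fill K ↔ b ∈ fill K := by
  have h : connectedComponentIn Kᶜ a = connectedComponentIn Kᶜ b :=
    connectedComponentIn_eq (hA.subset_connectedComponentIn ha hAK hb)
  have ha' : a ∉ K := hAK ha
  have hb' : b ∉ K := hAK hb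
  simp [fill, ha', hb', h]

/-- The complement of a filled compact set is the unbounded component of the complement. -/
lemma exists_compl_fill_eq {K : Set ℂ} (hK : IsCompact K) : ∃ (R : ℝ) (z : ℂ),
    {w : ℂ | R < ‖w‖} ⊆ (fill K)ᶜ ∧ (fill K)ᶜ = connectedComponentIn Kᶜ z := by
  obtain ⟨R, hR⟩ := hK.isBounded.exists_norm_le
  have hpre : IsPreconnected {w : ℂ | |R| < ‖w‖} := by
    have h : {w : ℂ | |R| < ‖w‖} =
        (fun u : ℝ × ℝ => (u.1 : ℂ) * exp (u.2 * I)) '' (Ioi |R| ×ˢ univ) := by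
      ext w
      constructor
      · exact fun hw => ⟨(‖w‖, arg w), ⟨hw, trivial⟩, norm_mul_exp_arg_mul_I w⟩
      · rintro ⟨⟨s, φ⟩, ⟨hs, -⟩, rfl⟩
        have hs' : |R| < s := hs
        rw [mem_ofPred_eq, norm_mul, norm_exp_ofReal_mul_I, mul_one, norm_real, Real.norm_eq_abs]
        exact hs'.trans_le (le_abs_self s)
    rw [h]
    exact (isPreconnected_Ioi.prod isPreconnected_univ).image _ (by fun_prop)
  have hsub : {w : ℂ | |R| < ‖w‖} ⊆ Kᶜ := fun w hw hwK =>
    absurd ((hR w hwK).trans (le_abs_self R)) (not_le.2 hw)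
  set z : ℂ := ((|R| + 1 : ℝ) : ℂ) with hz
  have hzm : z ∈ {w : ℂ | |R| < ‖w‖} := by
    rw [mem_ofPred_eq, hz, norm_real, Real.norm_eq_abs,
      abs_of_pos (show (0 : ℝ) < |R| + 1 by positivity)]
    linarith
  have hunb : ¬ Bornology.IsBounded {w : ℂ | |R| < ‖w‖} := by
    intro h
    obtain ⟨M, hM⟩ := h.exists_norm_le
    have := hM (((|R| + |M| + 1 : ℝ) : ℂ)) (by
      rw [mem_ofPred_eq, norm_real, Real.norm_eq_abs,
        abs_of_pos (show (0 : ℝ) < |R| + |M| + 1 by positivity)]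
      linarith [abs_nonneg M])
    rw [norm_real, Real.norm_eq_abs,
      abs_of_pos (show (0 : ℝ) < |R| + |M| + 1 by positivity)] at this
    linarith [le_abs_self M, abs_nonneg R]
  have heq : (fill K)ᶜ = connectedComponentIn Kᶜ z := by
    ext x
    constructor
    · intro hx
      have hxK : x ∉ K := fun h => hx (subset_fill K h)
      have hxb : ¬ Bornology.IsBounded (connectedComponentIn Kᶜ x) := fun h => hx (Or.inr ⟨hxK, h⟩)
      obtain ⟨y, hy, hyR⟩ : ∃ y ∈ connectedComponentIn Kᶜ x, |R| < ‖y‖ := by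
        by_contra! hcon
        exact hxb (isBounded_iff_forall_norm_le.2 ⟨|R|, hcon⟩)
      rw [connectedComponentIn_eq (hpre.subset_connectedComponentIn hzm hsub hyR),
        ← connectedComponentIn_eq hy]
      exact mem_connectedComponentIn hxK
    · rintro hx (hxK | ⟨-, hxb⟩)
      · exact connectedComponentIn_subset _ _ hx hxK
      · rw [← connectedComponentIn_eq hx] at hxb
        exact hunb (hxb.subset (hpre.subset_connectedComponentIn hzm hsub))
  refine ⟨|R|, z, ?_, heq⟩
  rw [heq]
  exact hpre.subset_connectedComponentIn hzm hsub

lemma isCompact_fill {K : Set ℂ} (hK : IsCompact K) : IsCompact (fill K) := by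
  obtain ⟨R, z, hR, hz⟩ := exists_compl_fill_eq hK
  refine isCompact_of_isClosed_isBounded ?_ ?_
  · rw [← isOpen_compl_iff, hz]
    exact hK.isClosed.isOpen_compl.connectedComponentIn
  · refine isBounded_iff_forall_norm_le.2 ⟨R, fun x hx => ?_⟩
    by_contra! h
    exact hR h hx

lemma isPreconnected_compl_fill {K : Set ℂ} (hK : IsCompact K) : IsPreconnected (fill K)ᶜ := by
  obtain ⟨R, z, hR, hz⟩ := exists_compl_fill_eq hK
  rw [hz]
  exact isPreconnected_connectedComponentIn

lemma mem_interior_fill {K : Set ℂ} (hK : IsClosed K) {x : ℂ} (hx : x ∈ fill K) (hxK : x ∉ K) :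
    x ∈ interior (fill K) := by
  refine mem_interior.2 ⟨connectedComponentIn Kᶜ x, fun y hy => ?_,
    hK.isOpen_compl.connectedComponentIn, mem_connectedComponentIn hxK⟩
  exact (mem_fill_iff_of_isPreconnected isPreconnected_connectedComponentIn
    (connectedComponentIn_subset _ _) (mem_connectedComponentIn hxK) hy).1 hx

/-- Otherwise the closure of a component of the complement would not meet the compact set, and the
component would be open and closed in the plane. -/
lemma isPreconnected_fill {K : Set ℂ} (hK : IsCompact K) (hpre : IsPreconnected K)
    (hne : K.Nonempty) : IsPreconnected (fill K) := by
  obtain ⟨y, hy⟩ := hne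
  refine isPreconnected_of_forall y fun x hx => ?_
  by_cases hxK : x ∈ K
  · exact ⟨K, subset_fill K, hy, hxK, hpre⟩
  set C := connectedComponentIn Kᶜ x with hC
  have hxC : x ∈ C := mem_connectedComponentIn hxK
  have hCpre : IsPreconnected (closure C) := isPreconnected_connectedComponentIn.closure
  have hCfill : C ⊆ fill K := fun z hz =>
    (mem_fill_iff_of_isPreconnected isPreconnected_connectedComponentIn
      (connectedComponentIn_subset _ _) hxC hz).1 hx
  obtain ⟨z, hzC, hzK⟩ : (closure C ∩ K).Nonempty := by
    by_contra hcon
    have hsub : closure C ⊆ Kᶜ := fun z hz hzK => hcon ⟨z, hz, hzK⟩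
    have hcl : IsClosed C := isClosed_of_closure_subset
      (hCpre.subset_connectedComponentIn (subset_closure hxC) hsub)
    have hclopen : IsClopen C := ⟨hcl, hK.isClosed.isOpen_compl.connectedComponentIn⟩
    rcases isClopen_iff.1 hclopen with h | h
    · rw [h] at hxC; exact hxC
    · exact connectedComponentIn_subset Kᶜ x (by rw [← hC, h]; trivial) hy
  refine ⟨closure C ∪ K, union_subset ((isCompact_fill hK).isClosed.closure_subset_iff.2 hCfill)
    (subset_fill K), Or.inr hy, Or.inl (subset_closure hxC), hCpre.union z hzC hzK hpre⟩

/-- A preconnected set that is contained in the closure of its interior has a preconnected interior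
if the interior is locally connected along the set. -/
lemma isPreconnected_interior_of_local {P : Set ℂ} (hP : IsPreconnected P)
    (hint : P ⊆ closure (interior P))
    (hloc : ∀ y ∈ P, ∃ r : ℝ, 0 < r ∧ IsPreconnected (ball y r ∩ interior P)) :
    IsPreconnected (interior P) := by
  rintro U V hU hV hUV ⟨a, ha, haU⟩ ⟨b, hb, hbV⟩
  have hcov : P ⊆ closure (interior P ∩ U) ∪ closure (interior P ∩ V) := by
    rw [← closure_union, ← inter_union_distrib_left, inter_eq_self_of_subset_left hUV]
    exact hint
  obtain ⟨y, hyP, hyU, hyV⟩ := isPreconnected_closed_iff.1 hP _ _ isClosed_closure isClosed_closure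
    hcov ⟨a, interior_subset ha, subset_closure ⟨ha, haU⟩⟩
    ⟨b, interior_subset hb, subset_closure ⟨hb, hbV⟩⟩
  obtain ⟨r, hr, hpre⟩ := hloc y hyP
  obtain ⟨u, hu, hu', huU⟩ := _root_.mem_closure_iff.1 hyU _ isOpen_ball (mem_ball_self hr)
  obtain ⟨v, hv, hv', hvV⟩ := _root_.mem_closure_iff.1 hyV _ isOpen_ball (mem_ball_self hr)
  obtain ⟨w, hw, hwUV⟩ := hpre U V hU hV (inter_subset_right.trans hUV) ⟨u, ⟨hu, hu'⟩, huU⟩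
    ⟨v, ⟨hv, hv'⟩, hvV⟩
  exact ⟨w, hw.2, hwUV⟩

/-! ### Local structure of a closed curve made of segments -/

lemma exists_polar (α : ℝ) (z : ℂ) :
    ∃ φ ∈ Ico α (α + 2 * Real.pi), z = ‖z‖ * exp (φ * I) := by
  refine ⟨toIcoMod Real.two_pi_pos α (arg z), toIcoMod_mem_Ico _ _ _, ?_⟩
  rw [toIcoMod]
  nth_rewrite 1 [← norm_mul_exp_arg_mul_I z]
  congr 1
  rw [exp_eq_exp_iff_exists_int]
  refine ⟨toIcoDiv Real.two_pi_pos α (arg z), ?_⟩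
  push_cast
  simp
  ring

lemma norm_polar {s : ℝ} (hs : 0 < s) (φ : ℝ) : ‖(s : ℂ) * exp (φ * I)‖ = s := by
  rw [norm_mul, norm_exp_ofReal_mul_I, mul_one, norm_real, Real.norm_eq_abs, abs_of_pos hs]

lemma eq_of_polar_eq {s s' φ ψ : ℝ} (hs : 0 < s) (hs' : 0 < s') (h : |φ - ψ| < 2 * Real.pi)
    (he : (s : ℂ) * exp (φ * I) = s' * exp (ψ * I)) : φ = ψ := by
  have hss : s = s' := by
    have := congrArg norm he
    rwa [norm_polar hs, norm_polar hs'] at this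
  subst hss
  have h1 := mul_left_cancel₀ (by exact_mod_cast hs.ne') he
  obtain ⟨k, hk⟩ := exp_eq_exp_iff_exists_int.1 h1
  have h2 : φ = ψ + k * (2 * Real.pi) := by
    have := congrArg Complex.im hk
    simpa using this
  have h3 : |(k : ℝ)| < 1 := by
    rw [h2, add_sub_cancel_left, abs_mul, abs_of_pos Real.two_pi_pos] at h
    exact lt_of_mul_lt_mul_right (by linarith) Real.two_pi_pos.le
  have h4 : k = 0 := Int.abs_lt_one_iff.1 (by exact_mod_cast h3)
  simpa [h4] using h2

/-- In the ball of radius `r` around `y` the set `K` consists of the two radii with the directions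
`α` and `β`. -/
structure IsLocalArc (K : Set ℂ) (y : ℂ) (r α β : ℝ) : Prop where
  r_pos : 0 < r
  lt : α < β
  lt_add : β < α + 2 * Real.pi
  mem : y ∈ K
  iff : ∀ s ∈ Ioo 0 r, ∀ φ ∈ Ico α (α + 2 * Real.pi),
    (y + s * exp (φ * I) ∈ K ↔ φ = α ∨ φ = β)

/-- The open circular sector around `y` with radius `r` between the angles `a` and `b`. -/
def sector (y : ℂ) (r a b : ℝ) : Set ℂ :=
  (fun u : ℝ × ℝ => y + u.1 * exp (u.2 * I)) '' (Ioo 0 r ×ˢ Ioo a b)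

lemma isPreconnected_sector (y : ℂ) (r a b : ℝ) : IsPreconnected (sector y r a b) :=
  (isPreconnected_Ioo.prod isPreconnected_Ioo).image _ (by fun_prop)

lemma mem_sector {y : ℂ} {r a b s φ : ℝ} (hs : s ∈ Ioo 0 r) (hφ : φ ∈ Ioo a b) :
    y + s * exp (φ * I) ∈ sector y r a b := ⟨(s, φ), ⟨hs, hφ⟩, rfl⟩

lemma exp_add_two_pi_mul_I (φ : ℝ) : exp (((φ + 2 * Real.pi : ℝ) : ℂ) * I) = exp (φ * I) := by
  push_cast
  rw [add_mul, exp_add, exp_two_pi_mul_I, mul_one]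

/-- The same arc with its two sides exchanged. -/
lemma IsLocalArc.swap {K : Set ℂ} {y : ℂ} {r α β : ℝ} (h : IsLocalArc K y r α β) :
    IsLocalArc K y r β (α + 2 * Real.pi) := by
  refine ⟨h.r_pos, h.lt_add, by linarith [h.lt], h.mem, fun s hs φ hφ => ?_⟩
  rcases lt_or_ge φ (α + 2 * Real.pi) with hlt | hge
  · rw [h.iff s hs φ ⟨h.lt.le.trans hφ.1, hlt⟩]
    constructor
    · rintro (h1 | h1)
      · linarith [hφ.1, h.lt]
      · exact Or.inl h1
    · rintro (h1 | h1)
      · exact Or.inr h1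
      · linarith
  · have := h.iff s hs (φ - 2 * Real.pi) ⟨by linarith, by linarith [hφ.2, h.lt_add]⟩
    have e := exp_add_two_pi_mul_I (φ - 2 * Real.pi)
    rw [sub_add_cancel] at e
    rw [e, this]
    constructor
    · rintro (h1 | h1)
      · exact Or.inr (by linarith)
      · linarith [hφ.2]
    · rintro (h1 | h1)
      · linarith [h.lt_add]
      · exact Or.inl (by linarith)

lemma sector_subset_ball {y : ℂ} {r a b : ℝ} : sector y r a b ⊆ ball y r := by
  rintro _ ⟨⟨s, φ⟩, ⟨hs, -⟩, rfl⟩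
  rw [mem_ball, dist_eq_norm, add_sub_cancel_left, norm_polar hs.1]
  exact hs.2

lemma IsLocalArc.sector_subset_compl {K : Set ℂ} {y : ℂ} {r α β : ℝ} (h : IsLocalArc K y r α β) :
    sector y r α β ⊆ Kᶜ := by
  rintro _ ⟨⟨s, φ⟩, ⟨hs, hφ⟩, rfl⟩ hK
  rcases (h.iff s hs φ ⟨hφ.1.le, hφ.2.trans h.lt_add⟩).1 hK with h1 | h1
  · exact hφ.1.ne' h1
  · exact hφ.2.ne h1

/-- The two sectors and the two radii fill the ball. -/
lemma IsLocalArc.cases {K : Set ℂ} {y : ℂ} {r α β : ℝ} (h : IsLocalArc K y r α β) {q : ℂ}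
    (hq : q ∈ ball y r) :
    q ∈ K ∨ q ∈ sector y r α β ∨ q ∈ sector y r β (α + 2 * Real.pi) := by
  rcases eq_or_ne (q - y) 0 with h0 | h0
  · left
    rw [sub_eq_zero.1 h0]
    exact h.mem
  obtain ⟨φ, hφ, he⟩ := exists_polar α (q - y)
  have hs : ‖q - y‖ ∈ Ioo 0 r := ⟨norm_pos_iff.2 h0, by rwa [mem_ball, dist_eq_norm] at hq⟩
  have hqe : q = y + ‖q - y‖ * exp (φ * I) := by rw [← he]; ring
  by_cases hK : q ∈ K
  · exact Or.inl hK
  · right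
    have := mt (h.iff _ hs φ hφ).2 (by rwa [← hqe])
    push Not at this
    rw [hqe]
    rcases lt_or_gt_of_ne this.2 with h1 | h1
    · exact Or.inl (mem_sector (by simpa using hs) ⟨lt_of_le_of_ne hφ.1 this.1.symm, h1⟩)
    · exact Or.inr (mem_sector (by simpa using hs) ⟨h1, hφ.2⟩)

lemma mem_closure_sector_of_mem_radius {y : ℂ} {r a b s φ : ℝ} (hab : a < b) (hs : s ∈ Ico 0 r)
    (hφ : φ ∈ Icc a b) : y + s * exp (φ * I) ∈ closure (sector y r a b) := by
  have hr : 0 < r := hs.1.trans_lt hs.2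
  have hc : Continuous fun u : ℝ × ℝ => y + u.1 * exp (u.2 * I) := by fun_prop
  refine image_closure_subset_closure_image hc ⟨(s, φ), ?_, rfl⟩
  rw [closure_prod_eq, closure_Ioo hr.ne, closure_Ioo hab.ne]
  exact ⟨⟨hs.1, hs.2.le⟩, hφ⟩

lemma IsLocalArc.conic {K : Set ℂ} {y : ℂ} {r α β : ℝ} (h : IsLocalArc K y r α β) {z : ℂ}
    (hz : ‖z‖ < r) {t : ℝ} (ht : t ∈ Ioc (0 : ℝ) 1) : y + z ∈ fill K ↔ y + t • z ∈ fill K := by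
  rcases eq_or_ne z 0 with rfl | h0
  · simp
  obtain ⟨φ, hφ, he⟩ := exists_polar α z
  have hz0 : 0 < ‖z‖ := norm_pos_iff.2 h0
  have e1 : y + z = y + (‖z‖ : ℝ) * exp (φ * I) := by rw [← he]
  have e2 : y + t • z = y + ((t * ‖z‖ : ℝ) : ℂ) * exp (φ * I) := by
    nth_rewrite 1 [he]; rw [real_smul]; push_cast; ring
  have h1 : ‖z‖ ∈ Ioo 0 r := ⟨hz0, hz⟩
  have h2 : t * ‖z‖ ∈ Ioo 0 r := ⟨mul_pos ht.1 hz0, by nlinarith [ht.2]⟩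
  by_cases hφK : φ = α ∨ φ = β
  · rw [e1, e2]
    exact iff_of_true (subset_fill K ((h.iff _ h1 φ hφ).2 hφK))
      (subset_fill K ((h.iff _ h2 φ hφ).2 hφK))
  · refine mem_fill_iff_of_isPreconnected
      (A := (fun u : ℝ => y + u * exp (φ * I)) '' Ioo 0 r)
      (isPreconnected_Ioo.image _ (by fun_prop)) ?_ ⟨_, h1, e1.symm⟩ ⟨_, h2, e2.symm⟩
    rintro _ ⟨u, hu, rfl⟩ hK
    exact hφK ((h.iff u hu φ hφ).1 hK)

lemma IsLocalArc.sector_subset_fill_or {K : Set ℂ} {y : ℂ} {r α β : ℝ}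
    (h : IsLocalArc K y r α β) :
    sector y r α β ⊆ fill K ∨ sector y r α β ⊆ (fill K)ᶜ := by
  by_cases hne : ∃ a ∈ sector y r α β, a ∈ fill K
  · obtain ⟨a, ha, haf⟩ := hne
    exact Or.inl fun b hb => (mem_fill_iff_of_isPreconnected (isPreconnected_sector y r α β)
      h.sector_subset_compl ha hb).1 haf
  · push Not at hne
    exact Or.inr hne

/-- A local arc whose left sector is filled, and whose right sector is filled or not. -/
structure IsFilledArc (K : Set ℂ) (y : ℂ) (r α β : ℝ) : Prop extends IsLocalArc K y r α β where
  left : sector y r α β ⊆ fill K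
  right : sector y r β (α + 2 * Real.pi) ⊆ fill K ∨
    sector y r β (α + 2 * Real.pi) ⊆ (fill K)ᶜ

lemma IsFilledArc.ball_subset {K : Set ℂ} {y : ℂ} {r α β : ℝ} (h : IsFilledArc K y r α β)
    (hr : sector y r β (α + 2 * Real.pi) ⊆ fill K) : ball y r ⊆ fill K := by
  intro q hq
  rcases h.cases hq with h1 | h1 | h1
  · exact subset_fill K h1
  · exact h.left h1
  · exact hr h1

lemma IsFilledArc.ball_sdiff {K : Set ℂ} {y : ℂ} {r α β : ℝ} (h : IsFilledArc K y r α β)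
    (hr : sector y r β (α + 2 * Real.pi) ⊆ (fill K)ᶜ) :
    ball y r \ fill K = sector y r β (α + 2 * Real.pi) := by
  ext q
  refine ⟨fun hq => ?_, fun hq => ⟨sector_subset_ball hq, hr hq⟩⟩
  rcases h.cases hq.1 with h1 | h1 | h1
  · exact absurd (subset_fill K h1) hq.2
  · exact absurd (h.left h1) hq.2
  · exact h1

lemma IsFilledArc.ball_inter_interior {K : Set ℂ} (hK : IsClosed K) {y : ℂ} {r α β : ℝ}
    (h : IsFilledArc K y r α β) (hr : sector y r β (α + 2 * Real.pi) ⊆ (fill K)ᶜ) :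
    ball y r ∩ interior (fill K) = sector y r α β := by
  ext q
  constructor
  · rintro ⟨hq, hqi⟩
    rcases h.cases hq with h1 | h1 | h1
    · -- points of the curve are limits of points of the right sector
      exfalso
      have hcl : q ∈ closure (sector y r β (α + 2 * Real.pi)) := by
        rcases eq_or_ne q y with rfl | h0
        · have := mem_closure_sector_of_mem_radius (y := q) (s := 0) h.lt_add ⟨le_rfl, h.r_pos⟩
            (left_mem_Icc.2 h.lt_add.le)
          simpa using this
        · obtain ⟨φ, hφ, he⟩ := exists_polar α (q - y)
          have hs : ‖q - y‖ ∈ Ioo 0 r :=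
            ⟨norm_pos_iff.2 (sub_ne_zero.2 h0), by rwa [mem_ball, dist_eq_norm] at hq⟩
          have hqe : q = y + ‖q - y‖ * exp (φ * I) := by rw [← he]; ring
          rw [hqe] at h1 ⊢
          rcases (h.iff _ hs φ hφ).1 h1 with rfl | rfl
          · rw [← exp_add_two_pi_mul_I]
            exact mem_closure_sector_of_mem_radius h.lt_add ⟨hs.1.le, hs.2⟩
              (right_mem_Icc.2 h.lt_add.le)
          · exact mem_closure_sector_of_mem_radius h.lt_add ⟨hs.1.le, hs.2⟩
              (left_mem_Icc.2 h.lt_add.le)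
      obtain ⟨w, hw1, hw2⟩ := _root_.mem_closure_iff.1 hcl _ isOpen_interior hqi
      exact hr hw2 (interior_subset hw1)
    · exact h1
    · exact absurd (interior_subset hqi) (hr h1)
  · intro hq
    exact ⟨sector_subset_ball hq, mem_interior_fill hK (h.left hq) (h.sector_subset_compl hq)⟩

/-- A compact connected set that locally consists of two radii, straight away from the finite set
`W`, bounds a region to which the construction of guards applies, provided that each of its points
outside `W` is a limit of points enclosed by the set. -/
theorem isPolygonal_fill {K : Set ℂ} {W : Finset ℂ} (hK : IsCompact K) (hpre : IsPreconnected K)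
    (hne : K.Nonempty)
    (harc : ∀ y ∈ K, ∃ r α β, IsLocalArc K y r α β ∧ (y ∉ W → β = α + Real.pi))
    (hreg : ∀ m ∈ K, m ∉ W → ∀ ε : ℝ, 0 < ε → ∃ q ∈ ball m ε, q ∉ K ∧ q ∈ fill K) :
    IsPolygonal (fill K) W := by
  have hfill : ∀ y ∈ K, ∃ r α β, IsFilledArc K y r α β ∧ (y ∉ W → β = α + Real.pi) := by
    intro y hy
    obtain ⟨r, α, β, h, hW⟩ := harc y hy
    rcases h.sector_subset_fill_or with h1 | h1
    · exact ⟨r, α, β, ⟨h, h1, h.swap.sector_subset_fill_or⟩, hW⟩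
    rcases h.swap.sector_subset_fill_or with h2 | h2
    · refine ⟨r, β, α + 2 * Real.pi, ⟨h.swap, h2, ?_⟩, fun hy => by rw [hW hy]; ring⟩
      have hs := h.swap.swap.sector_subset_fill_or
      exact hs
    · -- some point of the curve close to `y` is outside `W`
      exfalso
      have hinj : InjOn (fun s : ℝ => y + s * exp (α * I)) (Ioo 0 r) := by
        intro s hs t ht hst
        have := congrArg norm (add_left_cancel hst)
        rwa [norm_polar hs.1, norm_polar ht.1] at this
      obtain ⟨m, ⟨s, hs, rfl⟩, hmW⟩ :=
        ((Ioo_infinite h.r_pos).image hinj).exists_notMem_finset W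
      have hmK : y + s * exp (α * I) ∈ K :=
        (h.iff s hs α ⟨le_rfl, by linarith [Real.pi_pos]⟩).2 (Or.inl rfl)
      obtain ⟨q, hq, hqK, hqf⟩ := hreg _ hmK hmW (r - s) (by linarith [hs.2])
      have hqb : q ∈ ball y r := by
        rw [mem_ball] at hq ⊢
        have : dist (y + s * exp (α * I)) y = s := by
          rw [dist_eq_norm, add_sub_cancel_left, norm_polar hs.1]
        linarith [dist_triangle q (y + s * exp (α * I)) y]
      rcases h.cases hqb with h3 | h3 | h3
      · exact hqK h3
      · exact h1 h3 hqf
      · exact h2 h3 hqf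
  have hcl := hK.isClosed
  have hclosure : fill K ⊆ closure (interior (fill K)) := by
    intro y hy
    by_cases hyK : y ∈ K
    · obtain ⟨r, α, β, h, -⟩ := hfill y hyK
      have h0 := mem_closure_sector_of_mem_radius (y := y) (s := 0) h.lt ⟨le_rfl, h.r_pos⟩
        (left_mem_Icc.2 h.lt.le)
      rw [ofReal_zero, zero_mul, add_zero] at h0
      exact closure_mono (fun q hq => mem_interior_fill hcl (h.left hq)
        (h.sector_subset_compl hq)) h0
    · exact subset_closure (mem_interior_fill hcl hy hyK)
  have hball : ∀ y ∈ interior (fill K), ∃ r : ℝ, 0 < r ∧ ball y r ⊆ interior (fill K) :=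
    fun y hy => Metric.isOpen_iff.1 isOpen_interior y hy
  refine ⟨isCompact_fill hK, isPreconnected_compl_fill hK, ?_, hclosure, ?_, ?_⟩
  · refine isPreconnected_interior_of_local (isPreconnected_fill hK hpre hne) hclosure
      fun y hy => ?_
    by_cases hyi : y ∈ interior (fill K)
    · obtain ⟨r, hr, hsub⟩ := hball y hyi
      refine ⟨r, hr, ?_⟩
      rw [inter_eq_self_of_subset_left hsub]
      exact (convex_ball y r).isPreconnected
    · have hyK : y ∈ K := by
        by_contra h
        exact hyi (mem_interior_fill hcl hy h)
      obtain ⟨r, α, β, h, -⟩ := hfill y hyK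
      refine ⟨r, h.r_pos, ?_⟩
      rcases h.right with h1 | h1
      · exact absurd (mem_interior.2 ⟨_, h.ball_subset h1, isOpen_ball, mem_ball_self h.r_pos⟩) hyi
      · rw [h.ball_inter_interior hcl h1]
        exact isPreconnected_sector _ _ _ _
  · intro y hy
    by_cases hyK : y ∈ K
    · obtain ⟨r, α, β, h, -⟩ := hfill y hyK
      refine ⟨r, h.r_pos, fun z hz t ht => h.conic hz ht, ?_⟩
      rcases h.right with h1 | h1
      · rw [Set.sdiff_eq_empty.2 (h.ball_subset h1)]
        exact isPreconnected_empty
      · rw [h.ball_sdiff h1]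
        exact isPreconnected_sector _ _ _ _
    · obtain ⟨r, hr, hsub⟩ := hball y (mem_interior_fill hcl hy hyK)
      have hsub' := hsub.trans interior_subset
      refine ⟨r, hr, fun z hz t ht => ?_, ?_⟩
      · refine iff_of_true (hsub' (by simpa [mem_ball, dist_eq_norm] using hz)) (hsub' ?_)
        rw [mem_ball, dist_eq_norm, add_sub_cancel_left, norm_smul, Real.norm_eq_abs,
          abs_of_pos ht.1]
        nlinarith [ht.2, norm_nonneg z]
      · rw [Set.sdiff_eq_empty.2 hsub']
        exact isPreconnected_empty
  · intro v hv hvi d ρ hρ hd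
    by_contra hvW
    have hvK : v ∈ K := by
      by_contra h
      exact hvi (mem_interior_fill hcl hv h)
    obtain ⟨r, α, β, h, hβ⟩ := hfill v hvK
    have hβ := hβ hvW
    rcases h.right with h1 | h1
    · exact hvi (mem_interior.2 ⟨_, h.ball_subset h1, isOpen_ball, mem_ball_self h.r_pos⟩)
    have hd0 : d ≠ 0 := by
      rintro rfl
      have := (hd (ρ / 2) ⟨by linarith, by linarith⟩).1
      rw [smul_zero, add_zero] at this
      exact hvi this
    set s := min (ρ / 2) (r / (2 * ‖d‖)) with hs
    have hr := h.r_pos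
    have hs0 : 0 < s := lt_min (by linarith) (by positivity)
    have hsρ : s < ρ := (min_le_left _ _).trans_lt (by linarith)
    have hsr : ‖s • d‖ < r := by
      rw [norm_smul, Real.norm_eq_abs, abs_of_pos hs0]
      calc s * ‖d‖ ≤ r / (2 * ‖d‖) * ‖d‖ := by gcongr; exact min_le_right _ _
        _ = r / 2 := by field_simp
        _ < r := by linarith
    have hmem : v + s • d ∈ sector v r α β := by
      rw [← h.ball_inter_interior hcl h1]
      exact ⟨by simpa [mem_ball, dist_eq_norm] using hsr, (hd s ⟨hs0, hsρ⟩).1⟩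
    obtain ⟨⟨u, φ⟩, ⟨hu, hφ⟩, he⟩ := hmem
    have he' : (u : ℂ) * exp (φ * I) = s • d := add_left_cancel he
    apply h1 (a := v - s • d) _ (hd s ⟨hs0, hsρ⟩).2
    have e1 : v - s • d = v + u * exp (((φ + Real.pi : ℝ) : ℂ) * I) := by
      rw [← he']
      push_cast
      rw [add_mul, exp_add, exp_pi_mul_I]
      ring
    rw [e1]
    exact mem_sector hu ⟨by linarith [hφ.1], by linarith [hφ.2]⟩

/-! ### Enclosed points next to an edge -/

/-- If `K` stays connected after removal of the point `m` and runs along a segment of direction `d`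
near `m`, then one of the two sides of `K` at `m` is enclosed. Otherwise the quotient
`(z - m₊) / (z - m₋)` for points `m₊`, `m₋` on the two sides has a continuous logarithm on `K`.
It differs by a constant from the principal one on `K \ {m}`, but the latter jumps at `m`. -/
lemma exists_mem_fill_near {K : Set ℂ} (hK : IsCompact K) {m d : ℂ} {r : ℝ} (hd : d ≠ 0)
    (hr : 0 < r) (hm : m ∈ K) (hpre : IsPreconnected (K \ {m}))
    (hloc : ∀ ζ : ℂ, ‖ζ‖ < r → (m + ζ * d ∈ K ↔ ζ.im = 0)) {ε : ℝ} (hε : 0 < ε) :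
    ∃ q ∈ ball m ε, q ∉ K ∧ q ∈ fill K := by
  by_contra! hcon
  set δ := min (r / 2) (ε / (2 * ‖d‖))
  have hδ0 : 0 < δ := lt_min (by linarith) (by positivity)
  have hδr : δ < r := (min_le_left _ _).trans_lt (by linarith)
  have hδε : δ * ‖d‖ < ε := by
    calc δ * ‖d‖ ≤ ε / (2 * ‖d‖) * ‖d‖ := by gcongr; exact min_le_right _ _
      _ = ε / 2 := by field_simp
      _ < ε := by linarith
  have hside : ∀ τ : ℝ, |τ| = 1 → m + ((τ * δ : ℝ) * I) * d ∉ fill K := by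
    intro τ hτ
    have hτ0 : τ ≠ 0 := fun h => by simp [h] at hτ
    have hnorm : ‖((τ * δ : ℝ) : ℂ) * I‖ = δ := by
      rw [norm_mul, norm_I, mul_one, norm_real, Real.norm_eq_abs, abs_mul, hτ, one_mul,
        abs_of_pos hδ0]
    refine hcon _ ?_ ?_
    · rw [mem_ball, dist_eq_norm, add_sub_cancel_left, norm_mul, hnorm]
      exact hδε
    · rw [hloc _ (by rw [hnorm]; exact hδr)]
      simp [hτ0, hδ0.ne']
  have hp := hside 1 (by simp)
  have hn := hside (-1) (by simp)
  rw [one_mul] at hp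
  rw [neg_one_mul] at hn
  set a := m + ((δ : ℝ) * I) * d with ha
  set b := m + (((-δ : ℝ) : ℂ) * I) * d with hb
  obtain ⟨L₁, hL₁, hexp₁⟩ := exists_continuous_log (isCompact_fill hK)
    (isPreconnected_compl_fill hK) hp
  obtain ⟨L₂, hL₂, hexp₂⟩ := exists_continuous_log (isCompact_fill hK)
    (isPreconnected_compl_fill hK) hn
  have hKa : ∀ q ∈ K, q - a ≠ 0 := fun q hq h => hp (by
    rw [← sub_eq_zero.1 h]; exact subset_fill K hq)
  have hKb : ∀ q ∈ K, q - b ≠ 0 := fun q hq h => hn (by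
    rw [← sub_eq_zero.1 h]; exact subset_fill K hq)
  have hseg : ∀ q ∈ K \ {m}, q ∉ segment ℝ a b := by
    rintro q ⟨hqK, hqm⟩ ⟨s, t, hs, ht, hst, rfl⟩
    have e : s • a + t • b = m + (((s - t) * δ : ℝ) * I) * d := by
      rw [ha, hb]
      have : (s : ℂ) + t = 1 := by exact_mod_cast hst
      simp only [real_smul]
      push_cast
      linear_combination m * this
    have hst1 : |s - t| ≤ 1 := by rw [abs_le]; constructor <;> linarith
    rw [e, hloc] at hqK
    · have h0 : (s - t) * δ = 0 := by simpa using hqK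
      apply hqm
      rw [e, h0]
      simp
    · rw [norm_mul, norm_I, mul_one, norm_real, Real.norm_eq_abs, abs_mul, abs_of_pos hδ0]
      nlinarith
  have hconst : ∀ p ∈ K \ {m}, ∀ q ∈ K \ {m},
      L₁ p - L₂ p - log ((p - a) / (p - b)) = L₁ q - L₂ q - log ((q - a) / (q - b)) := by
    intro p hp q hq
    refine eq_of_exp_eq_one (f := fun q => L₁ q - L₂ q - log ((q - a) / (q - b))) hpre ?_ ?_ hp hq
    · have hsub : K \ {m} ⊆ fill K := sdiff_subset.trans (subset_fill K)
      refine ((hL₁.mono hsub).sub (hL₂.mono hsub)).sub (ContinuousOn.clog ?_ ?_)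
      · exact ContinuousOn.div (by fun_prop) (by fun_prop) fun q hq => hKb q hq.1
      · exact fun q hq => div_mem_slitPlane (hseg q hq)
    · intro q hq
      rw [exp_sub, exp_sub, hexp₁ q (subset_fill K hq.1), hexp₂ q (subset_fill K hq.1),
        exp_log (div_ne_zero (hKa q hq.1) (hKb q hq.1)),
        div_self (div_ne_zero (hKa q hq.1) (hKb q hq.1))]
  -- compare the values at `m ± η d` for small `η`
  set g : ℂ → ℂ := fun q => L₁ q - L₂ q with hg
  have hgc : ContinuousWithinAt g K m :=
    ((hL₁.mono (subset_fill K)).sub (hL₂.mono (subset_fill K))) m hm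
  obtain ⟨ρ, hρ, hρg⟩ := Metric.continuousWithinAt_iff.1 hgc (Real.pi / 2) (by positivity)
  set η := min (δ / 2) (ρ / (2 * ‖d‖))
  have hη0 : 0 < η := lt_min (by linarith) (by positivity)
  have hηδ : η < δ := (min_le_left _ _).trans_lt (by linarith)
  have hηρ : η * ‖d‖ < ρ := by
    calc η * ‖d‖ ≤ ρ / (2 * ‖d‖) * ‖d‖ := by gcongr; exact min_le_right _ _
      _ = ρ / 2 := by field_simp
      _ < ρ := by linarith
  have hpt : ∀ τ : ℝ, |τ| = 1 → m + ((τ * η : ℝ) : ℂ) * d ∈ K \ {m} ∧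
      ‖g (m + ((τ * η : ℝ) : ℂ) * d) - g m‖ < Real.pi / 2 ∧
      (m + ((τ * η : ℝ) : ℂ) * d - a) / (m + ((τ * η : ℝ) : ℂ) * d - b) =
        (((η ^ 2 - δ ^ 2) / (η ^ 2 + δ ^ 2) : ℝ) : ℂ) +
          ((-(2 * τ * η * δ) / (η ^ 2 + δ ^ 2) : ℝ) : ℂ) * I := by
    intro τ hτ
    have hτ0 : τ ≠ 0 := fun h => by simp [h] at hτ
    have hτ2 : τ ^ 2 = 1 := by rw [← sq_abs, hτ, one_pow]
    have hnorm : ‖((τ * η : ℝ) : ℂ)‖ = η := by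
      rw [norm_real, Real.norm_eq_abs, abs_mul, hτ, one_mul, abs_of_pos hη0]
    have hKm : m + ((τ * η : ℝ) : ℂ) * d ∈ K :=
      (hloc _ (by rw [hnorm]; linarith)).2 (ofReal_im _)
    refine ⟨⟨hKm, ?_⟩, ?_, ?_⟩
    · simp [hτ0, hη0.ne', hd]
    · rw [← dist_eq_norm]
      refine hρg hKm ?_
      rw [dist_eq_norm, add_sub_cancel_left, norm_mul, hnorm]
      exact hηρ
    · have h1 := hKb _ hKm
      rw [div_eq_iff h1, ha, hb]
      have h2 : ((η : ℂ) ^ 2 + δ ^ 2) ≠ 0 := by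
        have : η ^ 2 + δ ^ 2 ≠ 0 := by positivity
        exact_mod_cast this
      have hτ2' : (τ : ℂ) ^ 2 = 1 := by exact_mod_cast hτ2
      push_cast
      field_simp
      ring_nf
      simp only [I_sq]
      ring_nf
      linear_combination (2 * (δ : ℂ) * η ^ 2 * I * d) * hτ2'
  obtain ⟨hp1, hp2, hp3⟩ := hpt 1 (by simp)
  obtain ⟨hn1, hn2, hn3⟩ := hpt (-1) (by simp)
  have hc := congrArg Complex.im (hconst _ hp1 _ hn1)
  have hsum : 0 < η ^ 2 + δ ^ 2 := by positivity
  have hre : (η ^ 2 - δ ^ 2) / (η ^ 2 + δ ^ 2) < 0 :=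
    div_neg_of_neg_of_pos (by nlinarith) hsum
  set hP := (m + ((1 * η : ℝ) : ℂ) * d - a) / (m + ((1 * η : ℝ) : ℂ) * d - b)
  set hN := (m + ((-1 * η : ℝ) : ℂ) * d - a) / (m + ((-1 * η : ℝ) : ℂ) * d - b)
  have hPre : hP.re < 0 := by
    rw [hp3, add_re, ofReal_re, re_ofReal_mul, I_re, mul_zero, add_zero]; exact hre
  have hNre : hN.re < 0 := by
    rw [hn3, add_re, ofReal_re, re_ofReal_mul, I_re, mul_zero, add_zero]; exact hre
  have hPim : hP.im < 0 := by
    rw [hp3, add_im, ofReal_im, im_ofReal_mul, I_im, mul_one, zero_add]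
    exact div_neg_of_neg_of_pos (by nlinarith [mul_pos hη0 hδ0]) hsum
  have hNim : 0 < hN.im := by
    rw [hn3, add_im, ofReal_im, im_ofReal_mul, I_im, mul_one, zero_add]
    exact div_pos (by nlinarith [mul_pos hη0 hδ0]) hsum
  have hargP : arg hP < -(Real.pi / 2) := by
    by_contra! hle
    have h0 : arg hP < 0 := arg_neg_iff.2 hPim
    have := (abs_arg_le_pi_div_two_iff (z := hP)).1 (by rw [abs_of_neg h0]; linarith)
    linarith
  have hargN : Real.pi / 2 < arg hN := by
    by_contra! hle
    have h0 : 0 ≤ arg hN := arg_nonneg_iff.2 hNim.le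
    have := (abs_arg_le_pi_div_two_iff (z := hN)).1 (by rw [abs_of_nonneg h0]; exact hle)
    linarith
  have a1 := (Complex.abs_im_le_norm _).trans_lt hp2
  have a2 := (Complex.abs_im_le_norm _).trans_lt hn2
  rw [sub_im, abs_lt] at a1 a2
  simp only [sub_im, log_im] at hc
  simp only [hg, sub_im] at a1 a2
  linarith [a1.1, a1.2, a2.1, a2.2]

lemma mem_segment_polar_iff {y C : ℂ} {s φ γ : ℝ} (hC : C - y = ‖C - y‖ * exp (γ * I))
    (hs : 0 < s) (hsC : s < ‖C - y‖) (hφ : |φ - γ| < 2 * Real.pi) :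
    y + s * exp (φ * I) ∈ segment ℝ y C ↔ φ = γ := by
  have hN : 0 < ‖C - y‖ := hs.trans hsC
  rw [segment_eq_image']
  constructor
  · rintro ⟨t, ht, he⟩
    have he' : (s : ℂ) * exp (φ * I) = ((t * ‖C - y‖ : ℝ) : ℂ) * exp (γ * I) := by
      have h1 : t • (C - y) = (s : ℂ) * exp (φ * I) := add_left_cancel he
      rw [← h1, real_smul, ofReal_mul, mul_assoc, ← hC]
    have ht0 : 0 < t := by
      refine ht.1.lt_of_ne ?_
      rintro rfl
      have := congrArg norm he'
      rw [norm_polar hs] at this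
      simp at this
      linarith
    exact eq_of_polar_eq hs (mul_pos ht0 hN) hφ he'
  · rintro rfl
    refine ⟨s / ‖C - y‖, ⟨by positivity, ((div_lt_one hN).2 hsC).le⟩, ?_⟩
    have : (‖C - y‖ : ℂ) ≠ 0 := by exact_mod_cast hN.ne'
    simp only [add_right_inj, real_smul]
    nth_rewrite 2 [hC]
    push_cast
    field_simp

/-- Two segments that leave `y` in different directions form a local arc. -/
lemma exists_isLocalArc {K : Set ℂ} {y A B : ℂ} {r₀ : ℝ} (hr₀ : 0 < r₀) (hA : A ≠ y) (hB : B ≠ y)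
    (hAB : ∀ t : ℝ, 0 < t → B - y ≠ t • (A - y))
    (hloc : ∀ q ∈ ball y r₀, q ∈ K ↔ q ∈ segment ℝ y A ∪ segment ℝ y B) :
    ∃ r α β, IsLocalArc K y r α β ∧
      ((∃ t : ℝ, 0 < t ∧ B - y = -(t • (A - y))) → β = α + Real.pi) := by
  have hpi := Real.pi_pos
  have hAn : 0 < ‖A - y‖ := norm_pos_iff.2 (sub_ne_zero.2 hA)
  have hBn : 0 < ‖B - y‖ := norm_pos_iff.2 (sub_ne_zero.2 hB)
  have hAα : A - y = ‖A - y‖ * exp (arg (A - y) * I) := (norm_mul_exp_arg_mul_I _).symm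
  set α := arg (A - y)
  obtain ⟨β, hβ, hBβ⟩ := exists_polar α (B - y)
  have hA' : (‖A - y‖ : ℂ) ≠ 0 := by exact_mod_cast hAn.ne'
  have hB' : (‖B - y‖ : ℂ) ≠ 0 := by exact_mod_cast hBn.ne'
  have hne : β ≠ α := by
    intro h
    refine hAB (‖B - y‖ / ‖A - y‖) (by positivity) ?_
    rw [real_smul]
    nth_rewrite 1 [hBβ]
    nth_rewrite 2 [hAα]
    rw [h]
    push_cast
    field_simp
  refine ⟨min r₀ (min ‖A - y‖ ‖B - y‖), α, β, ⟨lt_min hr₀ (lt_min hAn hBn),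
    lt_of_le_of_ne hβ.1 hne.symm, hβ.2, ?_, fun s hs φ hφ => ?_⟩, ?_⟩
  · exact (hloc y (mem_ball_self hr₀)).2 (Or.inl (left_mem_segment _ _ _))
  · have h1 : s < r₀ := hs.2.trans_le (min_le_left _ _)
    have h2 : s < ‖A - y‖ := hs.2.trans_le ((min_le_right _ _).trans (min_le_left _ _))
    have h3 : s < ‖B - y‖ := hs.2.trans_le ((min_le_right _ _).trans (min_le_right _ _))
    rw [hloc _ (by rw [mem_ball, dist_eq_norm, add_sub_cancel_left, norm_polar hs.1]; exact h1),
      mem_union, mem_segment_polar_iff hAα hs.1 h2, mem_segment_polar_iff hBβ hs.1 h3]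
    · rw [abs_lt]; constructor <;> linarith [hφ.1, hφ.2, hβ.1, hβ.2]
    · rw [abs_lt]; constructor <;> linarith [hφ.1, hφ.2, hβ.1, hβ.2]
  · rintro ⟨t, ht, he⟩
    refine eq_of_polar_eq (s := ‖B - y‖) (s' := t * ‖A - y‖) hBn (by positivity) ?_ ?_
    · rw [abs_lt]; constructor <;> linarith [hβ.1, hβ.2]
    · rw [← hBβ, he, real_smul]
      nth_rewrite 1 [hAα]
      push_cast
      rw [add_mul, exp_add, exp_pi_mul_I]
      ring

lemma segment_eq_union {A B : ℂ} {τ : ℝ} (hτ : τ ∈ Ioo (0 : ℝ) 1) :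
    segment ℝ A B = segment ℝ (A + τ • (B - A)) A ∪ segment ℝ (A + τ • (B - A)) B := by
  have hm : A + τ • (B - A) ∈ segment ℝ A B := by
    rw [segment_eq_image']
    exact ⟨τ, ⟨hτ.1.le, hτ.2.le⟩, rfl⟩
  apply Subset.antisymm
  · intro q hq
    rw [segment_eq_image'] at hq
    obtain ⟨u, hu, rfl⟩ := hq
    have h0 : (τ : ℂ) ≠ 0 := by exact_mod_cast hτ.1.ne'
    have h1 : (1 - τ : ℂ) ≠ 0 := by
      have : (1 - τ : ℝ) ≠ 0 := by linarith [hτ.2]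
      exact_mod_cast this
    rcases le_total u τ with h | h
    · left
      rw [segment_eq_image']
      refine ⟨(τ - u) / τ, ⟨div_nonneg (by linarith) hτ.1.le, ?_⟩, ?_⟩
      · rw [div_le_one hτ.1]; linarith [hu.1]
      · simp only [real_smul]
        push_cast
        field_simp
        ring
    · right
      rw [segment_eq_image']
      refine ⟨(u - τ) / (1 - τ), ⟨div_nonneg (by linarith) (by linarith [hτ.2]), ?_⟩, ?_⟩
      · rw [div_le_one (by linarith [hτ.2])]; linarith [hu.2]
      · simp only [real_smul]
        push_cast
        field_simp
        ring
  · exact union_subset ((convex_segment A B).segment_subset hm (left_mem_segment _ _ _))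
      ((convex_segment A B).segment_subset hm (right_mem_segment _ _ _))

/-! ### Simple polygons -/

/-- The edge with index `i` of the closed polygonal curve with vertices `p`. -/
def edge {n : ℕ} (p : Fin n → ℂ) (i : Fin n) : Set ℂ := segment ℝ (p i) (p (finRotate n i))

/-- The curve with vertices `p` is simple: its edges have positive length, consecutive edges only
share their common vertex, and other pairs of edges are disjoint. -/
structure IsSimpleCurve {n : ℕ} (p : Fin n → ℂ) : Prop where
  pos : 0 < n
  ne : ∀ i, p i ≠ p (finRotate n i)
  inter : ∀ i, edge p i ∩ edge p (finRotate n i) = {p (finRotate n i)}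
  disjoint : ∀ i j, i ≠ j → j ≠ finRotate n i → i ≠ finRotate n j → Disjoint (edge p i) (edge p j)

lemma exists_iterate_finRotate {n : ℕ} (i j : Fin n) : ∃ k < n, (finRotate n)^[k] i = j := by
  have := i.neZero
  refine ⟨(j - i).val, (j - i).isLt, ?_⟩
  rw [← finCycle_eq_finRotate_iterate]
  simp [finCycle]

lemma iterate_finRotate_ne {n : ℕ} (i : Fin n) {k : ℕ} (hk : k < n) (hk0 : k ≠ 0) :
    (finRotate n)^[k] i ≠ i := by
  have := i.neZero
  have := finCycle_eq_finRotate_iterate (n := n) (k := ⟨k, hk⟩)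
  simp only at this
  rw [← this]
  intro h
  apply hk0
  have h2 : i + ⟨k, hk⟩ = i := by simpa [finCycle] using h
  have h3 : (⟨k, hk⟩ : Fin n) = 0 := by simpa using h2
  have h4 := congrArg Fin.val h3
  simpa using h4

lemma iterate_finRotate_self {n : ℕ} (i : Fin n) : (finRotate n)^[n] i = i := by
  obtain ⟨k, hk, he⟩ := exists_iterate_finRotate (finRotate n i) i
  rw [← Function.iterate_succ_apply] at he
  rcases (Nat.succ_le_of_lt hk).lt_or_eq with h | h
  · exact absurd he (iterate_finRotate_ne i h (Nat.succ_ne_zero k))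
  · exact (congrArg (fun m => (⇑(finRotate n))^[m] i) h).symm.trans he

section

variable {n : ℕ} {p : Fin n → ℂ}

lemma isCompact_edge (i : Fin n) : IsCompact (edge p i) := by
  rw [edge, segment_eq_image]
  exact isCompact_Icc.image (by fun_prop)

lemma isCompact_iUnion_edge : IsCompact (⋃ i, edge p i) := isCompact_iUnion isCompact_edge

lemma isPreconnected_iUnion_edge (hn : 0 < n) : IsPreconnected (⋃ i, edge p i) := by
  set i : Fin n := ⟨0, hn⟩
  have h : (⋃ i, edge p i) = ⋃ k ∈ (univ : Set ℕ), edge p ((finRotate n)^[k] i) := by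
    apply Subset.antisymm
    · refine iUnion_subset fun j => ?_
      obtain ⟨k, -, rfl⟩ := exists_iterate_finRotate i j
      exact subset_biUnion_of_mem (u := fun k => edge p ((finRotate n)^[k] i)) (mem_univ k)
    · exact iUnion₂_subset fun k _ => subset_iUnion (edge p) _
  rw [h]
  refine IsPreconnected.biUnion_of_chain ordConnected_univ
    (fun k _ => (convex_segment _ _).isPreconnected) fun k _ _ => ?_
  refine ⟨p ((finRotate n)^[k + 1] i), ?_, left_mem_segment _ _ _⟩
  rw [Function.iterate_succ_apply']
  exact right_mem_segment _ _ _

/-- A point of an edge that is not a vertex lies on no other edge. -/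
lemma IsSimpleCurve.notMem_edge (hp : IsSimpleCurve p) {i j : Fin n} {m : ℂ} (hm : m ∈ edge p i)
    (hmv : ∀ k, m ≠ p k) (hij : j ≠ i) : m ∉ edge p j := by
  intro hmj
  by_cases h1 : j = finRotate n i
  · subst h1
    have : m ∈ edge p i ∩ edge p (finRotate n i) := ⟨hm, hmj⟩
    rw [hp.inter] at this
    exact hmv _ this
  by_cases h2 : i = finRotate n j
  · subst h2
    have : m ∈ edge p j ∩ edge p (finRotate n j) := ⟨hmj, hm⟩
    rw [hp.inter] at this
    exact hmv _ this
  exact Set.disjoint_left.1 (hp.disjoint i j hij.symm h1 h2) hm hmj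

/-- A vertex lies on no edges but the two that end there. -/
lemma IsSimpleCurve.vertex_notMem_edge (hp : IsSimpleCurve p) {i k : Fin n} (hki : k ≠ i)
    (hkj : k ≠ finRotate n i) : p (finRotate n i) ∉ edge p k := by
  set j := finRotate n i with hj
  intro h
  by_cases h2 : k = finRotate n j
  · subst h2
    have : p j ∈ edge p j ∩ edge p (finRotate n j) := ⟨left_mem_segment _ _ _, h⟩
    rw [hp.inter] at this
    exact hp.ne j this
  refine Set.disjoint_left.1 (hp.disjoint k j hkj ?_ h2) h (left_mem_segment _ _ _)
  intro h3
  exact hki ((finRotate n).injective (h3.symm.trans hj))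

/-- Close to a point, the curve coincides with its edges through this point. -/
lemma exists_ball_iff {y : ℂ} {J : Set (Fin n)} (hJ : ∀ k ∉ J, y ∉ edge p k) :
    ∃ r : ℝ, 0 < r ∧ ∀ q ∈ ball y r, q ∈ (⋃ i, edge p i) ↔ q ∈ ⋃ i ∈ J, edge p i := by
  have hcl : IsClosed (⋃ k ∈ Jᶜ, edge p k) :=
    (Set.toFinite Jᶜ).isClosed_biUnion fun k _ => (isCompact_edge k).isClosed
  have hy : y ∉ ⋃ k ∈ Jᶜ, edge p k := by
    intro h
    obtain ⟨k, hk, hyk⟩ := mem_iUnion₂.1 h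
    exact hJ k hk hyk
  obtain ⟨r, hr, hsub⟩ := Metric.isOpen_iff.1 hcl.isOpen_compl y hy
  refine ⟨r, hr, fun q hq => ⟨fun h => ?_, fun h => ?_⟩⟩
  · obtain ⟨k, hk⟩ := mem_iUnion.1 h
    by_cases hkJ : k ∈ J
    · exact mem_iUnion₂.2 ⟨k, hkJ, hk⟩
    · exact absurd (mem_iUnion₂.2 ⟨k, hkJ, hk⟩) (hsub hq)
  · obtain ⟨k, -, hk⟩ := mem_iUnion₂.1 h
    exact mem_iUnion.2 ⟨k, hk⟩

/-- Position of a point of an edge that is not a vertex. -/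
lemma exists_eq_of_mem_edge {i : Fin n} {m : ℂ} (hm : m ∈ edge p i) (hmv : ∀ k, m ≠ p k) :
    ∃ τ ∈ Ioo (0 : ℝ) 1, m = p i + τ • (p (finRotate n i) - p i) := by
  rw [edge, segment_eq_image'] at hm
  obtain ⟨τ, hτ, rfl⟩ := hm
  refine ⟨τ, ⟨hτ.1.lt_of_ne ?_, hτ.2.lt_of_ne ?_⟩, rfl⟩
  · rintro rfl
    exact hmv i (by simp)
  · rintro rfl
    exact hmv (finRotate n i) (by simp)

lemma isPreconnected_punctured_segment (m C : ℂ) :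
    IsPreconnected (segment ℝ m C \ {m}) := by
  rcases eq_or_ne C m with rfl | hC
  · simpa using isPreconnected_empty
  have h : segment ℝ m C \ {m} = (fun t : ℝ => m + t • (C - m)) '' Ioc 0 1 := by
    ext q
    rw [segment_eq_image']
    constructor
    · rintro ⟨⟨t, ht, rfl⟩, hne⟩
      refine ⟨t, ⟨ht.1.lt_of_ne ?_, ht.2⟩, rfl⟩
      rintro rfl
      simp at hne
    · rintro ⟨t, ht, rfl⟩
      refine ⟨⟨t, ⟨ht.1.le, ht.2⟩, rfl⟩, ?_⟩
      simp [ht.1.ne', sub_ne_zero.2 hC]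
  rw [h]
  exact isPreconnected_Ioc.image _ (by fun_prop)

/-- A simple closed polygonal curve stays connected after removal of a point of an edge. -/
lemma IsSimpleCurve.isPreconnected_sdiff (hp : IsSimpleCurve p) {i : Fin n} {m : ℂ}
    (hm : m ∈ edge p i) (hmv : ∀ k, m ≠ p k) : IsPreconnected ((⋃ i, edge p i) \ {m}) := by
  obtain ⟨τ, hτ, hmτ⟩ := exists_eq_of_mem_edge hm hmv
  have hsplit : edge p i = segment ℝ m (p i) ∪ segment ℝ m (p (finRotate n i)) := by
    rw [hmτ]
    exact segment_eq_union hτ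
  -- the chain: the second part of the edge, the other edges in cyclic order, the first part
  set s : ℕ → Set ℂ := fun k =>
    if k = 0 then segment ℝ m (p (finRotate n i)) \ {m}
    else if k = n then segment ℝ m (p i) \ {m} else edge p ((finRotate n)^[k] i) with hs
  have hn := hp.pos
  have hs0 : s 0 = segment ℝ m (p (finRotate n i)) \ {m} := by simp [hs]
  have hsn : s n = segment ℝ m (p i) \ {m} := by simp [hs, hn.ne']
  have hsk : ∀ k, k ≠ 0 → k ≠ n → s k = edge p ((finRotate n)^[k] i) := by
    intro k h0 h1
    simp [hs, h0, h1]
  have heq : (⋃ i, edge p i) \ {m} = ⋃ k ∈ Iic n, s k := by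
    apply Subset.antisymm
    · rintro q ⟨hq, hqm⟩
      obtain ⟨j, hqj⟩ := mem_iUnion.1 hq
      obtain ⟨k, hk, rfl⟩ := exists_iterate_finRotate i j
      rcases eq_or_ne k 0 with rfl | hk0
      · rw [Function.iterate_zero, id, hsplit] at hqj
        rcases hqj with h | h
        · exact mem_iUnion₂.2 ⟨n, mem_Iic.2 le_rfl, by rw [hsn]; exact ⟨h, hqm⟩⟩
        · exact mem_iUnion₂.2 ⟨0, mem_Iic.2 (Nat.zero_le n), by rw [hs0]; exact ⟨h, hqm⟩⟩
      · exact mem_iUnion₂.2 ⟨k, mem_Iic.2 hk.le, by rw [hsk k hk0 hk.ne]; exact hqj⟩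
    · refine iUnion₂_subset fun k hk => ?_
      rcases eq_or_ne k 0 with rfl | hk0
      · rw [hs0]
        refine sdiff_subset_sdiff_left (subset_iUnion_of_subset i ?_)
        rw [hsplit]
        exact subset_union_right
      rcases eq_or_ne k n with rfl | hkn
      · rw [hsn]
        refine sdiff_subset_sdiff_left (subset_iUnion_of_subset i ?_)
        rw [hsplit]
        exact subset_union_left
      · rw [hsk k hk0 hkn]
        intro q hq
        refine ⟨mem_iUnion.2 ⟨_, hq⟩, ?_⟩
        rintro rfl
        exact hp.notMem_edge hm hmv
          (iterate_finRotate_ne i (lt_of_le_of_ne hk hkn) hk0) hq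
  rw [heq]
  have hend : ∀ k, k ≤ n → k ≠ 0 → p ((finRotate n)^[k] i) ∈ s k := by
    intro k hk hk0
    rcases eq_or_ne k n with rfl | hkn
    · rw [hsn, iterate_finRotate_self]
      exact ⟨right_mem_segment _ _ _, (hmv i).symm⟩
    · rw [hsk k hk0 hkn]
      exact left_mem_segment _ _ _
  refine IsPreconnected.biUnion_of_chain ordConnected_Iic (fun k _ => ?_) fun k hk hk' => ?_
  · rcases eq_or_ne k 0 with rfl | hk0
    · rw [hs0]
      exact isPreconnected_punctured_segment _ _
    rcases eq_or_ne k n with rfl | hkn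
    · rw [hsn]
      exact isPreconnected_punctured_segment _ _
    · rw [hsk k hk0 hkn]
      exact (convex_segment _ _).isPreconnected
  · refine ⟨p ((finRotate n)^[k + 1] i), ?_, hend (k + 1) hk' (Nat.succ_ne_zero k)⟩
    have hkn : k ≠ n := fun h => by
      rw [h] at hk'
      exact absurd (mem_Iic.1 hk') (Nat.not_succ_le_self n)
    rcases eq_or_ne k 0 with rfl | hk0
    · rw [hs0]
      exact ⟨right_mem_segment _ _ _, (hmv _).symm⟩
    · rw [hsk k hk0 hkn, Function.iterate_succ_apply']
      exact right_mem_segment _ _ _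

lemma IsSimpleCurve.exists_isLocalArc (hp : IsSimpleCurve p) {y : ℂ} (hy : y ∈ ⋃ i, edge p i) :
    ∃ r α β, IsLocalArc (⋃ i, edge p i) y r α β ∧ ((∀ k, y ≠ p k) → β = α + Real.pi) := by
  by_cases hyv : ∀ k, y ≠ p k
  · obtain ⟨i, hi⟩ := mem_iUnion.1 hy
    obtain ⟨τ, hτ, hyτ⟩ := exists_eq_of_mem_edge hi hyv
    obtain ⟨r₀, hr₀, hloc⟩ := exists_ball_iff (p := p) (y := y) (J := {i})
      fun k hk => hp.notMem_edge hi hyv hk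
    set d := p (finRotate n i) - p i with hd
    have hd0 : d ≠ 0 := sub_ne_zero.2 (hp.ne i).symm
    have hA : p i - y = -(τ • d) := by rw [hyτ]; ring
    have hB : p (finRotate n i) - y = (1 - τ) • d := by
      rw [hyτ, sub_smul, one_smul, hd]; ring
    have hdir : ∀ t : ℝ, 0 < t → p (finRotate n i) - y ≠ t • (p i - y) := fun t ht he => by
      rw [hA, hB, smul_neg, smul_smul, eq_neg_iff_add_eq_zero, ← add_smul] at he
      rcases smul_eq_zero.1 he with h0 | h0
      · nlinarith [mul_pos ht hτ.1, hτ.2]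
      · exact hd0 h0
    have hseg : ∀ q ∈ ball y r₀, q ∈ (⋃ i, edge p i) ↔
        q ∈ segment ℝ y (p i) ∪ segment ℝ y (p (finRotate n i)) := fun q hq => by
      rw [hloc q hq]
      simp only [mem_singleton_iff, iUnion_iUnion_eq_left]
      rw [edge, segment_eq_union hτ, ← hd, ← hyτ]
    obtain ⟨r, α, β, h, hopp⟩ := ChromaticGuarding.exists_isLocalArc hr₀ (hyv i).symm
      (hyv (finRotate n i)).symm hdir hseg
    refine ⟨r, α, β, h, fun _ => hopp ⟨(1 - τ) / τ, div_pos (by linarith [hτ.2]) hτ.1, ?_⟩⟩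
    rw [hA, hB, smul_neg, neg_neg, smul_smul, div_mul_cancel₀ _ hτ.1.ne']
  · push Not at hyv
    obtain ⟨j, rfl⟩ := hyv
    obtain ⟨i, rfl⟩ := (finRotate n).surjective j
    set j := finRotate n i with hj
    obtain ⟨r₀, hr₀, hloc⟩ := exists_ball_iff (p := p) (y := p j) (J := {i, j}) fun k hk => by
      simp only [mem_insert_iff, mem_singleton_iff, not_or] at hk
      exact hp.vertex_notMem_edge hk.1 hk.2
    have hdir : ∀ t : ℝ, 0 < t → p (finRotate n j) - p j ≠ t • (p i - p j) := fun t ht he => by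
      -- edges in the same direction would share more than the vertex
      rcases le_total t 1 with h1 | h1
      · have hB : p (finRotate n j) ∈ edge p i ∩ edge p j := by
          refine ⟨?_, right_mem_segment _ _ _⟩
          rw [edge, segment_symm, ← hj, segment_eq_image']
          exact ⟨t, ⟨ht.le, h1⟩, by simp only; rw [← he]; ring⟩
        rw [hj, hp.inter] at hB
        exact hp.ne j hB.symm
      · have hA : p i ∈ edge p i ∩ edge p j := by
          refine ⟨left_mem_segment _ _ _, ?_⟩
          rw [edge, segment_eq_image']
          refine ⟨t⁻¹, ⟨by positivity, inv_le_one_of_one_le₀ h1⟩, ?_⟩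
          simp only
          rw [he, smul_smul, inv_mul_cancel₀ ht.ne', one_smul]
          ring
        rw [hj, hp.inter] at hA
        exact hp.ne i hA
    have hseg : ∀ q ∈ ball (p j) r₀, q ∈ (⋃ i, edge p i) ↔
        q ∈ segment ℝ (p j) (p i) ∪ segment ℝ (p j) (p (finRotate n j)) := fun q hq => by
      rw [hloc q hq]
      simp only [mem_insert_iff, mem_singleton_iff, iUnion_iUnion_eq_or_left,
        iUnion_iUnion_eq_left]
      rw [edge, edge, ← hj, segment_symm ℝ (p i)]
    obtain ⟨r, α, β, h, -⟩ := ChromaticGuarding.exists_isLocalArc hr₀ (hp.ne i) (hp.ne j).symm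
      hdir hseg
    exact ⟨r, α, β, h, fun hv => absurd rfl (hv j)⟩

lemma IsSimpleCurve.exists_mem_fill (hp : IsSimpleCurve p) {m : ℂ} (hm : m ∈ ⋃ i, edge p i)
    (hmv : ∀ k, m ≠ p k) {ε : ℝ} (hε : 0 < ε) :
    ∃ q ∈ ball m ε, q ∉ (⋃ i, edge p i) ∧ q ∈ fill (⋃ i, edge p i) := by
  obtain ⟨i, hi⟩ := mem_iUnion.1 hm
  obtain ⟨τ, hτ, hmτ⟩ := exists_eq_of_mem_edge hi hmv
  obtain ⟨r₀, hr₀, hloc⟩ := exists_ball_iff (p := p) (y := m) (J := {i})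
    fun k hk => hp.notMem_edge hi hmv hk
  set d := p (finRotate n i) - p i with hd
  have hd0 : d ≠ 0 := sub_ne_zero.2 (hp.ne i).symm
  have hdn : 0 < ‖d‖ := norm_pos_iff.2 hd0
  refine exists_mem_fill_near (d := d) (r := min (r₀ / ‖d‖) (min τ (1 - τ)))
    isCompact_iUnion_edge hd0
    (lt_min (by positivity) (lt_min hτ.1 (by linarith [hτ.2]))) hm
    (hp.isPreconnected_sdiff hi hmv) (fun ζ hζ => ?_) hε
  have h1 : ‖ζ‖ < r₀ / ‖d‖ := hζ.trans_le (min_le_left _ _)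
  have h2 : ‖ζ‖ < τ := hζ.trans_le ((min_le_right _ _).trans (min_le_left _ _))
  have h3 : ‖ζ‖ < 1 - τ := hζ.trans_le ((min_le_right _ _).trans (min_le_right _ _))
  rw [hloc]
  · simp only [mem_singleton_iff, iUnion_iUnion_eq_left]
    rw [edge, segment_eq_image', ← hd]
    constructor
    · rintro ⟨u, hu, he⟩
      have : ((u - τ : ℝ) : ℂ) = ζ := by
        have h0 : ((u - τ : ℝ) : ℂ) * d = ζ * d := by
          rw [hmτ] at he
          simp only [real_smul] at he
          push_cast
          linear_combination he
        exact mul_right_cancel₀ hd0 h0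
      rw [← this]
      exact ofReal_im _
    · intro him
      have hre : ((ζ.re : ℝ) : ℂ) = ζ := Complex.ext (by simp) (by simp [him])
      have habs := abs_lt.1 ((Complex.abs_re_le_norm ζ).trans_lt h2)
      have habs' := abs_lt.1 ((Complex.abs_re_le_norm ζ).trans_lt h3)
      refine ⟨τ + ζ.re, ⟨by linarith [habs.1], by linarith [habs'.2]⟩, ?_⟩
      rw [hmτ]
      simp only [real_smul]
      push_cast
      rw [hre]
      ring
  · rw [mem_ball, dist_eq_norm, add_sub_cancel_left, norm_mul]
    rwa [lt_div_iff₀ hdn] at h1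

/-- The construction of guards applies to the region enclosed by a simple polygon, with `W` the
set of its vertices. -/
theorem IsSimpleCurve.isPolygonal (hp : IsSimpleCurve p) :
    IsPolygonal (fill (⋃ i, edge p i)) (Finset.univ.image p) := by
  have hW : ∀ y : ℂ, y ∉ Finset.univ.image p ↔ ∀ k, y ≠ p k := by
    intro y
    simp [eq_comm]
  refine isPolygonal_fill isCompact_iUnion_edge (isPreconnected_iUnion_edge hp.pos)
    ⟨p ⟨0, hp.pos⟩, mem_iUnion.2 ⟨⟨0, hp.pos⟩, left_mem_segment _ _ _⟩⟩ (fun y hy => ?_)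
    fun m hm hmW ε hε => hp.exists_mem_fill hm ((hW m).1 hmW) hε
  obtain ⟨r, α, β, h, hβ⟩ := hp.exists_isLocalArc hy
  exact ⟨r, α, β, h, fun hyW => hβ ((hW y).1 hyW)⟩

end

lemma image_toPlane_fill (K : Set ℂ) :
    toPlane '' fill K = (toPlane '' K) ∪ {x | x ∉ toPlane '' K ∧
      Bornology.IsBounded (connectedComponentIn (toPlane '' K)ᶜ x)} := by
  ext q
  obtain ⟨z, rfl⟩ := toPlane.surjective q
  rw [toPlane.injective.mem_set_image]
  simp only [fill, mem_union, mem_ofPred_eq, toPlane.injective.mem_set_image]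
  refine or_congr_right (and_congr_right fun hz => ?_)
  have h1 : (toPlane '' K)ᶜ = toPlane.toHomeomorph '' Kᶜ :=
    (image_compl_eq toPlane.bijective).symm
  have h2 : toPlane.toHomeomorph '' connectedComponentIn Kᶜ z =
      connectedComponentIn (toPlane.toHomeomorph '' Kᶜ) (toPlane.toHomeomorph z) :=
    toPlane.toHomeomorph.image_connectedComponentIn hz
  have h3 : connectedComponentIn (toPlane '' K)ᶜ (toPlane z) =
      toPlane '' connectedComponentIn Kᶜ z := by
    rw [h1]
    exact h2.symm
  rw [h3]
  constructor
  · exact fun h => toPlane.lipschitz.isBounded_image h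
  · intro h
    have := toPlane.symm.lipschitz.isBounded_image h
    rwa [← image_comp, show (toPlane.symm ∘ toPlane : ℂ → ℂ) = id from
      funext toPlane.symm_apply_apply, image_id] at this

end ChromaticGuarding

theorem mainTheorem4 {n : ℕ} (poly : Polygon ChromaticGuarding.Plane n)
    (hpoly : ChromaticGuarding.IsSimple poly) :
    ChromaticGuarding.chromaticGuardingNumber (ChromaticGuarding.region poly) 180 = 1 ∧
      ∀ α : ℝ, 0 < α → α ≤ 180 →
        ChromaticGuarding.chromaticGuardingNumber (ChromaticGuarding.region poly) α ≤ 2 := by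
  open ChromaticGuarding Set in
  obtain ⟨hn, hne, hint, hdis⟩ := hpoly
  set p : Fin n → ℂ := fun i => toPlane.symm (poly i) with hp
  have hedge : ∀ i, toPlane '' edge p i = poly.edgeSet ℝ i := by
    intro i
    rw [edge, image_toPlane_segment, Polygon.edgeSet, affineSegment_eq_segment]
    simp [hp]
  have hcurve : IsSimpleCurve p := by
    refine ⟨by omega, fun i h => hne i (toPlane.symm.injective h), fun i => ?_,
      fun i j h1 h2 h3 => ?_⟩
    · apply toPlane.injective.image_injective
      rw [image_inter toPlane.injective, hedge, hedge, hint, image_singleton]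
      simp [hp]
    · rw [← disjoint_image_iff toPlane.injective, hedge, hedge]
      exact hdis i j h1 h2 h3
  have hregion : region poly = toPlane '' fill (⋃ i, edge p i) := by
    rw [image_toPlane_fill, image_iUnion, iUnion_congr hedge]
    rfl
  rw [hregion]
  refine hcurve.isPolygonal.chromaticGuardingNumber ⟨p ⟨0, hcurve.pos⟩, subset_fill _ ?_⟩
  exact mem_iUnion.2 ⟨⟨0, hcurve.pos⟩, left_mem_segment _ _ _⟩
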